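/- Let $H$ be a separable complex Hilbert space ($\dim H\le\infty$), $n\ge 1$, $0<b\le\infty$, and let $\Delta=[0,b\rangle$ be an interval with left end point $0\in\Delta$ and right end point $b$ (if $b<\infty$, then $b$ may or may not belong to $\Delta$). Write $[H]$ for the bounded operators on $H$, scalar products being linear in the first argument. Let $$l[y]=\sum_{k=1}^n(-1)^k\Bigl((p_{n-k}y^{(k)})^{(k)}-\tfrac i2\bigl[(q_{n-k}^*y^{(k)})^{(k-1)}+(q_{n-k}y^{(k-1)})^{(k)}\bigr]\Bigr)+p_ny,$$ where $p_0,\dots,p_n,\,q_0,\dots,q_{n-1}:\Delta\to[H]$ are norm continuous, $p_k(t)=p_k(t)^*$, and $p_0(t)$ has a bounded inverse for every $t\in\Delta$. The expression is understood as $l[y]=y^{[2n]}$ through the quasi-derivatives $y^{[k]}=y^{(k)}$ ($0\le k\le n-1$), $y^{[n]}=p_0y^{(n)}-\tfrac i2q_0y^{(n-1)}$ and, for $1\le j\le n$, $$y^{[n+j]}=-(y^{[n+j-1]})'+p_jy^{(n-j)}+\tfrac i2\bigl(q_{j-1}^*y^{(n-j+1)}-q_jy^{(n-j-1)}\bigr),$$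 the term with $q_j$ being absent for $j=n$; the same formulas are used for operator functions $Y:\Delta\to[\mathcal K,H]$. (If the coefficients are sufficiently smooth, this is the displayed expression.) Put $y^{(1)}(t)=(y^{[0]}(t),\dots,y^{[n-1]}(t))\in H^n$ and $y^{(2)}(t)=(y^{[2n-1]}(t),\dots,y^{[n]}(t))\in H^n$ (in this notation $(1),(2)$ do not denote derivatives), and $$[y,z](t)=(y^{(1)}(t),z^{(2)}(t))_{H^n}-(y^{(2)}(t),z^{(1)}(t))_{H^n},\qquad [y,z](b)=\lim_{t\uparrow b}[y,z](t).$$ Let $\mathcal D$ be the set of all $y\in L_2(\Delta;H)$ such that $y^{[k]}$, $0\le k\le 2n-2$, has a continuous derivative on $\Delta$, $y^{[2n-1]}$ is absolutely continuous on compact subintervals of $\Delta$, and $l[y]\in L_2(\Delta;H)$. The minimal operator $L_0$ acts by $L_0y=l[y]$ on the set of all $y\in\mathcal D$ with $y^{(1)}(0)=y^{(2)}(0)=0$ and $[y,z](b)=0$ for all $z\in\mathcal D$. For a selfadjoint linear relation $\theta=\theta^*$ in $H^n$ let $L_\theta y=l[y]$ on the set of all $y\in\mathcal D$ with $(y^{(1)}(0),y^{(2)}(0))\in\theta$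 and $[y,z](b)=0$ for all $z\in\mathcal D$. For a symmetric operator $T$ put $n_\pm(T)=\dim\operatorname{Ker}(T^*\mp i)$. The deficiency indices of $l[y]$ at $b$ are $n_{b\pm}:=n_\pm(L_\theta)$, where $\theta$ is any selfadjoint linear relation in $H^n$. A selfadjoint operator pair is a pair $K=(K_0,K_1)$ of bounded operators on $H^n$ such that $K_0h=K_1h=0$ only for $h=0$ and $\{(K_0h,K_1h):h\in H^n\}$ is a selfadjoint linear relation in $H^n$. For such a pair and $\lambda\in\mathbb C$ let $\varphi_K(\cdot,\lambda):\Delta\to[H^n,H]$ be the operator solution of $l[y]-\lambda y=0$ with the initial data $\varphi_K^{(1)}(0,\lambda)=K_0$, $\varphi_K^{(2)}(0,\lambda)=K_1$ (its quasi-derivatives of orders $0,\dots,2n-1$ have continuous derivatives on $\Delta$). Proposition 3.14. For every such expression, and for every selfadjoint linear relation $\theta$ in $H^n$ used to compute $n_{b\pm}$, the following statements are equivalent: (i) $n_{b+}=n_{b-}=0$; (ii) there exist a selfadjoint operator pair $K$ and points $\lambda\in\mathbb C_+$, $\mu\in\mathbb C_-$ such that $$\int_0^b\|\varphi_K(t,\lambda)\hat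 h\|^2\,dt=\int_0^b\|\varphi_K(t,\mu)\hat h\|^2\,dt=\infty\qquad\text{for all }\hat h\in H^n,\ \hat h\ne0;$$ (iii) for every selfadjoint operator pair $K$ and every $\lambda\in\mathbb C\setminus\mathbb R$ one has $\int_0^b\|\varphi_K(t,\lambda)\hat h\|^2\,dt=\infty$ for all $\hat h\in H^n$, $\hat h\neq0$. If in addition $\dim H<\infty$, then (i)–(iii) are equivalent to the equalities $n_+(L_0)=n_-(L_0)=n\cdot\dim H$. -/

import Mathlib

open MeasureTheory Set Filter Topology

noncomputable section

/-- The Hilbert space `H^n` (orthogonal sum of `n` copies of `H`). -/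
abbrev HilbertPow (H : Type*) (n : ℕ) : Type _ := PiLp 2 (fun _ : Fin n => H)

/-- The data of a formally selfadjoint differential expression of even order `2n`
`l[y] = ∑_{k=1}^n (-1)^k ((p_{n-k} y^{(k)})^{(k)}
  - (i/2) [(q_{n-k}^* y^{(k)})^{(k-1)} + (q_{n-k} y^{(k-1)})^{(k)}]) + p_n y`
on `Δ = [0, b⟩`, `0 < b ≤ ∞`, with coefficients in the bounded operators on `H`.
The right end point `b` may or may not belong to `Δ` (for `b = ∞` the two alternatives in
`interval_eq` coincide). Of `p` and `q` only `p 0, …, p n` and `q 0, …, q (n-1)` on `Δ` matter.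
Since `l[y]` is expressed through quasi-derivatives, norm continuity is all the smoothness of the
coefficients that is needed. -/
structure DiffExpr (H : Type*) [NormedAddCommGroup H] [InnerProductSpace ℂ H] [CompleteSpace H]
    (n : ℕ) where
  n_pos : 0 < n
  /-- the right end point -/
  b : EReal
  b_pos : 0 < b
  /-- the interval `[0, b⟩` -/
  interval : Set ℝ
  interval_eq : interval = {t : ℝ | 0 ≤ t ∧ (t : EReal) < b} ∨
    interval = {t : ℝ | 0 ≤ t ∧ (t : EReal) ≤ b}
  p : ℕ → ℝ → (H →L[ℂ] H)
  q : ℕ → ℝ → (H →L[ℂ] H)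
  p_continuousOn : ∀ k ≤ n, ContinuousOn (p k) interval
  q_continuousOn : ∀ k < n, ContinuousOn (q k) interval
  p_selfAdjoint : ∀ k ≤ n, ∀ t ∈ interval, IsSelfAdjoint (p k t)
  p_zero_isUnit : ∀ t ∈ interval, IsUnit (p 0 t)

/-- `f` is (locally) absolutely continuous on the interval `Δ ∋ 0`: it is an indefinite integral of
a locally integrable function. For functions with values in a Hilbert space (which has the
Radon–Nikodym property) this is the same as the `ε`-`δ` definition on compact subintervals. -/
def IsLocAC {E : Type*} [NormedAddCommGroup E] [NormedSpace ℝ E] (f : ℝ → E) (Δ : Set ℝ) : Prop :=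
  ∃ g : ℝ → E, LocallyIntegrableOn g Δ ∧ ∀ t ∈ Δ, f t = f 0 + ∫ s in (0 : ℝ)..t, g s

namespace DiffExpr

section QuasiDerivatives

/-! The quasi-derivatives are given by the same formulas for vector functions (`E = H`, with
`A • x = A x`) and for operator functions (`E = (𝒦 →L[ℂ] H)`, with `A • Y = A ∘ Y`). -/

variable {H : Type*} [NormedAddCommGroup H] [InnerProductSpace ℂ H] [CompleteSpace H] {n : ℕ}
variable {E : Type*} [NormedAddCommGroup E] [NormedSpace ℂ E] [Module (H →L[ℂ] H) E]

/-- The quasi-derivatives `y^{[n+j]}`, `0 ≤ j ≤ n`: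
`y^{[n]} = p_0 y^{(n)} - (i/2) q_0 y^{(n-1)}` and, for `1 ≤ j ≤ n`,
`y^{[n+j]} = -(y^{[n+j-1]})' + p_j y^{(n-j)} + (i/2) (q_{j-1}^* y^{(n-j+1)} - q_j y^{(n-j-1)})`,
where the last term is absent for `j = n`. -/
def quasiDerivUpper (l : DiffExpr H n) (y : ℝ → E) : ℕ → ℝ → E
  | 0 => fun t =>
      l.p 0 t • iteratedDerivWithin n y l.interval t
        - (Complex.I / 2) • (l.q 0 t • iteratedDerivWithin (n - 1) y l.interval t)
  | j + 1 => fun t =>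
      -derivWithin (quasiDerivUpper l y j) l.interval t
        + (l.p (j + 1) t • iteratedDerivWithin (n - (j + 1)) y l.interval t
          + (Complex.I / 2) • ((l.q j t).adjoint • iteratedDerivWithin (n - j) y l.interval t)
          - (if j + 1 < n then
              (Complex.I / 2) •
                (l.q (j + 1) t • iteratedDerivWithin (n - (j + 2)) y l.interval t)
            else 0))

/-- The quasi-derivatives `y^{[k]}`, `0 ≤ k ≤ 2n`; `y^{[k]} = y^{(k)}` for `k < n`. -/
def quasiDeriv (l : DiffExpr H n) (y : ℝ → E) (k : ℕ) : ℝ → E :=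
  if k < n then iteratedDerivWithin k y l.interval else l.quasiDerivUpper y (k - n)

/-- `l[y] = y^{[2n]}`. -/
def expr (l : DiffExpr H n) (y : ℝ → E) : ℝ → E := l.quasiDeriv y (2 * n)

end QuasiDerivatives

variable {H : Type*} [NormedAddCommGroup H] [InnerProductSpace ℂ H] [CompleteSpace H] {n : ℕ}

/-- The vector `y^{(1)}(t) = (y^{[0]}(t), …, y^{[n-1]}(t)) ∈ H^n`. -/
def vec1 (l : DiffExpr H n) (y : ℝ → H) (t : ℝ) : HilbertPow H n :=
  WithLp.toLp 2 fun k : Fin n => l.quasiDeriv y k t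

/-- The vector `y^{(2)}(t) = (y^{[2n-1]}(t), …, y^{[n]}(t)) ∈ H^n`. -/
def vec2 (l : DiffExpr H n) (y : ℝ → H) (t : ℝ) : HilbertPow H n :=
  WithLp.toLp 2 fun k : Fin n => l.quasiDeriv y (2 * n - (k + 1)) t

/-- The form `[y,z](t) = (y^{(1)}(t), z^{(2)}(t)) - (y^{(2)}(t), z^{(1)}(t))`, where the scalar
product is linear in its first argument (Mathlib's `inner` is linear in the second one). -/
def bracket (l : DiffExpr H n) (y z : ℝ → H) (t : ℝ) : ℂ :=
  inner ℂ (l.vec2 z t) (l.vec1 y t) - inner ℂ (l.vec1 z t) (l.vec2 y t)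

/-- The filter `t ↑ b`. -/
def atEnd (l : DiffExpr H n) : Filter ℝ := comap (fun t : ℝ => (t : EReal)) (𝓝[<] l.b)

/-- Lebesgue measure on `Δ`. -/
def measure (l : DiffExpr H n) : Measure ℝ := volume.restrict l.interval

/-- The Hilbert space `L₂(Δ; H)`. -/
abbrev L2 (l : DiffExpr H n) : Type _ := Lp H 2 l.measure

/-- The set `𝒟(l)`: `y^{[k]}`, `0 ≤ k ≤ 2n-2`, has a continuous derivative on `Δ` and `y^{[2n-1]}`
is absolutely continuous on `Δ`. -/
structure MemDomExpr (l : DiffExpr H n) (y : ℝ → H) : Prop where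
  contDiffOn : ∀ k, k + 1 < 2 * n → ContDiffOn ℝ 1 (l.quasiDeriv y k) l.interval
  locAC : IsLocAC (l.quasiDeriv y (2 * n - 1)) l.interval

/-- The domain `𝒟` of the maximal operator `L`: `y ∈ 𝒟(l) ∩ L₂(Δ; H)` with `l[y] ∈ L₂(Δ; H)`. -/
structure MemMaxDom (l : DiffExpr H n) (y : ℝ → H) : Prop where
  memDomExpr : l.MemDomExpr y
  memLp : MemLp y 2 l.measure
  expr_memLp : MemLp (l.expr y) 2 l.measure

/-- `[y,z](b) = lim_{t ↑ b} [y,z](t) = 0` for all `z ∈ 𝒟`. -/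
def VanishesAtEnd (l : DiffExpr H n) (y : ℝ → H) : Prop :=
  ∀ z : ℝ → H, l.MemMaxDom z → Tendsto (l.bracket y z) l.atEnd (𝓝 0)

section Linearity

variable (l : DiffExpr H n)

lemma zero_mem_interval : (0 : ℝ) ∈ l.interval := by
  rcases l.interval_eq with h | h <;> rw [h]
  · exact ⟨le_rfl, by simpa using l.b_pos⟩
  · exact ⟨le_rfl, by simpa using l.b_pos.le⟩

lemma nonneg_of_mem {t : ℝ} (ht : t ∈ l.interval) : 0 ≤ t := by
  rcases l.interval_eq with h | h <;> rw [h] at ht <;> exact ht.1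

lemma ordConnected_interval : l.interval.OrdConnected := by
  refine ⟨fun x hx y hy z hz => ?_⟩
  rcases l.interval_eq with h | h <;> rw [h] at hx hy ⊢
  · exact ⟨hx.1.trans hz.1, lt_of_le_of_lt (by exact_mod_cast hz.2) hy.2⟩
  · exact ⟨hx.1.trans hz.1, le_trans (by exact_mod_cast hz.2) hy.2⟩

lemma measurableSet_interval : MeasurableSet l.interval :=
  l.ordConnected_interval.measurableSet

lemma intervalIntegrable_of_mem {g : ℝ → H} (hg : LocallyIntegrableOn g l.interval) {t : ℝ}
    (ht : t ∈ l.interval) : IntervalIntegrable g volume 0 t := by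
  have h0 := l.nonneg_of_mem ht
  rw [intervalIntegrable_iff_integrableOn_Icc_of_le h0]
  exact hg.integrableOn_compact_subset
    (l.ordConnected_interval.out l.zero_mem_interval ht) isCompact_Icc

variable {l}

lemma ae_differentiableWithinAt {f : ℝ → H} (hf : IsLocAC f l.interval) :
    ∀ᵐ t ∂l.measure, DifferentiableWithinAt ℝ f l.interval t := by
  obtain ⟨g, hg, hfg⟩ := hf
  rw [measure, ae_restrict_iff' l.measurableSet_interval]
  have h1 : ∀ᵐ x : ℝ, ∀ r : ℚ, (r : ℝ) ∈ l.interval → x ∈ uIcc 0 (r : ℝ) →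
      ∀ c ∈ uIcc 0 (r : ℝ), HasDerivAt (fun x => ∫ s in c..x, g s) (g x) x := by
    rw [ae_all_iff]
    intro r
    by_cases hr : (r : ℝ) ∈ l.interval
    · filter_upwards [(l.intervalIntegrable_of_mem hg hr).ae_hasDerivAt_integral] with x hx _
        using hx
    · exact Eventually.of_forall fun x h => absurd h hr
  have h2 : ∀ᵐ x : ℝ, x ≠ l.b.toReal := by simp [ae_iff, measure_singleton]
  filter_upwards [h1, h2] with x hx hxb hxl
  have h0 := l.nonneg_of_mem hxl
  have hlt : (x : EReal) < l.b := by
    rcases l.interval_eq with h | h <;> rw [h] at hxl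
    · exact hxl.2
    · refine lt_of_le_of_ne hxl.2 fun he => hxb ?_
      rw [← he, EReal.toReal_coe]
  obtain ⟨r, hxr, hrb⟩ := EReal.lt_iff_exists_rat_btwn.1 hlt
  have hxr' : x < (r : ℝ) := by
    have : (x : EReal) < ((r : ℝ) : EReal) := hxr
    exact_mod_cast this
  have hr : (r : ℝ) ∈ l.interval := by
    have hrb' : ((r : ℝ) : EReal) < l.b := hrb
    rcases l.interval_eq with h | h <;> rw [h]
    · exact ⟨h0.trans hxr'.le, hrb'⟩
    · exact ⟨h0.trans hxr'.le, hrb'.le⟩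
  have hd := hx r hr (by rw [uIcc_of_le (h0.trans hxr'.le)]; exact ⟨h0, hxr'.le⟩) 0 left_mem_uIcc
  exact ((hd.differentiableAt.const_add (f 0)).differentiableWithinAt).congr
    (fun t ht => hfg t ht) (hfg x hxl)

lemma isLocAC_add {f g h : ℝ → H} (hf : IsLocAC f l.interval) (hg : IsLocAC g l.interval)
    (hh : EqOn h (f + g) l.interval) : IsLocAC h l.interval := by
  obtain ⟨u, hu, hfu⟩ := hf
  obtain ⟨v, hv, hgv⟩ := hg
  refine ⟨u + v, hu.add hv, fun t ht => ?_⟩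
  rw [hh ht, hh l.zero_mem_interval, Pi.add_apply, Pi.add_apply, hfu t ht, hgv t ht]
  simp only [Pi.add_apply]
  rw [intervalIntegral.integral_add (l.intervalIntegrable_of_mem hu ht)
    (l.intervalIntegrable_of_mem hv ht)]
  abel

lemma isLocAC_smul {f : ℝ → H} (hf : IsLocAC f l.interval) (c : ℂ) :
    IsLocAC (c • f) l.interval := by
  obtain ⟨u, hu, hfu⟩ := hf
  refine ⟨c • u, fun t ht => (hu t ht).smul c, fun t ht => ?_⟩
  simp only [Pi.smul_apply]
  rw [hfu t ht, intervalIntegral.integral_smul, smul_add]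

lemma quasiDerivUpper_smul (y : ℝ → H) (c : ℂ) (j : ℕ) :
    l.quasiDerivUpper (c • y) j = c • l.quasiDerivUpper y j := by
  have hd : ∀ k, iteratedDerivWithin k (c • y) l.interval
      = c • iteratedDerivWithin k y l.interval := by
    intro k
    induction k with
    | zero => simp
    | succ k ih =>
      rw [iteratedDerivWithin_succ, ih, iteratedDerivWithin_succ]
      funext t
      rw [derivWithin_const_smul_field]; rfl
  induction j with
  | zero =>
    funext t
    simp only [quasiDerivUpper, hd, Pi.smul_apply, ContinuousLinearMap.smul_def, map_smul,
      smul_sub, smul_comm c (Complex.I / 2)]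
  | succ j ih =>
    funext t
    simp only [quasiDerivUpper, ih, hd, Pi.smul_apply, ContinuousLinearMap.smul_def, map_smul,
      derivWithin_const_smul_field]
    split_ifs <;> simp only [smul_sub, smul_add, smul_neg, smul_comm c (Complex.I / 2), smul_zero]

lemma quasiDeriv_smul (y : ℝ → H) (c : ℂ) (k : ℕ) :
    l.quasiDeriv (c • y) k = c • l.quasiDeriv y k := by
  unfold quasiDeriv
  split_ifs
  · induction k with
    | zero => simp
    | succ k ih =>
      rw [iteratedDerivWithin_succ, ih (by omega), iteratedDerivWithin_succ]
      funext t
      rw [derivWithin_const_smul_field]; rfl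
  · exact quasiDerivUpper_smul y c _

lemma quasiDeriv_zero (k : ℕ) : l.quasiDeriv (0 : ℝ → H) k = 0 := by
  have := quasiDeriv_smul (l := l) (0 : ℝ → H) 0 k
  rwa [zero_smul, zero_smul] at this

lemma MemDomExpr.differentiableOn {y : ℝ → H} (hy : l.MemDomExpr y) {k : ℕ}
    (hk : k + 1 < 2 * n) : DifferentiableOn ℝ (l.quasiDeriv y k) l.interval :=
  (hy.contDiffOn k hk).differentiableOn (by simp)

lemma MemDomExpr.differentiableOn_iterated {y : ℝ → H} (hy : l.MemDomExpr y) {k : ℕ}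
    (hk : k < n) : DifferentiableOn ℝ (iteratedDerivWithin k y l.interval) l.interval := by
  have := hy.differentiableOn (k := k) (by omega)
  rwa [quasiDeriv, if_pos hk] at this

lemma MemDomExpr.differentiableOn_upper {y : ℝ → H} (hy : l.MemDomExpr y) {j : ℕ}
    (hj : j + 1 < n) : DifferentiableOn ℝ (l.quasiDerivUpper y j) l.interval := by
  have := hy.differentiableOn (k := n + j) (by omega)
  rwa [quasiDeriv, if_neg (by omega), Nat.add_sub_cancel_left] at this

lemma iterated_add {y z : ℝ → H} (hy : l.MemDomExpr y) (hz : l.MemDomExpr z) {k : ℕ}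
    (hk : k ≤ n) : EqOn (iteratedDerivWithin k (y + z) l.interval)
      (iteratedDerivWithin k y l.interval + iteratedDerivWithin k z l.interval) l.interval := by
  induction k with
  | zero => intro t _; simp
  | succ k ih =>
    intro t ht
    rw [iteratedDerivWithin_succ, derivWithin_congr (ih (by omega)) (ih (by omega) ht),
      derivWithin_add (hy.differentiableOn_iterated hk t ht)
        (hz.differentiableOn_iterated hk t ht), iteratedDerivWithin_succ, Pi.add_apply,
      iteratedDerivWithin_succ]

lemma upper_succ_add {y z : ℝ → H} (hy : l.MemDomExpr y) (hz : l.MemDomExpr z) {j : ℕ}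
    (ih : EqOn (l.quasiDerivUpper (y + z) j) (l.quasiDerivUpper y j + l.quasiDerivUpper z j)
      l.interval) {t : ℝ} (ht : t ∈ l.interval)
    (hdy : DifferentiableWithinAt ℝ (l.quasiDerivUpper y j) l.interval t)
    (hdz : DifferentiableWithinAt ℝ (l.quasiDerivUpper z j) l.interval t) :
    l.quasiDerivUpper (y + z) (j + 1) t
      = l.quasiDerivUpper y (j + 1) t + l.quasiDerivUpper z (j + 1) t := by
  have h := fun k (hk : k ≤ n) => iterated_add hy hz hk ht
  simp only [quasiDerivUpper]
  rw [derivWithin_congr ih (ih ht), derivWithin_add hdy hdz, h _ (by omega), h _ (by omega),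
    h _ (by omega)]
  simp only [Pi.add_apply, smul_add]
  split_ifs <;> abel

lemma upper_add {y z : ℝ → H} (hy : l.MemDomExpr y) (hz : l.MemDomExpr z) {j : ℕ} (hj : j < n) :
    EqOn (l.quasiDerivUpper (y + z) j) (l.quasiDerivUpper y j + l.quasiDerivUpper z j)
      l.interval := by
  induction j with
  | zero =>
    intro t ht
    have h := fun k (hk : k ≤ n) => iterated_add hy hz hk ht
    simp only [quasiDerivUpper, Pi.add_apply]
    rw [h _ le_rfl, h _ (by omega)]
    simp only [Pi.add_apply, smul_add]
    abel
  | succ j ih =>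
    intro t ht
    exact upper_succ_add hy hz (ih (by omega)) ht (hy.differentiableOn_upper hj t ht)
      (hz.differentiableOn_upper hj t ht)

lemma quasiDeriv_add {y z : ℝ → H} (hy : l.MemDomExpr y) (hz : l.MemDomExpr z) {k : ℕ}
    (hk : k < 2 * n) :
    EqOn (l.quasiDeriv (y + z) k) (l.quasiDeriv y k + l.quasiDeriv z k) l.interval := by
  unfold quasiDeriv
  split_ifs with h
  · exact iterated_add hy hz h.le
  · exact upper_add hy hz (by omega)

lemma expr_add {y z : ℝ → H} (hy : l.MemDomExpr y) (hz : l.MemDomExpr z) :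
    l.expr (y + z) =ᵐ[l.measure] l.expr y + l.expr z := by
  have hn := l.n_pos
  have e1 : 2 * n - 1 = n + (n - 1) := by omega
  have e2 : 2 * n - n = (n - 1) + 1 := by omega
  have hu : ∀ w : ℝ → H, l.quasiDeriv w (2 * n - 1) = l.quasiDerivUpper w (n - 1) := fun w => by
    rw [quasiDeriv, if_neg (by omega), e1, Nat.add_sub_cancel_left]
  have he : ∀ w : ℝ → H, l.expr w = l.quasiDerivUpper w (n - 1 + 1) := fun w => by
    rw [expr, quasiDeriv, if_neg (by omega), e2]
  have hm : ∀ᵐ t ∂l.measure, t ∈ l.interval := ae_restrict_mem l.measurableSet_interval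
  filter_upwards [hm, ae_differentiableWithinAt hy.locAC, ae_differentiableWithinAt hz.locAC]
    with t ht h1 h2
  rw [hu] at h1 h2
  rw [Pi.add_apply, he, he, he]
  exact upper_succ_add hy hz (upper_add hy hz (by omega)) ht h1 h2

lemma expr_smul (y : ℝ → H) (c : ℂ) : l.expr (c • y) = c • l.expr y := quasiDeriv_smul y c _

lemma MemMaxDom.add {y z : ℝ → H} (hy : l.MemMaxDom y) (hz : l.MemMaxDom z) :
    l.MemMaxDom (y + z) where
  memDomExpr :=
    { contDiffOn := fun k hk => ((hy.memDomExpr.contDiffOn k hk).add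
        (hz.memDomExpr.contDiffOn k hk)).congr
          fun _ ht => quasiDeriv_add hy.memDomExpr hz.memDomExpr (by omega) ht
      locAC := isLocAC_add hy.memDomExpr.locAC hz.memDomExpr.locAC
        (quasiDeriv_add hy.memDomExpr hz.memDomExpr (by have := l.n_pos; omega)) }
  memLp := hy.memLp.add hz.memLp
  expr_memLp := (memLp_congr_ae (expr_add hy.memDomExpr hz.memDomExpr)).2
    (hy.expr_memLp.add hz.expr_memLp)

lemma MemMaxDom.smul {y : ℝ → H} (hy : l.MemMaxDom y) (c : ℂ) : l.MemMaxDom (c • y) where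
  memDomExpr :=
    { contDiffOn := fun k hk => by
        rw [quasiDeriv_smul]
        exact (contDiff_const_smul c).comp_contDiffOn (hy.memDomExpr.contDiffOn k hk)
      locAC := by
        rw [quasiDeriv_smul]
        exact isLocAC_smul hy.memDomExpr.locAC c }
  memLp := hy.memLp.const_smul c
  expr_memLp := by
    rw [expr_smul]
    exact hy.expr_memLp.const_smul c

lemma memMaxDom_zero : l.MemMaxDom 0 where
  memDomExpr :=
    { contDiffOn := fun k _ => by rw [quasiDeriv_zero]; exact contDiffOn_const
      locAC := by
        rw [quasiDeriv_zero]
        exact ⟨0, fun t _ => integrableAtFilter_zero, fun t _ => by simp⟩ }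
  memLp := MemLp.zero
  expr_memLp := by rw [expr, quasiDeriv_zero]; exact MemLp.zero

lemma vec1_add {y z : ℝ → H} (hy : l.MemDomExpr y) (hz : l.MemDomExpr z) {t : ℝ}
    (ht : t ∈ l.interval) : l.vec1 (y + z) t = l.vec1 y t + l.vec1 z t := by
  ext k
  exact quasiDeriv_add hy hz (by omega) ht

lemma vec2_add {y z : ℝ → H} (hy : l.MemDomExpr y) (hz : l.MemDomExpr z) {t : ℝ}
    (ht : t ∈ l.interval) : l.vec2 (y + z) t = l.vec2 y t + l.vec2 z t := by
  ext k
  exact quasiDeriv_add hy hz (by omega) ht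

lemma vec1_smul (y : ℝ → H) (c : ℂ) (t : ℝ) : l.vec1 (c • y) t = c • l.vec1 y t := by
  ext k
  simp [vec1, quasiDeriv_smul]

lemma vec2_smul (y : ℝ → H) (c : ℂ) (t : ℝ) : l.vec2 (c • y) t = c • l.vec2 y t := by
  ext k
  simp [vec2, quasiDeriv_smul]

lemma vec1_zero (t : ℝ) : l.vec1 0 t = 0 := by
  ext k
  simp [vec1, quasiDeriv_zero]

lemma vec2_zero (t : ℝ) : l.vec2 0 t = 0 := by
  ext k
  simp [vec2, quasiDeriv_zero]

lemma eventually_mem_interval : ∀ᶠ t in l.atEnd, t ∈ l.interval := by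
  have h : Ioo (0 : EReal) l.b ∈ 𝓝[<] l.b := Ioo_mem_nhdsLT l.b_pos
  filter_upwards [preimage_mem_comap h] with t ht
  have h0' : (0 : EReal) ≤ (t : EReal) := ht.1.le
  have h0 : (0 : ℝ) ≤ t := by exact_mod_cast h0'
  rcases l.interval_eq with h | h <;> rw [h]
  · exact ⟨h0, ht.2⟩
  · exact ⟨h0, ht.2.le⟩

lemma VanishesAtEnd.add {y z : ℝ → H} (hy : l.MemMaxDom y) (hz : l.MemMaxDom z)
    (hy' : l.VanishesAtEnd y) (hz' : l.VanishesAtEnd z) : l.VanishesAtEnd (y + z) := by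
  intro w hw
  have := (hy' w hw).add (hz' w hw)
  rw [add_zero] at this
  refine this.congr' ?_
  filter_upwards [l.eventually_mem_interval] with t ht
  simp only [bracket, vec1_add hy.memDomExpr hz.memDomExpr ht,
    vec2_add hy.memDomExpr hz.memDomExpr ht, inner_add_right]
  ring

lemma VanishesAtEnd.smul {y : ℝ → H} (hy : l.VanishesAtEnd y) (c : ℂ) :
    l.VanishesAtEnd (c • y) := by
  intro w hw
  have := (hy w hw).const_mul c
  rw [mul_zero] at this
  refine this.congr fun t => ?_
  simp only [bracket, vec1_smul, vec2_smul, inner_smul_right]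
  ring

lemma vanishesAtEnd_zero : l.VanishesAtEnd 0 := by
  intro w _
  refine tendsto_const_nhds.congr fun t => ?_
  simp [bracket, vec1_zero, vec2_zero]

end Linearity

/-- (The graph of) the extension `L_θ ⊆ L` of the minimal operator, a subspace of
`L₂(Δ; H) × L₂(Δ; H)`: its domain consists of all `y ∈ 𝒟` with `(y^{(1)}(0), y^{(2)}(0)) ∈ θ` and
`[y,z](b) = 0` for all `z ∈ 𝒟`, and `L_θ y = l[y]`. -/
def extension (l : DiffExpr H n) (θ : Submodule ℂ (HilbertPow H n × HilbertPow H n)) :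
    Submodule ℂ (l.L2 × l.L2) where
  carrier := {u | ∃ y : ℝ → H, l.MemMaxDom y ∧ (l.vec1 y 0, l.vec2 y 0) ∈ θ ∧
    l.VanishesAtEnd y ∧ u.1 =ᵐ[l.measure] y ∧ u.2 =ᵐ[l.measure] l.expr y}
  zero_mem' := ⟨0, memMaxDom_zero, by rw [vec1_zero, vec2_zero]; exact θ.zero_mem,
    vanishesAtEnd_zero, Lp.coeFn_zero _ _ _, by
      rw [expr, quasiDeriv_zero]; exact Lp.coeFn_zero _ _ _⟩
  add_mem' := by
    rintro u v ⟨y, hy, hyθ, hyb, hu1, hu2⟩ ⟨z, hz, hzθ, hzb, hv1, hv2⟩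
    refine ⟨y + z, hy.add hz, ?_, hyb.add hy hz hzb, (Lp.coeFn_add _ _).trans (hu1.add hv1),
      (Lp.coeFn_add _ _).trans ((hu2.add hv2).trans (expr_add hy.memDomExpr hz.memDomExpr).symm)⟩
    rw [vec1_add hy.memDomExpr hz.memDomExpr l.zero_mem_interval,
      vec2_add hy.memDomExpr hz.memDomExpr l.zero_mem_interval]
    exact θ.add_mem hyθ hzθ
  smul_mem' := by
    rintro c u ⟨y, hy, hyθ, hyb, hu1, hu2⟩
    refine ⟨c • y, hy.smul c, ?_, hyb.smul c, (Lp.coeFn_smul _ _).trans (hu1.const_smul c), ?_⟩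
    · rw [vec1_smul, vec2_smul]
      exact θ.smul_mem c hyθ
    · rw [expr_smul]
      exact (Lp.coeFn_smul _ _).trans (hu2.const_smul c)

/-- (The graph of) the minimal operator `L_0`: the restriction of `L` to all `y ∈ 𝒟` with
`y^{(1)}(0) = y^{(2)}(0) = 0` and `[y,z](b) = 0` for all `z ∈ 𝒟`. -/
def minimalOperator (l : DiffExpr H n) : Submodule ℂ (l.L2 × l.L2) := l.extension ⊥

/-- `Y` is an operator solution of `l[y] - z y = 0` with values in the bounded operators
`𝒦 → H`: `Y^{[k]}`, `0 ≤ k ≤ 2n-1`, has a continuous derivative (in the operator norm) on `Δ`, and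
`l[Y] = z Y` on `Δ`. -/
structure IsOperatorSolution {𝒦 : Type*} [NormedAddCommGroup 𝒦] [InnerProductSpace ℂ 𝒦]
    (l : DiffExpr H n) (z : ℂ) (Y : ℝ → (𝒦 →L[ℂ] H)) : Prop where
  contDiffOn : ∀ k < 2 * n, ContDiffOn ℝ 1 (l.quasiDeriv Y k) l.interval
  expr_eq : ∀ t ∈ l.interval, l.expr Y t = z • Y t

/-- `φ = φ_K(·, z) : Δ → [H^n, H]` is the operator solution of `l[y] - z y = 0` with the initial
data `φ^{(1)}(0) = K₀`, `φ^{(2)}(0) = K₁`. (Such a `φ` exists and is unique on `Δ`.) -/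
structure IsPhi (l : DiffExpr H n) (K₀ K₁ : HilbertPow H n →L[ℂ] HilbertPow H n) (z : ℂ)
    (φ : ℝ → (HilbertPow H n →L[ℂ] H)) : Prop where
  isOperatorSolution : l.IsOperatorSolution z φ
  initial₁ : ∀ (h : HilbertPow H n) (k : Fin n), l.quasiDeriv φ k 0 h = K₀ h k
  initial₂ : ∀ (h : HilbertPow H n) (k : Fin n), l.quasiDeriv φ (2 * n - (k + 1)) 0 h = K₁ h k

/-- `∫_0^b ‖φ_K(t, z) h‖² dt = ∞` for all `h ∈ H^n`, `h ≠ 0`. -/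
def PhiNotSquareIntegrable (l : DiffExpr H n)
    (K₀ K₁ : HilbertPow H n →L[ℂ] HilbertPow H n) (z : ℂ) : Prop :=
  ∃ φ : ℝ → (HilbertPow H n →L[ℂ] H), l.IsPhi K₀ K₁ z φ ∧
    ∀ h : HilbertPow H n, h ≠ 0 → ∫⁻ t in l.interval, ‖φ t h‖ₑ ^ 2 = ⊤

end DiffExpr

section LinearRelations

/-! Operators are identified with their graphs; `Submodule.adjoint` is the adjoint linear relation
`T* = {(g, g') : (f', g) = (f, g') for all (f, f') ∈ T}`. -/

variable {X : Type*} [NormedAddCommGroup X] [InnerProductSpace ℂ X]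

/-- `θ = θ*` for a linear relation `θ` in `X`. -/
def IsSelfAdjointRelation (θ : Submodule ℂ (X × X)) : Prop := θ.adjoint = θ

/-- `K = (K₀, K₁)ᵀ : X → X ⊕ X` is a selfadjoint operator pair: it is admissible (`Ker K = 0`) and
its range `{(K₀ h, K₁ h) : h ∈ X}` is a selfadjoint linear relation (in particular closed). -/
structure IsSelfAdjointPair (K₀ K₁ : X →L[ℂ] X) : Prop where
  ker_eq_bot : ∀ h : X, K₀ h = 0 → K₁ h = 0 → h = 0
  range_selfAdjoint :
    IsSelfAdjointRelation (LinearMap.range ((K₀.prod K₁ : X →L[ℂ] X × X) : X →ₗ[ℂ] X × X))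

/-- The defect subspace `𝔑_z(T) = Ker (T* - z)`. -/
def defectSubspace (T : Submodule ℂ (X × X)) (z : ℂ) : Submodule ℂ X :=
  T.adjoint.comap (LinearMap.prod LinearMap.id (z • LinearMap.id))

/-- The deficiency index `n_+(T) = dim 𝔑_z(T)`, `Im z > 0`, of a symmetric operator; the dimension
does not depend on `z`, and `z = i` is taken. The value `⊤` means infinite dimension. -/
def deficiencyIndexPos (T : Submodule ℂ (X × X)) : ℕ∞ :=
  Cardinal.toENat (Module.rank ℂ (defectSubspace T Complex.I))

/-- The deficiency index `n_-(T) = dim 𝔑_z(T)`, `Im z < 0`, of a symmetric operator; the dimension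
does not depend on `z`, and `z = -i` is taken. The value `⊤` means infinite dimension. -/
def deficiencyIndexNeg (T : Submodule ℂ (X × X)) : ℕ∞ :=
  Cardinal.toENat (Module.rank ℂ (defectSubspace T (-Complex.I)))

end LinearRelations

namespace DiffExpr

variable {H : Type*} [NormedAddCommGroup H] [InnerProductSpace ℂ H] [CompleteSpace H] {n : ℕ}

/-- The deficiency index `n_{b+} = n_+(L_θ)`, `θ = θ*`, of the expression `l[y]` at the right end
`b`. It does not depend on the choice of the selfadjoint relation `θ` in `H^n`, which is an argument
here so that statements can be made for every choice. -/
def endDeficiencyPos (l : DiffExpr H n)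
    (θ : Submodule ℂ (HilbertPow H n × HilbertPow H n)) : ℕ∞ :=
  deficiencyIndexPos (l.extension θ)

/-- The deficiency index `n_{b-} = n_-(L_θ)`, `θ = θ*`, of the expression `l[y]` at the right end
`b`; see `endDeficiencyPos`. -/
def endDeficiencyNeg (l : DiffExpr H n)
    (θ : Submodule ℂ (HilbertPow H n × HilbertPow H n)) : ℕ∞ :=
  deficiencyIndexNeg (l.extension θ)

end DiffExpr

end

/-! All statements are compared with one condition that involves neither a relation, nor a pair, nor
a spectral parameter: the limit point condition `DiffExpr.IsLimitPoint`, i.e. `[y,z](b) = 0` for all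
`y`, `z` in the maximal domain.

Assume the limit point condition. Green's formula for a square integrable solution `y` of `l[y] =
λy` equates a multiple of `Im λ · ‖y‖²` with `[y,y](0)`, which is zero when the initial data lie in
a symmetric relation. For nonreal `λ` therefore `y = 0`. This gives both (i) and (iii). Conversely,
if both defect subspaces of `L_θ` are trivial, then `L_θ` is essentially selfadjoint and its adjoint
is symmetric. The adjoint contains all maximal functions with zero initial data, so the brackets of
such functions vanish at `b`; every maximal function differs from one of these by a function
vanishing near `b`. Under (ii) this is applied to `θ = ran K`: the defect subspace at `λ` consists
of the square integrable functions `φ_K(·,λ)h`, and triviality of a defect subspace propagates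
through a half-plane, which carries `μ` to the conjugate of `λ`.

The analytic core is the description of the adjoint of `L_θ` as the restriction of the maximal
operator by `θ*` (`DiffExpr.mem_adjoint_extension_iff`). The equation `l[y] = f` is rewritten as a
first order system on `H^{2n}` whose matrix is skew for the boundary form
(`DiffExpr.boundaryForm_field`, hence `DiffExpr.IsState.lagrange`). Two facts about this system on a
short interval `[0,c]` are needed: any initial state can be steered to zero, and a function
orthogonal to everything orthogonal to the homogeneous solutions is itself a homogeneous solution.
Both require that the map from initial data to solutions in `L₂(0,c)` be bounded below. Since `H`
may be infinite dimensional, compactness of the unit sphere cannot be used; the bound is the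
observability inequality `DiffExpr.exists_observability`, which makes the Gramian boundedly
invertible.

For `dim H < ∞` let `S_z ⊆ H^{2n}` be the initial data of the square integrable solutions of `l[y] =
zy`. The defect subspace of `L_θ` at `z` is isomorphic to `S_z ∩ θ`, that of `L₀` to `S_z`.
Surjectivity of the shifted adjoint of a symmetric relation gives `S_z + θ = H^{2n}`. As `dim θ = n
dim H`, the deficiency indices of `L₀` exceed those of `L_θ` by exactly `n dim H`. -/

noncomputable section

set_option linter.unusedSectionVars false

/-! ### Integral equations with Lipschitz right-hand side on compact intervals. -/

section Volterra

variable {E : Type*} [NormedAddCommGroup E] [NormedSpace ℝ E]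

/-- The weight `exp (2Kt)` is reproduced up to the factor `1/2` by integration against the Lipschitz
constant; this is the contraction constant of the Picard operator in the weighted norm. -/
lemma integral_two_mul_exp (K t : ℝ) :
    ∫ s in (0 : ℝ)..t, K * Real.exp (2 * K * s) = (Real.exp (2 * K * t) - 1) / 2 := by
  have h : ∀ s ∈ uIcc 0 t,
      HasDerivAt (fun s => Real.exp (2 * K * s) / 2) (K * Real.exp (2 * K * s)) s := by
    intro s _
    have h1 : HasDerivAt (fun s : ℝ => 2 * K * s) (2 * K) s := by
      simpa using (hasDerivAt_id s).const_mul (2 * K)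
    convert! h1.exp.div_const 2 using 1
    ring
  rw [intervalIntegral.integral_eq_sub_of_hasDerivAt h
    (by apply Continuous.intervalIntegrable; fun_prop)]
  simp
  ring

/-- Global solvability on a compact interval of an integral equation whose right-hand side is
globally Lipschitz. -/
theorem exists_integralEq_of_lipschitz [CompleteSpace E] {F : ℝ → E → E} {c : ℝ} (hc : 0 ≤ c)
    {K : ℝ} (hK : 0 < K) (hF : ContinuousOn (Function.uncurry F) (Icc 0 c ×ˢ univ))
    (hL : ∀ t ∈ Icc 0 c, ∀ x y, ‖F t x - F t y‖ ≤ K * ‖x - y‖) (x₀ : E) :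
    ∃ x : ℝ → E, Continuous x ∧
      ∀ t ∈ Icc 0 c, x t = x₀ + ∫ s in (0 : ℝ)..t, F s (x s) := by
  -- Exponential weight: the unknown is `v = x / w`. In the sup norm of `v` the Picard operator
  -- contracts on all of `[0, c]`, so no iteration over short intervals is needed.
  let w : ℝ → ℝ := fun s => Real.exp (2 * K * s)
  have hw : Continuous w := by fun_prop
  have hw0 : ∀ s, 0 < w s := fun s => Real.exp_pos _
  let u : C(Icc 0 c, E) → ℝ → E := fun v s => w s • v (projIcc 0 c hc s)
  have hu : ∀ v, Continuous (u v) := fun v =>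
    hw.smul (v.continuous.comp continuous_projIcc)
  -- Composition with the projection to `[0, c]` extends the integrand continuously to the whole
  -- line.
  let G : C(Icc 0 c, E) → ℝ → E := fun v s =>
    F (projIcc 0 c hc s) (u v (projIcc 0 c hc s))
  have hG : ∀ v, Continuous (G v) := fun v => by
    have h1 : Continuous fun s => (((projIcc 0 c hc s : Icc 0 c) : ℝ), u v (projIcc 0 c hc s)) :=
      (continuous_subtype_val.comp continuous_projIcc).prodMk
        ((hu v).comp (continuous_subtype_val.comp continuous_projIcc))
    exact hF.comp_continuous h1 fun s => ⟨(projIcc 0 c hc s).2, mem_univ _⟩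
  let T : C(Icc 0 c, E) → C(Icc 0 c, E) := fun v =>
    ⟨fun t => (w t)⁻¹ • (x₀ + ∫ s in (0 : ℝ)..t, G v s), by
      have h1 : Continuous fun t : ℝ => ∫ s in (0 : ℝ)..t, G v s :=
        intervalIntegral.continuous_primitive (fun a b => (hG v).intervalIntegrable a b) 0
      have h2 : Continuous fun t : ℝ => (w t)⁻¹ • (x₀ + ∫ s in (0 : ℝ)..t, G v s) :=
        (hw.inv₀ fun s => (hw0 s).ne').smul (continuous_const.add h1)
      exact h2.comp continuous_subtype_val⟩
  have hT : ContractingWith (1 / 2) T := by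
    refine ⟨by norm_num, LipschitzWith.of_dist_le_mul fun v v' => ?_⟩
    rw [ContinuousMap.dist_le (by positivity)]
    rintro ⟨t, ht⟩
    have e1 : T v ⟨t, ht⟩ - T v' ⟨t, ht⟩ = (w t)⁻¹ • ∫ s in (0 : ℝ)..t, (G v s - G v' s) := by
      rw [intervalIntegral.integral_sub ((hG v).intervalIntegrable _ _)
        ((hG v').intervalIntegrable _ _)]
      change (w t)⁻¹ • (x₀ + _) - (w t)⁻¹ • (x₀ + _) = _
      rw [← smul_sub, add_sub_add_left_eq_sub]
    have e2 : ‖∫ s in (0 : ℝ)..t, (G v s - G v' s)‖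
        ≤ ∫ s in (0 : ℝ)..t, K * w s * dist v v' := by
      refine intervalIntegral.norm_integral_le_of_norm_le ht.1 (Eventually.of_forall
        fun s hs => ?_) (by apply Continuous.intervalIntegrable; fun_prop)
      have hs' : s ∈ Icc 0 c := ⟨hs.1.le, hs.2.trans ht.2⟩
      have hp : projIcc 0 c hc s = ⟨s, hs'⟩ := projIcc_of_mem hc hs'
      simp only [G, u, hp]
      refine (hL s hs' _ _).trans ?_
      rw [mul_assoc, ← smul_sub, norm_smul, Real.norm_of_nonneg (hw0 s).le, ← dist_eq_norm]
      gcongr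
      exact ContinuousMap.dist_apply_le_dist _
    rw [intervalIntegral.integral_mul_const, integral_two_mul_exp K] at e2
    rw [dist_eq_norm, e1, norm_smul, norm_inv, Real.norm_of_nonneg (hw0 t).le]
    have h3 : (w t)⁻¹ * ‖∫ s in (0 : ℝ)..t, (G v s - G v' s)‖
        ≤ (w t)⁻¹ * ((w t - 1) / 2 * dist v v') := by
      have := (inv_pos.2 (hw0 t)).le
      gcongr
    refine h3.trans ?_
    have h4 : (w t)⁻¹ * ((w t - 1) / 2 * dist v v')
        = (1 / 2) * dist v v' - (w t)⁻¹ / 2 * dist v v' := by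
      have := (hw0 t).ne'
      field_simp
    rw [h4]
    have : 0 ≤ (w t)⁻¹ / 2 * dist v v' := by
      have := (inv_pos.2 (hw0 t)).le
      positivity
    norm_num at this ⊢
    linarith
  obtain ⟨v, hv, -⟩ := hT.exists_fixedPoint 0 (edist_ne_top _ _)
  refine ⟨u v, hu v, fun t ht => ?_⟩
  have h1 : v ⟨t, ht⟩ = (w t)⁻¹ • (x₀ + ∫ s in (0 : ℝ)..t, G v s) := by
    conv_lhs => rw [← hv.eq]
    rfl
  have h2 : u v t = x₀ + ∫ s in (0 : ℝ)..t, G v s := by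
    simp only [u]
    rw [projIcc_of_mem hc ht, h1, smul_inv_smul₀ (hw0 t).ne']
  rw [h2]
  congr 1
  refine intervalIntegral.integral_congr fun s hs => ?_
  rw [uIcc_of_le ht.1] at hs
  have hs' : s ∈ Icc 0 c := ⟨hs.1, hs.2.trans ht.2⟩
  simp only [G]
  rw [projIcc_of_mem hc hs']

/-- Uniqueness for integral equations with Lipschitz right-hand side. -/
theorem integralEq_unique [CompleteSpace E] {F : ℝ → E → E} {a c : ℝ} {K : ℝ} (hK : 0 ≤ K)
    (hF : ContinuousOn (Function.uncurry F) (Icc a c ×ˢ univ))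
    (hL : ∀ t ∈ Icc a c, ∀ x y, ‖F t x - F t y‖ ≤ K * ‖x - y‖) {x y : ℝ → E}
    (hx : ContinuousOn x (Icc a c)) (hy : ContinuousOn y (Icc a c))
    (hxe : ∀ t ∈ Icc a c, x t = x a + ∫ s in a..t, F s (x s))
    (hye : ∀ t ∈ Icc a c, y t = y a + ∫ s in a..t, F s (y s)) (h0 : x a = y a) :
    EqOn x y (Icc a c) := by
  have key : ∀ x : ℝ → E, ContinuousOn x (Icc a c) →
      (∀ t ∈ Icc a c, x t = x a + ∫ s in a..t, F s (x s)) →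
      ∀ t ∈ Ico a c, HasDerivWithinAt x (F t (x t)) (Ici t) t := by
    intro x hx hxe t ht
    have hG : ContinuousOn (fun s => F s (x s)) (Icc a c) :=
      hF.comp (continuousOn_id.prodMk hx) fun s hs => ⟨hs, mem_univ _⟩
    have hc : Icc a c ∈ 𝓝[>] t :=
      mem_of_superset (Ioc_mem_nhdsGT ht.2) fun s hs => ⟨ht.1.trans hs.1.le, hs.2⟩
    have hint : IntervalIntegrable (fun s => F s (x s)) volume a t := by
      apply ContinuousOn.intervalIntegrable
      rw [uIcc_of_le ht.1]
      exact hG.mono (Icc_subset_Icc_right ht.2.le)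
    have hd : HasDerivWithinAt (fun u => ∫ s in a..u, F s (x s)) (F t (x t)) (Ici t) t := by
      refine intervalIntegral.integral_hasDerivWithinAt_right hint ?_ ?_ (t := Ioi t)
      · exact ⟨Icc a c, hc, hG.aestronglyMeasurable measurableSet_Icc⟩
      · exact (hG t (Ico_subset_Icc_self ht)).mono_of_mem_nhdsWithin hc
    refine (hd.const_add (x a)).congr_of_eventuallyEq ?_ (hxe t (Ico_subset_Icc_self ht))
    have : Icc a c ∈ 𝓝[≥] t :=
      mem_of_superset (Icc_mem_nhdsGE ht.2) fun s hs => ⟨ht.1.trans hs.1, hs.2⟩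
    filter_upwards [this] with s hs using hxe s hs
  refine ODE_solution_unique_of_mem_Icc_right (v := F) (s := fun _ => univ) (K := ⟨K, hK⟩) ?_ hx
    (key x hx hxe) (fun t _ => mem_univ _) hy (key y hy hye) (fun t _ => mem_univ _) h0
  intro t ht
  refine LipschitzOnWith.of_dist_le_mul fun u _ v _ => ?_
  rw [dist_eq_norm, dist_eq_norm]
  exact hL t (Ico_subset_Icc_self ht) u v

end Volterra

/-! ### Calculus on `Δ` and linear integral equations on all of `Δ`. -/

namespace DiffExpr

variable {H : Type*} [NormedAddCommGroup H] [InnerProductSpace ℂ H] [CompleteSpace H] {n : ℕ}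
variable (l : DiffExpr H n)

lemma Icc_subset_interval {t : ℝ} (ht : t ∈ l.interval) : Icc 0 t ⊆ l.interval :=
  l.ordConnected_interval.out l.zero_mem_interval ht

lemma exists_pos_mem_interval : ∃ c : ℝ, 0 < c ∧ (c : EReal) < l.b ∧ c ∈ l.interval := by
  obtain ⟨r, hr0, hrb⟩ := EReal.lt_iff_exists_real_btwn.1 l.b_pos
  have hr : 0 < r := by exact_mod_cast hr0
  refine ⟨r, hr, hrb, ?_⟩
  rcases l.interval_eq with h | h <;> rw [h]
  · exact ⟨hr.le, hrb⟩
  · exact ⟨hr.le, hrb.le⟩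

lemma mem_interval_of_lt {t : ℝ} (h0 : 0 ≤ t) (hb : (t : EReal) < l.b) : t ∈ l.interval := by
  rcases l.interval_eq with h | h <;> rw [h]
  · exact ⟨h0, hb⟩
  · exact ⟨h0, hb.le⟩

lemma uniqueDiffOn_interval : UniqueDiffOn ℝ l.interval := by
  obtain ⟨c, hc, -, hcl⟩ := l.exists_pos_mem_interval
  refine uniqueDiffOn_convex l.ordConnected_interval.convex ⟨c / 2, ?_⟩
  refine mem_interior.2 ⟨Ioo 0 c, ?_, isOpen_Ioo, by constructor <;> linarith⟩
  exact Ioo_subset_Icc_self.trans (l.Icc_subset_interval hcl)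

/-- Local properties on `Δ` can be checked on intervals `[0, c]`. If `t` is the last point of `Δ`,
then `c = t` serves; otherwise any later point of `Δ` does. -/
lemma exists_Icc_mem_nhdsWithin {t : ℝ} (ht : t ∈ l.interval) :
    ∃ c ∈ l.interval, t ≤ c ∧ Icc 0 c ∈ 𝓝[l.interval] t := by
  by_cases h : ∃ c ∈ l.interval, t < c
  · obtain ⟨c, hc, htc⟩ := h
    refine ⟨c, hc, htc.le, ?_⟩
    filter_upwards [self_mem_nhdsWithin, mem_nhdsWithin_of_mem_nhds (Iio_mem_nhds htc)]
      with s hs hs' using ⟨l.nonneg_of_mem hs, le_of_lt hs'⟩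
  · push Not at h
    exact ⟨t, ht, le_rfl, mem_of_superset self_mem_nhdsWithin
      fun s hs => ⟨l.nonneg_of_mem hs, h s hs⟩⟩

section Calculus

variable {E : Type*} [NormedAddCommGroup E] [NormedSpace ℝ E]

variable {l} in
lemma intervalIntegrable_of_locallyIntegrableOn {g : ℝ → E}
    (hg : LocallyIntegrableOn g l.interval) {s t : ℝ} (hs : s ∈ l.interval)
    (ht : t ∈ l.interval) : IntervalIntegrable g volume s t := by
  rw [intervalIntegrable_iff']
  exact hg.integrableOn_compact_subset (l.ordConnected_interval.uIcc_subset hs ht) isCompact_uIcc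

variable {l} in
lemma intervalIntegrable_of_continuousOn {g : ℝ → E} (hg : ContinuousOn g l.interval) {s t : ℝ}
    (hs : s ∈ l.interval) (ht : t ∈ l.interval) : IntervalIntegrable g volume s t :=
  (hg.mono (l.ordConnected_interval.uIcc_subset hs ht)).intervalIntegrable

variable {l} in
lemma continuousOn_of_Icc {g : ℝ → E} (h : ∀ c ∈ l.interval, ContinuousOn g (Icc 0 c)) :
    ContinuousOn g l.interval := by
  intro t ht
  obtain ⟨c, hc, htc, hmem⟩ := l.exists_Icc_mem_nhdsWithin ht
  exact (h c hc t ⟨l.nonneg_of_mem ht, htc⟩).mono_of_mem_nhdsWithin hmem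

variable {l} in
lemma continuousOn_primitive {g : ℝ → E} (hg : LocallyIntegrableOn g l.interval) :
    ContinuousOn (fun t => ∫ s in (0 : ℝ)..t, g s) l.interval := by
  refine continuousOn_of_Icc fun c hc => ?_
  have := intervalIntegral.continuousOn_primitive_interval'
    (intervalIntegrable_of_locallyIntegrableOn hg l.zero_mem_interval hc)
    (left_mem_uIcc)
  rwa [uIcc_of_le (l.nonneg_of_mem hc)] at this

variable {l} in
lemma hasDerivWithinAt_primitive [CompleteSpace E] {g : ℝ → E} (hg : ContinuousOn g l.interval)
    {t : ℝ} (ht : t ∈ l.interval) :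
    HasDerivWithinAt (fun t => ∫ s in (0 : ℝ)..t, g s) (g t) l.interval t := by
  obtain ⟨c, hc, htc, hmem⟩ := l.exists_Icc_mem_nhdsWithin ht
  have hg' : ContinuousOn g (Icc 0 c) := hg.mono (l.Icc_subset_interval hc)
  have htI : t ∈ Icc 0 c := ⟨l.nonneg_of_mem ht, htc⟩
  have : Fact (t ∈ Icc 0 c) := ⟨htI⟩
  have hd : HasDerivWithinAt (fun t => ∫ s in (0 : ℝ)..t, g s) (g t) (Icc 0 c) t := by
    refine intervalIntegral.integral_hasDerivWithinAt_right
      (intervalIntegrable_of_continuousOn hg l.zero_mem_interval ht) ?_ (hg' t htI)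
    exact ⟨Icc 0 c, self_mem_nhdsWithin, hg'.aestronglyMeasurable measurableSet_Icc⟩
  exact hd.mono_of_mem_nhdsWithin hmem

variable {l} in
lemma hasDerivWithinAt_of_integralEq [CompleteSpace E] {x g : ℝ → E}
    (hg : ContinuousOn g l.interval)
    (hx : ∀ t ∈ l.interval, x t = x 0 + ∫ s in (0 : ℝ)..t, g s) {t : ℝ} (ht : t ∈ l.interval) :
    HasDerivWithinAt x (g t) l.interval t :=
  ((hasDerivWithinAt_primitive hg ht).const_add (x 0)).congr (fun s hs => hx s hs) (hx t ht)

variable {l} in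
lemma integralEq_of_hasDerivWithinAt [CompleteSpace E] {x g : ℝ → E}
    (hg : ContinuousOn g l.interval)
    (hx : ∀ t ∈ l.interval, HasDerivWithinAt x (g t) l.interval t) {t : ℝ} (ht : t ∈ l.interval) :
    x t = x 0 + ∫ s in (0 : ℝ)..t, g s := by
  have h0 := l.nonneg_of_mem ht
  have hsub := l.Icc_subset_interval ht
  rw [intervalIntegral.integral_eq_sub_of_hasDeriv_right_of_le h0
    (fun s hs => ((hx s (hsub hs)).continuousWithinAt).mono hsub) (f' := g) ?_
    (intervalIntegrable_of_continuousOn hg l.zero_mem_interval ht)]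
  · abel
  · intro s hs
    refine (hx s (hsub (Ioo_subset_Icc_self hs))).mono_of_mem_nhdsWithin ?_
    exact mem_of_superset (Ioc_mem_nhdsGT hs.2) fun r hr => hsub ⟨hs.1.le.trans hr.1.le, hr.2⟩

variable {l} in
lemma ae_hasDerivWithinAt_of_integralEq [CompleteSpace E] {f g : ℝ → E}
    (hg : LocallyIntegrableOn g l.interval)
    (hfg : ∀ t ∈ l.interval, f t = f 0 + ∫ s in (0 : ℝ)..t, g s) :
    ∀ᵐ t ∂l.measure, HasDerivWithinAt f (g t) l.interval t := by
  rw [measure, ae_restrict_iff' l.measurableSet_interval]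
  have h1 : ∀ᵐ x : ℝ, ∀ r : ℚ, (r : ℝ) ∈ l.interval → x ∈ uIcc 0 (r : ℝ) →
      ∀ c ∈ uIcc 0 (r : ℝ), HasDerivAt (fun x => ∫ s in c..x, g s) (g x) x := by
    rw [ae_all_iff]
    intro r
    by_cases hr : (r : ℝ) ∈ l.interval
    · filter_upwards [(intervalIntegrable_of_locallyIntegrableOn hg l.zero_mem_interval
        hr).ae_hasDerivAt_integral] with x hx _ using hx
    · exact Eventually.of_forall fun x h => absurd h hr
  -- Below `b` there is always a rational end point inside `Δ`, so countably many exceptional null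
  -- sets suffice once `b` itself is discarded. For `b = ∞` the default value `0` of `toReal` merely
  -- discards one more point.
  have h2 : ∀ᵐ x : ℝ, x ≠ l.b.toReal := by simp [ae_iff, measure_singleton]
  filter_upwards [h1, h2] with x hx hxb hxl
  have h0 := l.nonneg_of_mem hxl
  have hlt : (x : EReal) < l.b := by
    rcases l.interval_eq with h | h <;> rw [h] at hxl
    · exact hxl.2
    · refine lt_of_le_of_ne hxl.2 fun he => hxb ?_
      rw [← he, EReal.toReal_coe]
  obtain ⟨r, hxr, hrb⟩ := EReal.lt_iff_exists_rat_btwn.1 hlt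
  have hxr' : x < (r : ℝ) := by
    have : (x : EReal) < ((r : ℝ) : EReal) := hxr
    exact_mod_cast this
  have hr : (r : ℝ) ∈ l.interval := l.mem_interval_of_lt (h0.trans hxr'.le) hrb
  have hd := hx r hr (by rw [uIcc_of_le (h0.trans hxr'.le)]; exact ⟨h0, hxr'.le⟩) 0 left_mem_uIcc
  exact ((hd.const_add (f 0)).hasDerivWithinAt).congr (fun t ht => hfg t ht) (hfg x hxl)

lemma ae_lt_b : ∀ᵐ t : ℝ ∂l.measure, (t : EReal) < l.b := by
  rw [measure, ae_restrict_iff' l.measurableSet_interval]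
  have h2 : ∀ᵐ x : ℝ, x ≠ l.b.toReal := by simp [ae_iff, measure_singleton]
  filter_upwards [h2] with x hxb hxl
  rcases l.interval_eq with h | h <;> rw [h] at hxl
  · exact hxl.2
  · refine lt_of_le_of_ne hxl.2 fun he => hxb ?_
    rw [← he, EReal.toReal_coe]

/-- Global solvability on `Δ` of linear integral equations. -/
theorem exists_integralEq [CompleteSpace E] {A : ℝ → E →L[ℝ] E} {g : ℝ → E}
    (hA : ContinuousOn A l.interval) (hg : ContinuousOn g l.interval) (x₀ : E) :
    ∃ x : ℝ → E, ContinuousOn x l.interval ∧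
      ∀ t ∈ l.interval, x t = x₀ + ∫ s in (0 : ℝ)..t, (A s (x s) + g s) := by
  have hF : ContinuousOn (Function.uncurry fun t x => A t x + g t) (l.interval ×ˢ univ) := by
    have h1 : ContinuousOn (fun z : ℝ × E => A z.1) (l.interval ×ˢ univ) :=
      hA.comp continuousOn_fst fun z hz => hz.1
    have h2 : ContinuousOn (fun z : ℝ × E => g z.1) (l.interval ×ˢ univ) :=
      hg.comp continuousOn_fst fun z hz => hz.1
    exact (h1.clm_apply continuousOn_snd).add h2
  have hK : ∀ c ∈ l.interval, ∃ K : ℝ, 0 < K ∧ ∀ t ∈ Icc 0 c, ∀ x y : E,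
      ‖(A t x + g t) - (A t y + g t)‖ ≤ K * ‖x - y‖ := by
    intro c hc
    obtain ⟨K, hK⟩ := isCompact_Icc.exists_bound_of_continuousOn
      (hA.mono (l.Icc_subset_interval hc))
    refine ⟨max K 1, by positivity, fun t ht x y => ?_⟩
    rw [add_sub_add_right_eq_sub, ← map_sub]
    exact ((A t).le_opNorm _).trans (by gcongr; exact (hK t ht).trans (le_max_left _ _))
  have hex : ∀ c : l.interval, ∃ x : ℝ → E, Continuous x ∧
      ∀ t ∈ Icc 0 (c : ℝ), x t = x₀ + ∫ s in (0 : ℝ)..t, (A s (x s) + g s) := by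
    rintro ⟨c, hc⟩
    obtain ⟨K, hK0, hK⟩ := hK c hc
    exact exists_integralEq_of_lipschitz (l.nonneg_of_mem hc) hK0
      (hF.mono (prod_mono (l.Icc_subset_interval hc) Subset.rfl)) hK x₀
  choose X hXc hX using hex
  have hX0 : ∀ c : l.interval, X c 0 = x₀ := fun c => by
    simpa using hX c 0 ⟨le_rfl, l.nonneg_of_mem c.2⟩
  have hcomp : ∀ (c d : l.interval), (c : ℝ) ≤ d → EqOn (X c) (X d) (Icc 0 (c : ℝ)) := by
    intro c d hcd
    obtain ⟨K, hK0, hK⟩ := hK c c.2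
    refine integralEq_unique hK0.le (hF.mono (prod_mono (l.Icc_subset_interval c.2) Subset.rfl)) hK
      (hXc c).continuousOn (hXc d).continuousOn ?_ ?_ ((hX0 c).trans (hX0 d).symm)
    · intro t ht
      rw [hX0]
      exact hX c t ht
    · intro t ht
      rw [hX0]
      exact hX d t ⟨ht.1, ht.2.trans hcd⟩
  classical
  -- The solutions on the intervals `[0, c]` agree on overlaps by uniqueness, so evaluating at `t`
  -- the solution belonging to `[0, t]` glues them.
  let x : ℝ → E := fun t => if ht : t ∈ l.interval then X ⟨t, ht⟩ t else 0
  have hx : ∀ c : l.interval, EqOn x (X c) (Icc 0 (c : ℝ)) := by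
    intro c t ht
    have htl := l.Icc_subset_interval c.2 ht
    simp only [x, dif_pos htl]
    exact hcomp ⟨t, htl⟩ c ht.2 ⟨ht.1, le_rfl⟩
  refine ⟨x, continuousOn_of_Icc fun c hc => (hXc ⟨c, hc⟩).continuousOn.congr (hx ⟨c, hc⟩), ?_⟩
  intro t ht
  have h0 := l.nonneg_of_mem ht
  rw [hx ⟨t, ht⟩ ⟨h0, le_rfl⟩, hX ⟨t, ht⟩ t ⟨h0, le_rfl⟩]
  congr 1
  refine intervalIntegral.integral_congr fun s hs => ?_
  rw [uIcc_of_le h0] at hs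
  simp only [hx ⟨t, ht⟩ hs]

variable {l} in
/-- Uniqueness for linear integral equations, from any starting point of `Δ`. -/
theorem integralEq_linear_unique [CompleteSpace E] {A : ℝ → E →L[ℝ] E} {g : ℝ → E}
    (hA : ContinuousOn A l.interval) {a : ℝ} (ha : a ∈ l.interval) {x y : ℝ → E}
    (hx : ContinuousOn x l.interval) (hy : ContinuousOn y l.interval)
    (hxg : ∀ t ∈ l.interval, a ≤ t → IntervalIntegrable g volume a t)
    (hxe : ∀ t ∈ l.interval, a ≤ t → x t = x a + ∫ s in a..t, (A s (x s) + g s))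
    (hye : ∀ t ∈ l.interval, a ≤ t → y t = y a + ∫ s in a..t, (A s (y s) + g s))
    (h0 : x a = y a) {t : ℝ} (ht : t ∈ l.interval) (hat : a ≤ t) : x t = y t := by
  have hsub : Icc a t ⊆ l.interval := l.ordConnected_interval.out ha ht
  have hAi : ∀ {u : ℝ → E}, ContinuousOn u l.interval → ∀ s ∈ Icc a t,
      IntervalIntegrable (fun r => A r (u r)) volume a s := fun hu s hs =>
    intervalIntegrable_of_continuousOn (hA.clm_apply hu) ha (hsub hs)
  obtain ⟨K, hK⟩ := isCompact_Icc.exists_bound_of_continuousOn (hA.mono hsub)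
  have hK' : ∀ s ∈ Icc a t, ∀ u v : E, ‖A s u - A s v‖ ≤ max K 1 * ‖u - v‖ := by
    intro s hs u v
    rw [← map_sub]
    exact ((A s).le_opNorm _).trans (by gcongr; exact (hK s hs).trans (le_max_left _ _))
  have hF : ContinuousOn (Function.uncurry fun s u => A s u) (Icc a t ×ˢ univ) := by
    have h1 : ContinuousOn (fun z : ℝ × E => A z.1) (Icc a t ×ˢ univ) :=
      (hA.mono hsub).comp continuousOn_fst fun z hz => hz.1
    exact h1.clm_apply continuousOn_snd
  -- The inhomogeneity `g` is only integrable, so uniqueness is applied to the difference `x - y`,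
  -- which solves the homogeneous equation with continuous right-hand side.
  have := integralEq_unique (F := fun s u => A s u) (x := x - y) (y := fun _ => 0)
    (by positivity) hF hK' ((hx.sub hy).mono hsub) continuousOn_const ?_ (by simp) (by simp [h0])
    (right_mem_Icc.2 hat)
  · exact sub_eq_zero.1 this
  · intro s hs
    have hsl := hsub hs
    simp only [Pi.sub_apply, map_sub]
    rw [intervalIntegral.integral_sub (hAi hx s hs) (hAi hy s hs), hxe s hsl hs.1, hye s hsl hs.1,
      intervalIntegral.integral_add (hAi hx s hs) (hxg s hsl hs.1),
      intervalIntegral.integral_add (hAi hy s hs) (hxg s hsl hs.1), h0]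
    abel

end Calculus

end DiffExpr

/-! ### Integration by parts for absolutely continuous Hilbert space valued functions. -/

section ProductRule

lemma absolutelyContinuousOnInterval_of_dist_le {X : Type*} [PseudoMetricSpace X] {f : ℝ → X}
    {N : ℝ → ℝ} {a b : ℝ} (hN : AbsolutelyContinuousOnInterval N a b)
    (h : ∀ s ∈ uIcc a b, ∀ t ∈ uIcc a b, dist (f s) (f t) ≤ dist (N s) (N t)) :
    AbsolutelyContinuousOnInterval f a b := by
  rw [absolutelyContinuousOnInterval_iff] at hN ⊢
  intro ε hε
  obtain ⟨δ, hδ, hN⟩ := hN ε hε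
  refine ⟨δ, hδ, fun E hE hE' => (Finset.sum_le_sum fun i hi => ?_).trans_lt (hN E hE hE')⟩
  have := hE.1 i hi
  exact h _ this.1 _ this.2

variable {E : Type*} [NormedAddCommGroup E] [InnerProductSpace ℂ E] [CompleteSpace E]

lemma integral_sub_of_mem_Icc {X : Type*} [NormedAddCommGroup X] [NormedSpace ℝ X] {v : ℝ → X}
    {c s t : ℝ} (hv : IntervalIntegrable v volume 0 c) (hs : s ∈ Icc 0 c) (ht : t ∈ Icc 0 c) :
    (∫ r in (0 : ℝ)..t, v r) - ∫ r in (0 : ℝ)..s, v r = ∫ r in s..t, v r := by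
  have h : ∀ {u}, u ∈ Icc 0 c → uIcc 0 u ⊆ uIcc 0 c := fun hu => by
    rw [uIcc_of_le (hu.1.trans hu.2), uIcc_of_le hu.1]
    exact Icc_subset_Icc_right hu.2
  exact intervalIntegral.integral_interval_sub_left (hv.mono_set (h ht)) (hv.mono_set (h hs))

/-- Integration by parts for the scalar product of two absolutely continuous functions. -/
theorem inner_sub_inner_eq_integral {c : ℝ} (hc : 0 ≤ c) {F G f g : ℝ → E}
    (hf : IntervalIntegrable f volume 0 c) (hg : IntervalIntegrable g volume 0 c)
    (hF : ∀ t ∈ Icc 0 c, F t = F 0 + ∫ s in (0 : ℝ)..t, f s)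
    (hG : ∀ t ∈ Icc 0 c, G t = G 0 + ∫ s in (0 : ℝ)..t, g s) :
    inner ℂ (F c) (G c) - inner ℂ (F 0) (G 0)
      = ∫ s in (0 : ℝ)..c, (inner ℂ (F s) (g s) + inner ℂ (f s) (G s)) := by
  have hsub : ∀ {s t}, s ∈ Icc 0 c → t ∈ Icc 0 c → uIcc s t ⊆ uIcc 0 c := fun hs ht => by
    rw [uIcc_of_le hc]; exact ordConnected_Icc.uIcc_subset hs ht
  have hcont : ∀ {u v : ℝ → E}, IntervalIntegrable v volume 0 c →
      (∀ t ∈ Icc 0 c, u t = u 0 + ∫ s in (0 : ℝ)..t, v s) → ContinuousOn u (Icc 0 c) := by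
    intro u v hv hu
    have := intervalIntegral.continuousOn_primitive_interval' hv left_mem_uIcc
    rw [uIcc_of_le hc] at this
    exact (this.const_add (u 0)).congr hu
  have hFc := hcont hf hF
  have hGc := hcont hg hG
  obtain ⟨C₁, hC₁⟩ := isCompact_Icc.exists_bound_of_continuousOn hFc
  obtain ⟨C₂, hC₂⟩ := isCompact_Icc.exists_bound_of_continuousOn hGc
  have h0I : (0 : ℝ) ∈ Icc 0 c := ⟨le_rfl, hc⟩
  have hC₁0 : 0 ≤ C₁ := (norm_nonneg _).trans (hC₁ 0 h0I)
  have hC₂0 : 0 ≤ C₂ := (norm_nonneg _).trans (hC₂ 0 h0I)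
  have hii : IntervalIntegrable (fun s => inner ℂ (F s) (g s) + inner ℂ (f s) (G s))
      volume 0 c := by
    rw [intervalIntegrable_iff_integrableOn_Icc_of_le hc] at hf hg ⊢
    have hm1 : AEStronglyMeasurable F (volume.restrict (Icc 0 c)) :=
      hFc.aestronglyMeasurable measurableSet_Icc
    have hm2 : AEStronglyMeasurable G (volume.restrict (Icc 0 c)) :=
      hGc.aestronglyMeasurable measurableSet_Icc
    refine Integrable.add ?_ ?_
    · refine (hg.norm.const_mul C₁).mono' (hm1.inner hg.aestronglyMeasurable) ?_
      filter_upwards [ae_restrict_mem measurableSet_Icc] with s hs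
      exact (norm_inner_le_norm _ _).trans (by gcongr; exact hC₁ s hs)
    · refine (hf.norm.mul_const C₂).mono' (hf.aestronglyMeasurable.inner hm2) ?_
      filter_upwards [ae_restrict_mem measurableSet_Icc] with s hs
      exact (norm_inner_le_norm _ _).trans (by gcongr; exact hC₂ s hs)
  set k : ℝ → ℂ := fun s => inner ℂ (F s) (g s) + inner ℂ (f s) (G s) with hk
  -- The factor `2` accounts for the two contributions to an increment of `P` below: that of the
  -- scalar product and that of the integral of `k`, each bounded by the same integral.
  let b : ℝ → ℝ := fun s => 2 * (C₁ * ‖g s‖ + C₂ * ‖f s‖)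
  have hb : IntervalIntegrable b volume 0 c :=
    ((hg.norm.const_mul C₁).add (hf.norm.const_mul C₂)).const_mul 2
  have hb0 : ∀ s, 0 ≤ b s := fun s => by positivity
  -- `P` is absolutely continuous, being dominated by the primitive `N`, and has derivative zero
  -- almost everywhere; hence it is constant, which is the claim.
  let P : ℝ → ℂ := fun t => inner ℂ (F t) (G t) - ∫ s in (0 : ℝ)..t, k s
  let N : ℝ → ℝ := fun t => ∫ s in (0 : ℝ)..t, b s
  have hle : ∀ s ∈ Icc 0 c, ∀ t ∈ Icc 0 c, s ≤ t → dist (P s) (P t) ≤ dist (N s) (N t) := by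
    intro s hs t ht hst
    have hgi := hg.mono_set (hsub hs ht)
    have hfi := hf.mono_set (hsub hs ht)
    have hbi := hb.mono_set (hsub hs ht)
    -- The product increment is split as `(F t, ΔG) + (ΔF, G s)`; both factors that are not
    -- increments are bounded on `[0, c]`.
    have e1 : P t - P s = inner ℂ (F t) (∫ r in s..t, g r) + inner ℂ (∫ r in s..t, f r) (G s)
        - ∫ r in s..t, k r := by
      have eF : F t - F s = ∫ r in s..t, f r := by
        rw [hF t ht, hF s hs, add_sub_add_left_eq_sub, integral_sub_of_mem_Icc hf hs ht]
      have eG : G t - G s = ∫ r in s..t, g r := by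
        rw [hG t ht, hG s hs, add_sub_add_left_eq_sub, integral_sub_of_mem_Icc hg hs ht]
      rw [← eF, ← eG, ← integral_sub_of_mem_Icc hii hs ht, inner_sub_left, inner_sub_right]
      simp only [P]
      ring
    have e2 : N t - N s = ∫ r in s..t, b r := integral_sub_of_mem_Icc hb hs ht
    have e3 : ‖∫ r in s..t, k r‖ ≤ ∫ r in s..t, (C₁ * ‖g r‖ + C₂ * ‖f r‖) := by
      refine intervalIntegral.norm_integral_le_of_norm_le hst (Eventually.of_forall fun r hr => ?_)
        ((hgi.norm.const_mul C₁).add (hfi.norm.const_mul C₂))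
      have hr' : r ∈ Icc 0 c := ⟨hs.1.trans hr.1.le, hr.2.trans ht.2⟩
      refine (norm_add_le _ _).trans (add_le_add ?_ ?_)
      · exact (norm_inner_le_norm _ _).trans (by gcongr; exact hC₁ r hr')
      · rw [mul_comm]
        exact (norm_inner_le_norm _ _).trans (by gcongr; exact hC₂ r hr')
    have e4 : ‖inner ℂ (F t) (∫ r in s..t, g r)‖ ≤ ∫ r in s..t, C₁ * ‖g r‖ := by
      rw [intervalIntegral.integral_const_mul]
      refine (norm_inner_le_norm _ _).trans ?_
      gcongr
      · exact hC₁ t ht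
      · exact intervalIntegral.norm_integral_le_integral_norm hst
    have e5 : ‖inner ℂ (∫ r in s..t, f r) (G s)‖ ≤ ∫ r in s..t, C₂ * ‖f r‖ := by
      rw [intervalIntegral.integral_const_mul, mul_comm]
      exact (norm_inner_le_norm _ _).trans (mul_le_mul
        (intervalIntegral.norm_integral_le_integral_norm hst) (hC₂ s hs) (norm_nonneg _)
        (intervalIntegral.integral_nonneg hst fun r _ => norm_nonneg _))
    have e6 : ∫ r in s..t, b r = 2 * ∫ r in s..t, (C₁ * ‖g r‖ + C₂ * ‖f r‖) :=
      intervalIntegral.integral_const_mul _ _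
    have e7 := intervalIntegral.integral_add (hgi.norm.const_mul C₁) (hfi.norm.const_mul C₂)
    rw [dist_comm, dist_comm (N s), dist_eq_norm, dist_eq_norm, e1, e2, Real.norm_of_nonneg
      (intervalIntegral.integral_nonneg hst fun r _ => hb0 r)]
    refine (norm_sub_le _ _).trans ?_
    have := norm_add_le (inner ℂ (F t) (∫ r in s..t, g r)) (inner ℂ (∫ r in s..t, f r) (G s))
    linarith
  have hN : AbsolutelyContinuousOnInterval N 0 c :=
    hb.absolutelyContinuousOnInterval_intervalIntegral left_mem_uIcc
  have hP : AbsolutelyContinuousOnInterval P 0 c := by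
    refine absolutelyContinuousOnInterval_of_dist_le hN ?_
    rw [uIcc_of_le hc]
    intro s hs t ht
    rcases le_total s t with h | h
    · exact hle s hs t ht h
    · rw [dist_comm, dist_comm (N s)]
      exact hle t ht s hs h
  have hPd : ∀ᵐ x : ℝ, x ∈ Ioo 0 c → HasDerivAt P 0 x := by
    filter_upwards [hf.ae_hasDerivAt_integral, hg.ae_hasDerivAt_integral,
      hii.ae_hasDerivAt_integral] with x h1 h2 h3 hx
    have hxI : x ∈ uIcc 0 c := by rw [uIcc_of_le hc]; exact Ioo_subset_Icc_self hx
    have hnhds : Icc 0 c ∈ 𝓝 x := Icc_mem_nhds hx.1 hx.2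
    have d1 : HasDerivAt F (f x) x :=
      ((h1 hxI 0 left_mem_uIcc).const_add (F 0)).congr_of_eventuallyEq
        (by filter_upwards [hnhds] with s hs using hF s hs)
    have d2 : HasDerivAt G (g x) x :=
      ((h2 hxI 0 left_mem_uIcc).const_add (G 0)).congr_of_eventuallyEq
        (by filter_upwards [hnhds] with s hs using hG s hs)
    have := (d1.inner ℂ d2).sub (h3 hxI 0 left_mem_uIcc)
    convert! this using 1
    simp [hk]
  have hPd' : ∀ᵐ x : ℝ, x ∈ uIcc 0 c → HasDerivAt P 0 x := by
    have h1 : ∀ᵐ x : ℝ, x ≠ 0 := by simp [ae_iff, measure_singleton]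
    have h2 : ∀ᵐ x : ℝ, x ≠ c := by simp [ae_iff, measure_singleton]
    filter_upwards [hPd, h1, h2] with x hx hx0 hxc hxI
    rw [uIcc_of_le hc] at hxI
    exact hx ⟨lt_of_le_of_ne hxI.1 (Ne.symm hx0), lt_of_le_of_ne hxI.2 hxc⟩
  obtain ⟨C, hC⟩ := hP.const_of_ae_hasDerivAt_zero hPd'
  have q1 := hC 0 left_mem_uIcc
  have q2 := hC c right_mem_uIcc
  simp only [P, intervalIntegral.integral_same, sub_zero] at q1 q2
  rw [q1, ← q2]
  ring

end ProductRule

/-! ### Defect subspaces of symmetric linear relations. -/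

section SymmetricRelations

variable {X : Type*} [NormedAddCommGroup X] [InnerProductSpace ℂ X] {T : Submodule ℂ (X × X)}

lemma mem_defectSubspace_iff {z : ℂ} {x : X} :
    x ∈ defectSubspace T z ↔ (x, z • x) ∈ T.adjoint := Iff.rfl

lemma mem_defectSubspace_iff_inner {z : ℂ} {x : X} :
    x ∈ defectSubspace T z ↔
      ∀ a b, (a, b) ∈ T → inner ℂ (b - (starRingEnd ℂ z) • a) x = 0 := by
  simp only [mem_defectSubspace_iff, Submodule.mem_adjoint_iff, inner_sub_left, inner_smul_left,
    inner_smul_right, Complex.conj_conj]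

lemma inner_comm_of_le_adjoint (hT : T ≤ T.adjoint) {a b a' b' : X} (h : (a, b) ∈ T)
    (h' : (a', b') ∈ T) : inner ℂ b a' = inner ℂ a b' :=
  sub_eq_zero.1 ((Submodule.mem_adjoint_iff T _).1 (hT h') a b h)

/-- Since `(a, b)` lies in a symmetric relation, the scalar product of `a` and `b` is real, so the
imaginary part of that of `a` and `b - z • a` comes only from `z`; Cauchy–Schwarz then gives the
bound. -/
lemma abs_im_mul_norm_le (hT : T ≤ T.adjoint) (z : ℂ) {a b : X} (h : (a, b) ∈ T) :
    |z.im| * ‖a‖ ≤ ‖b - z • a‖ := by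
  have h1 : (inner ℂ a b : ℂ).im = 0 := by
    have := inner_comm_of_le_adjoint hT h h
    rw [← inner_conj_symm] at this
    exact Complex.conj_eq_iff_im.1 this
  have h2 : (inner ℂ a (b - z • a) : ℂ).im = -(z.im * ‖a‖ ^ 2) := by
    rw [inner_sub_right, inner_smul_right, Complex.sub_im, h1, inner_self_eq_norm_sq_to_K]
    simp [← Complex.ofReal_pow]
  have h3 : |z.im| * ‖a‖ ^ 2 ≤ ‖a‖ * ‖b - z • a‖ := by
    calc |z.im| * ‖a‖ ^ 2 = |(inner ℂ a (b - z • a) : ℂ).im| := by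
          rw [h2, abs_neg, abs_mul, abs_of_nonneg (sq_nonneg ‖a‖)]
      _ ≤ ‖(inner ℂ a (b - z • a) : ℂ)‖ := Complex.abs_im_le_norm _
      _ ≤ _ := norm_inner_le_norm _ _
  rcases (norm_nonneg a).eq_or_lt with h0 | h0
  · rw [← h0]; simp
  · nlinarith

variable [CompleteSpace X]

/-- The adjoint of a symmetric relation, shifted by a nonreal number, is surjective. -/
theorem exists_mem_adjoint_sub_smul_eq (hT : T ≤ T.adjoint) {z : ℂ} (hz : z.im ≠ 0) (f : X) :
    ∃ g g', (g, g') ∈ T.adjoint ∧ g' - z • g = f := by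
  -- The requirement on `g` is that its scalar product with `b - conj z • a` equal that of `f` with
  -- `a`, for all `(a, b)` in `T`. The right-hand side is a bounded functional of `b - conj z • a`
  -- by the basic estimate. Its extension by Hahn–Banach and the Riesz theorem produce `g`; neither
  -- closedness of `T` nor density of its domain is needed.
  let ρ : T →ₗ[ℂ] X :=
    (LinearMap.snd ℂ X X - (starRingEnd ℂ z) • LinearMap.fst ℂ X X) ∘ₗ T.subtype
  have hρ : ∀ u : T, |z.im| * ‖u.1.1‖ ≤ ‖ρ u‖ := fun u => by
    have := abs_im_mul_norm_le hT (starRingEnd ℂ z) (a := u.1.1) (b := u.1.2) u.2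
    rwa [Complex.conj_im, abs_neg] at this
  have hz' : 0 < |z.im| := abs_pos.2 hz
  have hinj : Function.Injective ρ := by
    rw [← LinearMap.ker_eq_bot, LinearMap.ker_eq_bot']
    intro u hu
    have h1 : u.1.1 = 0 := by
      have := hρ u
      rw [hu, norm_zero] at this
      exact norm_le_zero_iff.1 (by nlinarith)
    have h2 : u.1.2 = 0 := by
      have : u.1.2 - (starRingEnd ℂ z) • u.1.1 = 0 := hu
      rwa [h1, smul_zero, sub_zero] at this
    exact Subtype.ext (Prod.ext h1 h2)
  let e := LinearEquiv.ofInjective ρ hinj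
  let F : LinearMap.range ρ →ₗ[ℂ] ℂ :=
    (innerSL ℂ f).toLinearMap ∘ₗ LinearMap.fst ℂ X X ∘ₗ T.subtype ∘ₗ e.symm.toLinearMap
  have hF : ∀ r, ‖F r‖ ≤ (‖f‖ * |z.im|⁻¹) * ‖r‖ := by
    intro r
    have h1 := hρ (e.symm r)
    have h2 : ρ (e.symm r) = r := by
      have := congrArg Subtype.val (e.apply_symm_apply r)
      simpa only [e, LinearEquiv.ofInjective_apply] using this
    rw [h2] at h1
    have h3 : ‖(e.symm r).1.1‖ ≤ |z.im|⁻¹ * ‖(r : X)‖ := by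
      rw [inv_mul_eq_div, le_div_iff₀ hz', mul_comm]; exact h1
    calc ‖F r‖ ≤ ‖f‖ * ‖(e.symm r).1.1‖ := norm_inner_le_norm _ _
      _ ≤ ‖f‖ * (|z.im|⁻¹ * ‖(r : X)‖) := by gcongr
      _ = _ := by rw [mul_assoc]; rfl
  obtain ⟨G, hG, -⟩ := exists_extension_norm_eq (LinearMap.range ρ) (F.mkContinuous _ hF)
  let g := (InnerProductSpace.toDual ℂ X).symm G
  have hg : ∀ x, inner ℂ g x = G x := fun x => InnerProductSpace.toDual_symm_apply
  refine ⟨g, f + z • g, (Submodule.mem_adjoint_iff T _).2 fun a b hab => ?_, by simp⟩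
  have h1 : G (b - (starRingEnd ℂ z) • a) = inner ℂ f a := by
    have := hG (e ⟨(a, b), hab⟩)
    simpa [F, e, ρ] using this
  rw [← hg] at h1
  have h2 := congrArg (starRingEnd ℂ) h1
  rw [inner_conj_symm, inner_conj_symm, inner_sub_left, inner_smul_left, Complex.conj_conj] at h2
  simp only [inner_add_right, inner_smul_right]
  rw [← h2]
  ring

/-- If a defect subspace is trivial, the range of the shifted relation is dense. -/
lemma exists_mem_norm_sub_lt {z : ℂ} (h : defectSubspace T z = ⊥) (f : X) {ε : ℝ} (hε : 0 < ε) :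
    ∃ a b, (a, b) ∈ T ∧ ‖f - (b - (starRingEnd ℂ z) • a)‖ < ε := by
  let ρ : X × X →ₗ[ℂ] X := LinearMap.snd ℂ X X - (starRingEnd ℂ z) • LinearMap.fst ℂ X X
  have h1 : (T.map ρ).topologicalClosure = ⊤ := by
    rw [Submodule.topologicalClosure_eq_top_iff, Submodule.eq_bot_iff]
    intro x hx
    rw [← Submodule.mem_bot ℂ, ← h, mem_defectSubspace_iff_inner]
    intro a b hab
    exact (Submodule.mem_orthogonal _ _).1 hx _ (Submodule.mem_map_of_mem hab)
  have h2 : f ∈ closure (T.map ρ : Set X) := by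
    rw [← Submodule.topologicalClosure_coe, h1]; trivial
  obtain ⟨r, hr, hrε⟩ := Metric.mem_closure_iff.1 h2 ε hε
  obtain ⟨⟨a, b⟩, hab, rfl⟩ := hr
  exact ⟨a, b, hab, by simpa [dist_eq_norm, ρ] using hrε⟩

/-- A vector `f` of the defect subspace at `w` is approximated by `r = b - conj z • a` with `(a, b)`
in `T`. Orthogonality of `f` to `b - conj w • a` replaces `r` by `conj (w - z) • a` in its product
with `f`, and the basic estimate bounds that by `q ‖r‖ ‖f‖` with `q = |w - z| / |Im z| < 1`. In the
limit `‖f‖² ≤ q ‖f‖²`. -/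
lemma defectSubspace_eq_bot_of_norm_sub_lt (hT : T ≤ T.adjoint) {z w : ℂ}
    (hzw : ‖w - z‖ < |z.im|) (h : defectSubspace T z = ⊥) : defectSubspace T w = ⊥ := by
  rw [Submodule.eq_bot_iff]
  intro f hf
  have hz' : 0 < |z.im| := (norm_nonneg _).trans_lt hzw
  set q := ‖w - z‖ / |z.im| with hq
  have hq1 : q < 1 := (div_lt_one hz').2 hzw
  have hq0 : 0 ≤ q := by positivity
  rw [mem_defectSubspace_iff_inner] at hf
  have key : ∀ ε > 0, ‖f‖ ^ 2 ≤ q * ‖f‖ ^ 2 + ε * (‖f‖ * (1 + q)) := by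
    intro ε hε
    obtain ⟨a, b, hab, hlt⟩ := exists_mem_norm_sub_lt h f hε
    set r := b - (starRingEnd ℂ z) • a with hr
    have h1 : inner ℂ r f = inner ℂ ((starRingEnd ℂ (w - z)) • a) f := by
      have := hf a b hab
      rw [← sub_eq_zero, ← inner_sub_left, ← this]
      congr 1
      rw [hr, map_sub, sub_smul]
      abel
    have h2 : ‖(inner ℂ r f : ℂ)‖ ≤ q * ‖r‖ * ‖f‖ := by
      rw [h1]
      refine (norm_inner_le_norm _ _).trans ?_
      gcongr
      rw [norm_smul, RCLike.norm_conj, hq, div_mul_eq_mul_div, le_div_iff₀ hz', mul_assoc]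
      gcongr
      rw [mul_comm]
      simpa using abs_im_mul_norm_le hT (starRingEnd ℂ z) hab
    have h3 : ‖f‖ ^ 2 ≤ ‖(inner ℂ r f : ℂ)‖ + ε * ‖f‖ := by
      have e : (inner ℂ f f : ℂ) = inner ℂ r f + inner ℂ (f - r) f := by
        rw [← inner_add_left]; congr 1; abel
      have := congrArg norm e
      rw [inner_self_eq_norm_sq_to_K] at this
      simp only [norm_pow, RCLike.norm_ofReal, abs_norm] at this
      rw [this]
      refine (norm_add_le _ _).trans ?_
      gcongr
      exact (norm_inner_le_norm _ _).trans (by gcongr)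
    have h4 : ‖r‖ ≤ ‖f‖ + ε := by
      have : r = f - (f - r) := by abel
      rw [this]
      exact (norm_sub_le _ _).trans (by gcongr)
    calc ‖f‖ ^ 2 ≤ q * ‖r‖ * ‖f‖ + ε * ‖f‖ := h3.trans (by gcongr)
      _ ≤ q * (‖f‖ + ε) * ‖f‖ + ε * ‖f‖ := by gcongr
      _ = _ := by ring
  have h5 : ‖f‖ ^ 2 ≤ q * ‖f‖ ^ 2 := by
    refine le_of_forall_pos_le_add fun δ hδ => ?_
    have hp : 0 < ‖f‖ * (1 + q) + 1 := by positivity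
    refine (key (δ / (‖f‖ * (1 + q) + 1)) (by positivity)).trans ?_
    gcongr
    rw [div_mul_eq_mul_div, div_le_iff₀ hp]
    nlinarith
  have : ‖f‖ ^ 2 ≤ 0 := by nlinarith [sq_nonneg ‖f‖]
  simpa using le_antisymm this (sq_nonneg _)

/-- Triviality of the defect subspaces of a symmetric relation depends only on the half-plane. -/
theorem defectSubspace_eq_bot_of_same_side (hT : T ≤ T.adjoint) {z w : ℂ}
    (hzw : 0 < z.im * w.im) (h : defectSubspace T z = ⊥) : defectSubspace T w = ⊥ := by
  have hm : 0 < min |z.im| |w.im| := by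
    refine lt_min (abs_pos.2 ?_) (abs_pos.2 ?_) <;> rintro h0 <;> simp [h0] at hzw
  -- The segment from `z` to `w` stays at distance at least `min |Im z| |Im w|` from the real axis,
  -- so `N` equal steps shorter than this distance allow the local statement to be iterated.
  obtain ⟨N, hN⟩ := exists_nat_gt (‖w - z‖ / min |z.im| |w.im|)
  have hN0 : (0 : ℝ) < N := lt_of_le_of_lt (by positivity) hN
  let u : ℕ → ℂ := fun k => z + ((k / N : ℝ) : ℂ) * (w - z)
  have him : ∀ k ≤ N, min |z.im| |w.im| ≤ |(u k).im| := by
    intro k hk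
    have hs0 : (0 : ℝ) ≤ k / N := by positivity
    have hs1 : (k / N : ℝ) ≤ 1 := (div_le_one hN0).2 (by exact_mod_cast hk)
    have e : (u k).im = (1 - k / N) * z.im + (k / N) * w.im := by
      simp only [u, Complex.add_im, Complex.im_ofReal_mul, Complex.sub_im]
      ring
    rw [e]
    generalize (k / N : ℝ) = s at hs0 hs1
    rcases lt_trichotomy z.im 0 with h1 | h1 | h1
    · have h2 : w.im < 0 := by nlinarith
      rw [abs_of_neg h1, abs_of_neg h2, abs_of_nonpos (by nlinarith)]
      have := min_le_left (-z.im) (-w.im)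
      have := min_le_right (-z.im) (-w.im)
      nlinarith
    · simp [h1] at hzw
    · have h2 : 0 < w.im := by nlinarith
      rw [abs_of_pos h1, abs_of_pos h2, abs_of_nonneg (by nlinarith)]
      have := min_le_left z.im w.im
      have := min_le_right z.im w.im
      nlinarith
  have hu : ∀ k ≤ N, defectSubspace T (u k) = ⊥ := by
    intro k
    induction k with
    | zero => intro _; simpa [u] using h
    | succ k ih =>
      intro hk
      refine defectSubspace_eq_bot_of_norm_sub_lt hT ?_ (ih (by omega))
      have e : u (k + 1) - u k = ((1 / N : ℝ) : ℂ) * (w - z) := by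
        simp only [u]
        push_cast
        ring
      rw [e, norm_mul, Complex.norm_real, Real.norm_of_nonneg (by positivity)]
      refine lt_of_lt_of_le ?_ (him k (by omega))
      rw [div_lt_iff₀ hm] at hN
      rw [one_div, inv_mul_eq_div, div_lt_iff₀ hN0, mul_comm]
      exact hN
  have := hu N le_rfl
  have e : u N = w := by
    simp only [u]
    rw [div_self hN0.ne']
    simp
  rwa [e] at this

/-- A symmetric relation with trivial defect subspaces is essentially selfadjoint: its adjoint is
symmetric. -/
theorem inner_comm_of_defectSubspace_eq_bot (hT : T ≤ T.adjoint) {z : ℂ} (hz : z.im ≠ 0)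
    (h₁ : defectSubspace T z = ⊥) (h₂ : defectSubspace T (starRingEnd ℂ z) = ⊥) {f f' g g' : X}
    (hf : (f, f') ∈ T.adjoint) (hg : (g, g') ∈ T.adjoint) : inner ℂ f' g = inner ℂ f g' := by
  have hz' : 0 < |z.im| := abs_pos.2 hz
  -- `(f, f')` is shown to be a limit of elements `(a k, b k)` of `T`. Density of the range gives
  -- convergence of `b - conj z • a`, and the basic estimate then convergence of `a`.
  choose a b hab hlt using fun k : ℕ => exists_mem_norm_sub_lt h₁ (f' - (starRingEnd ℂ z) • f)
    (Nat.one_div_pos_of_nat (α := ℝ) (n := k))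
  have hr : Tendsto (fun k => b k - (starRingEnd ℂ z) • a k) atTop
      (𝓝 (f' - (starRingEnd ℂ z) • f)) := by
    rw [tendsto_iff_norm_sub_tendsto_zero]
    refine squeeze_zero (fun _ => norm_nonneg _) (fun k => ?_)
      tendsto_one_div_add_atTop_nhds_zero_nat
    rw [norm_sub_rev]
    exact (hlt k).le
  have hac : CauchySeq a := by
    have hrc := hr.cauchySeq
    rw [Metric.cauchySeq_iff] at hrc ⊢
    intro ε hε
    obtain ⟨N, hN⟩ := hrc (|z.im| * ε) (by positivity)
    refine ⟨N, fun m hm k hk => ?_⟩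
    have h3 := hN m hm k hk
    have h4 := abs_im_mul_norm_le hT (starRingEnd ℂ z) (T.sub_mem (hab m) (hab k))
    rw [dist_eq_norm] at h3 ⊢
    have e : b m - b k - (starRingEnd ℂ z) • (a m - a k)
        = b m - (starRingEnd ℂ z) • a m - (b k - (starRingEnd ℂ z) • a k) := by
      rw [smul_sub]; abel
    rw [e] at h4
    simp only [Complex.conj_im, abs_neg] at h4
    exact lt_of_mul_lt_mul_left (h4.trans_lt h3) hz'.le
  obtain ⟨t, ht⟩ := cauchySeq_tendsto_of_complete hac
  have hb : Tendsto b atTop (𝓝 (f' - (starRingEnd ℂ z) • f + (starRingEnd ℂ z) • t)) := by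
    have := hr.add (ht.const_smul (starRingEnd ℂ z))
    refine this.congr fun k => by simp
  have hgreen : ∀ x x', (x, x') ∈ T.adjoint →
      inner ℂ (f' - (starRingEnd ℂ z) • f + (starRingEnd ℂ z) • t) x = inner ℂ t x' := by
    intro x x' hx
    have l1 := hb.inner (tendsto_const_nhds (x := x)) (𝕜 := ℂ)
    have l2 := ht.inner (tendsto_const_nhds (x := x')) (𝕜 := ℂ)
    refine tendsto_nhds_unique l1 (l2.congr fun k => ?_)
    exact (sub_eq_zero.1 ((Submodule.mem_adjoint_iff T _).1 hx _ _ (hab k))).symm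
  -- The limit pair lies in the adjoint and has the same image as `(f, f')` under the shift by `conj
  -- z`; their difference is in the other defect subspace, which is trivial.
  have htf : f - t = 0 := by
    rw [← Submodule.mem_bot ℂ, ← h₂, mem_defectSubspace_iff]
    have h5 : (t, f' - (starRingEnd ℂ z) • f + (starRingEnd ℂ z) • t) ∈ T.adjoint := by
      rw [Submodule.mem_adjoint_iff]
      intro c d hcd
      have := hgreen c d (hT hcd)
      have h6 := congrArg (starRingEnd ℂ) this
      rw [inner_conj_symm, inner_conj_symm] at h6
      simp only
      rw [h6, sub_self]
    convert! T.adjoint.sub_mem hf h5 using 1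
    ext
    · simp
    · simp only [Prod.snd_sub, smul_sub]
      abel
  have hft : t = f := (sub_eq_zero.1 htf).symm
  have := hgreen g g' hg
  rwa [hft, sub_add_cancel] at this

end SymmetricRelations

/-! ### Dimension of a selfadjoint relation. -/

section FiniteDimensional

variable {X : Type*} [NormedAddCommGroup X] [InnerProductSpace ℂ X] [FiniteDimensional ℂ X]

/-- The adjoint is the orthogonal complement of a rotated copy of the relation in `X ⊕ X`, so the
dimensions of a relation and of its adjoint add up to `2 dim X`. -/
lemma finrank_of_isSelfAdjointRelation {θ : Submodule ℂ (X × X)} (hθ : IsSelfAdjointRelation θ) :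
    Module.finrank ℂ θ = Module.finrank ℂ X := by
  have h : Module.finrank ℂ θ.adjoint + Module.finrank ℂ θ = 2 * Module.finrank ℂ X := by
    unfold Submodule.adjoint
    have e : Module.finrank ℂ (WithLp 2 (X × X)) = 2 * Module.finrank ℂ X := by
      rw [(WithLp.linearEquiv 2 ℂ (X × X)).finrank_eq, Module.finrank_prod, two_mul]
    have : FiniteDimensional ℂ (WithLp 2 (X × X)) :=
      (WithLp.linearEquiv 2 ℂ (X × X)).symm.finiteDimensional
    rw [LinearEquiv.finrank_map_eq (WithLp.linearEquiv 2 ℂ (X × X)), ← e]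
    rw [← Submodule.finrank_add_finrank_orthogonal (K := (θ.map (((LinearEquiv.skewSwap ℂ X X).symm.trans
      (WithLp.linearEquiv 2 ℂ (X × X)).symm).toLinearMap))), LinearEquiv.finrank_map_eq, add_comm]
  rw [hθ] at h
  omega

end FiniteDimensional

/-! ### Coordinates and the boundary form on `H^{2n}`. -/

section Coordinates

variable {H : Type*} [NormedAddCommGroup H] [InnerProductSpace ℂ H]

/-- The `k`-th coordinate on `H^{2n}`, zero for `k ≥ 2n`. -/
def coord (H : Type*) [NormedAddCommGroup H] [InnerProductSpace ℂ H] (n k : ℕ) :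
    HilbertPow H (2 * n) →L[ℂ] H :=
  if h : k < 2 * n then PiLp.proj 2 (fun _ : Fin (2 * n) => H) ⟨k, h⟩ else 0

/-- The embedding of `H` into the `k`-th coordinate of `H^{2n}`. -/
def coordEmb (H : Type*) [NormedAddCommGroup H] [InnerProductSpace ℂ H] {n : ℕ} (k : Fin (2 * n)) :
    H →L[ℂ] HilbertPow H (2 * n) :=
  ((PiLp.continuousLinearEquiv 2 ℂ (fun _ : Fin (2 * n) => H)).symm :
    (Fin (2 * n) → H) →L[ℂ] HilbertPow H (2 * n)) ∘L
    ContinuousLinearMap.single ℂ (fun _ : Fin (2 * n) => H) k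

variable {n : ℕ}

lemma coord_apply {k : ℕ} (hk : k < 2 * n) (x : HilbertPow H (2 * n)) :
    coord H n k x = x ⟨k, hk⟩ := by
  simp [coord, hk]

lemma coord_of_le {k : ℕ} (hk : 2 * n ≤ k) : coord H n k = 0 := by
  simp [coord, not_lt.2 hk]

lemma ext_coord {x y : HilbertPow H (2 * n)} (h : ∀ k < 2 * n, coord H n k x = coord H n k y) :
    x = y := by
  ext k
  simpa [coord_apply k.2] using h k k.2

lemma coord_coordEmb {k : ℕ} (hk : k < 2 * n) (j : Fin (2 * n)) (h : H) :
    coord H n k (coordEmb H j h) = if k = j then h else 0 := by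
  rw [coord_apply hk]
  simp only [coordEmb, ContinuousLinearMap.comp_apply]
  change (Pi.single j h : Fin (2 * n) → H) ⟨k, hk⟩ = _
  by_cases hkj : k = j
  · subst hkj; simp
  · rw [if_neg hkj, Pi.single_eq_of_ne]
    exact fun e => hkj (congrArg Fin.val e)

/-- The first half `(x_0, …, x_{n-1})` of the coordinates of `x ∈ H^{2n}`. -/
def lowerHalf (H : Type*) [NormedAddCommGroup H] [InnerProductSpace ℂ H] (n : ℕ) :
    HilbertPow H (2 * n) →L[ℂ] HilbertPow H n :=
  ((PiLp.continuousLinearEquiv 2 ℂ (fun _ : Fin n => H)).symm :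
    (Fin n → H) →L[ℂ] HilbertPow H n) ∘L ContinuousLinearMap.pi fun k : Fin n => coord H n k

/-- The reversed second half `(x_{2n-1}, …, x_n)` of the coordinates of `x ∈ H^{2n}`. -/
def upperHalf (H : Type*) [NormedAddCommGroup H] [InnerProductSpace ℂ H] (n : ℕ) :
    HilbertPow H (2 * n) →L[ℂ] HilbertPow H n :=
  ((PiLp.continuousLinearEquiv 2 ℂ (fun _ : Fin n => H)).symm :
    (Fin n → H) →L[ℂ] HilbertPow H n) ∘L
    ContinuousLinearMap.pi fun k : Fin n => coord H n (2 * n - (k + 1))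

lemma lowerHalf_apply (x : HilbertPow H (2 * n)) (k : Fin n) :
    lowerHalf H n x k = coord H n k x := rfl

lemma upperHalf_apply (x : HilbertPow H (2 * n)) (k : Fin n) :
    upperHalf H n x k = coord H n (2 * n - (k + 1)) x := rfl

/-- The inverse of `x ↦ (lowerHalf x, upperHalf x)`. -/
def joinHalves (H : Type*) [NormedAddCommGroup H] [InnerProductSpace ℂ H] (n : ℕ) :
    HilbertPow H n × HilbertPow H n →L[ℂ] HilbertPow H (2 * n) :=
  ((PiLp.continuousLinearEquiv 2 ℂ (fun _ : Fin (2 * n) => H)).symm :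
    (Fin (2 * n) → H) →L[ℂ] HilbertPow H (2 * n)) ∘L
    ContinuousLinearMap.pi fun k : Fin (2 * n) =>
      if h : (k : ℕ) < n then
        (PiLp.proj 2 (fun _ : Fin n => H) ⟨k, h⟩ : HilbertPow H n →L[ℂ] H) ∘L
          ContinuousLinearMap.fst ℂ _ _
      else (PiLp.proj 2 (fun _ : Fin n => H) ⟨2 * n - 1 - k, by omega⟩ : HilbertPow H n →L[ℂ] H) ∘L
          ContinuousLinearMap.snd ℂ _ _

lemma coord_joinHalves_of_lt (u : HilbertPow H n × HilbertPow H n) {k : ℕ} (hk : k < n) :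
    coord H n k (joinHalves H n u) = u.1 ⟨k, hk⟩ := by
  rw [coord_apply (by omega)]
  change (if h : k < n then
        (PiLp.proj 2 (fun _ : Fin n => H) ⟨k, h⟩ : HilbertPow H n →L[ℂ] H) ∘L
          ContinuousLinearMap.fst ℂ _ _
      else (PiLp.proj 2 (fun _ : Fin n => H) ⟨2 * n - 1 - k, by omega⟩ : HilbertPow H n →L[ℂ] H) ∘L
          ContinuousLinearMap.snd ℂ _ _) u = _
  rw [dif_pos hk]
  rfl

lemma coord_joinHalves_of_ge (u : HilbertPow H n × HilbertPow H n) {k : ℕ} (hk : k < n) :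
    coord H n (2 * n - (k + 1)) (joinHalves H n u) = u.2 ⟨k, hk⟩ := by
  rw [coord_apply (by omega)]
  change (if h : 2 * n - (k + 1) < n then
        (PiLp.proj 2 (fun _ : Fin n => H) ⟨2 * n - (k + 1), h⟩ : HilbertPow H n →L[ℂ] H) ∘L
          ContinuousLinearMap.fst ℂ _ _
      else (PiLp.proj 2 (fun _ : Fin n => H) ⟨2 * n - 1 - (2 * n - (k + 1)), by omega⟩ :
          HilbertPow H n →L[ℂ] H) ∘L ContinuousLinearMap.snd ℂ _ _) u = _
  rw [dif_neg (by omega)]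
  exact congrArg (fun i : Fin n => u.2 i) (Fin.ext (by simp only; omega))

lemma lowerHalf_joinHalves (u : HilbertPow H n × HilbertPow H n) :
    lowerHalf H n (joinHalves H n u) = u.1 := by
  ext k
  rw [lowerHalf_apply, coord_joinHalves_of_lt u k.2]

lemma upperHalf_joinHalves (u : HilbertPow H n × HilbertPow H n) :
    upperHalf H n (joinHalves H n u) = u.2 := by
  ext k
  rw [upperHalf_apply, coord_joinHalves_of_ge u k.2]

lemma ext_halves {x y : HilbertPow H (2 * n)} (h₁ : lowerHalf H n x = lowerHalf H n y)
    (h₂ : upperHalf H n x = upperHalf H n y) : x = y := by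
  refine ext_coord fun k hk => ?_
  by_cases hkn : k < n
  · exact congrArg (fun u : HilbertPow H n => u ⟨k, hkn⟩) h₁
  · have := congrArg (fun u : HilbertPow H n => u ⟨2 * n - 1 - k, by omega⟩) h₂
    simp only [upperHalf_apply] at this
    rwa [show 2 * n - (2 * n - 1 - k + 1) = k by omega] at this

/-- The linear equivalence `x ↦ (lowerHalf x, upperHalf x)`. -/
def halvesEquiv (H : Type*) [NormedAddCommGroup H] [InnerProductSpace ℂ H] (n : ℕ) :
    HilbertPow H (2 * n) ≃ₗ[ℂ] HilbertPow H n × HilbertPow H n where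
  toFun x := (lowerHalf H n x, upperHalf H n x)
  map_add' x y := by simp
  map_smul' c x := by simp
  invFun u := joinHalves H n u
  left_inv x := ext_halves (lowerHalf_joinHalves _) (upperHalf_joinHalves _)
  right_inv u := Prod.ext (lowerHalf_joinHalves _) (upperHalf_joinHalves _)

/-- The boundary form on `H^{2n}`, linear in the first argument. -/
def boundaryForm (x y : HilbertPow H (2 * n)) : ℂ :=
  inner ℂ (upperHalf H n y) (lowerHalf H n x) - inner ℂ (lowerHalf H n y) (upperHalf H n x)

/-- The pairing of coordinate `k` with coordinate `2n - 1 - k` is the arrangement in which the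
skewness of the system matrix becomes a telescoping sum. -/
lemma boundaryForm_eq_sum (x y : HilbertPow H (2 * n)) :
    boundaryForm x y = ∑ k ∈ Finset.range n,
      (inner ℂ (coord H n (2 * n - (k + 1)) y) (coord H n k x)
        - inner ℂ (coord H n k y) (coord H n (2 * n - (k + 1)) x)) := by
  rw [Finset.sum_range]
  simp only [boundaryForm, PiLp.inner_apply, lowerHalf_apply, upperHalf_apply,
    Finset.sum_sub_distrib]

variable [CompleteSpace H]

/-- The operator of the boundary form. -/
def boundaryOp (H : Type*) [NormedAddCommGroup H] [InnerProductSpace ℂ H] [CompleteSpace H]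
    (n : ℕ) : HilbertPow H (2 * n) →L[ℂ] HilbertPow H (2 * n) :=
  (upperHalf H n).adjoint ∘L lowerHalf H n - (lowerHalf H n).adjoint ∘L upperHalf H n

lemma inner_boundaryOp (x y : HilbertPow H (2 * n)) :
    inner ℂ y (boundaryOp H n x) = boundaryForm x y := by
  simp [boundaryOp, boundaryForm, ContinuousLinearMap.adjoint_inner_right]

lemma boundaryForm_add_left (x x' y : HilbertPow H (2 * n)) :
    boundaryForm (x + x') y = boundaryForm x y + boundaryForm x' y := by
  simp only [← inner_boundaryOp, map_add, inner_add_right]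

lemma boundaryForm_add_right (x y y' : HilbertPow H (2 * n)) :
    boundaryForm x (y + y') = boundaryForm x y + boundaryForm x y' := by
  simp only [← inner_boundaryOp, inner_add_left]

lemma boundaryForm_zero_left (y : HilbertPow H (2 * n)) : boundaryForm 0 y = 0 := by
  simp [← inner_boundaryOp]

lemma boundaryForm_zero_right (x : HilbertPow H (2 * n)) : boundaryForm x 0 = 0 := by
  simp [← inner_boundaryOp]

lemma eq_zero_of_boundaryForm_eq_zero {x : HilbertPow H (2 * n)}
    (h : ∀ y, boundaryForm x y = 0) : x = 0 := by
  -- The test vector is `x` rotated by the symplectic structure, for which the form equals the sum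
  -- of the squared norms of the two halves.
  have := h (joinHalves H n (-upperHalf H n x, lowerHalf H n x))
  rw [boundaryForm, lowerHalf_joinHalves, upperHalf_joinHalves, inner_neg_left, sub_neg_eq_add,
    inner_self_eq_norm_sq_to_K, inner_self_eq_norm_sq_to_K] at this
  dsimp only at this
  have h2 : ‖lowerHalf H n x‖ ^ 2 + ‖upperHalf H n x‖ ^ 2 = 0 := by
    exact Complex.ofReal_injective (by push_cast; exact this)
  have h3 : lowerHalf H n x = 0 := by
    rw [← norm_eq_zero]; nlinarith [sq_nonneg ‖lowerHalf H n x‖, sq_nonneg ‖upperHalf H n x‖]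
  have h4 : upperHalf H n x = 0 := by
    rw [← norm_eq_zero]; nlinarith [sq_nonneg ‖lowerHalf H n x‖, sq_nonneg ‖upperHalf H n x‖]
  exact ext_halves (by rw [h3, map_zero]) (by rw [h4, map_zero])

end Coordinates

namespace DiffExpr

/-! ### The first order system for the quasi-derivatives and its skew symmetry. -/

section FirstOrderSystem

variable {H : Type*} [NormedAddCommGroup H] [InnerProductSpace ℂ H] [CompleteSpace H] {n : ℕ}

section General

variable {E : Type*} [NormedAddCommGroup E] [NormedSpace ℂ E] [Module (H →L[ℂ] H) E]

/-- The functions `x_k`, `0 ≤ k < 2n`, and `w` satisfy on `Δ` the first order system equivalent to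
the definition of the quasi-derivatives, except for the equation for `x_{2n-1}'`. -/
structure IsQuasiSystem (l : DiffExpr H n) (x : ℕ → ℝ → E) (w : ℝ → E) : Prop where
  deriv_lower : ∀ k < n, ∀ t ∈ l.interval,
    HasDerivWithinAt (x k) (if k + 1 < n then x (k + 1) t else w t) l.interval t
  mid : ∀ t ∈ l.interval,
    x n t = l.p 0 t • w t - (Complex.I / 2) • (l.q 0 t • x (n - 1) t)
  deriv_upper : ∀ j, j + 1 < n → ∀ t ∈ l.interval,
    HasDerivWithinAt (x (n + j)) (-x (n + j + 1) t + (l.p (j + 1) t • x (n - (j + 1)) t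
      + (Complex.I / 2) • ((l.q j t).adjoint • (if n - j < n then x (n - j) t else w t))
      - (Complex.I / 2) • (l.q (j + 1) t • x (n - (j + 2)) t))) l.interval t

variable {l : DiffExpr H n} {x : ℕ → ℝ → E} {w : ℝ → E}

lemma IsQuasiSystem.iteratedDerivWithin_eq (hx : l.IsQuasiSystem x w) {k : ℕ} (hk : k ≤ n) {t : ℝ}
    (ht : t ∈ l.interval) :
    iteratedDerivWithin k (x 0) l.interval t = if k < n then x k t else w t := by
  have hn := l.n_pos
  induction k generalizing t with
  | zero => simp [hn]
  | succ k ih =>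
    rw [iteratedDerivWithin_succ, derivWithin_congr (f := x k)
      (fun s hs => by rw [ih (by omega) hs, if_pos (by omega)])
      (by rw [ih (by omega) ht, if_pos (by omega)])]
    exact (hx.deriv_lower k (by omega) t ht).derivWithin (l.uniqueDiffOn_interval t ht)

lemma IsQuasiSystem.quasiDerivUpper_eq (hx : l.IsQuasiSystem x w) {j : ℕ} (hj : j < n) {t : ℝ}
    (ht : t ∈ l.interval) : l.quasiDerivUpper (x 0) j t = x (n + j) t := by
  have hn := l.n_pos
  induction j generalizing t with
  | zero =>
    simp only [quasiDerivUpper]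
    rw [hx.iteratedDerivWithin_eq le_rfl ht, hx.iteratedDerivWithin_eq (by omega) ht,
      if_neg (by omega), if_pos (by omega), add_zero, hx.mid t ht]
  | succ j ih =>
    have hlow : ∀ k < n, iteratedDerivWithin k (x 0) l.interval t = x k t := fun k hk => by
      rw [hx.iteratedDerivWithin_eq hk.le ht, if_pos hk]
    simp only [quasiDerivUpper]
    rw [derivWithin_congr (f := x (n + j)) (fun s hs => ih (by omega) hs) (ih (by omega) ht),
      (hx.deriv_upper j hj t ht).derivWithin (l.uniqueDiffOn_interval t ht),
      hlow (n - (j + 1)) (by omega), hlow (n - (j + 2)) (by omega),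
      hx.iteratedDerivWithin_eq (Nat.sub_le n j) ht, if_pos hj, ← add_assoc n j 1]
    abel

lemma IsQuasiSystem.quasiDeriv_eq (hx : l.IsQuasiSystem x w) {k : ℕ} (hk : k < 2 * n) {t : ℝ}
    (ht : t ∈ l.interval) : l.quasiDeriv (x 0) k t = x k t := by
  unfold quasiDeriv
  split_ifs with h
  · rw [hx.iteratedDerivWithin_eq h.le ht, if_pos h]
  · rw [hx.quasiDerivUpper_eq (by omega) ht]
    congr 1
    omega

lemma IsQuasiSystem.expr_eq (hx : l.IsQuasiSystem x w) {t : ℝ} (ht : t ∈ l.interval) {f : E}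
    (hd : HasDerivWithinAt (x (2 * n - 1)) (-f + (l.p n t • x 0 t + (Complex.I / 2) •
      ((l.q (n - 1) t).adjoint • (if 1 < n then x 1 t else w t)))) l.interval t) :
    l.expr (x 0) t = f := by
  have hn := l.n_pos
  rw [expr, quasiDeriv, if_neg (by omega), show 2 * n - n = (n - 1) + 1 by omega]
  simp only [quasiDerivUpper]
  have e : n + (n - 1) = 2 * n - 1 := by omega
  rw [derivWithin_congr (f := x (2 * n - 1))
    (fun s hs => by rw [hx.quasiDerivUpper_eq (by omega) hs, e])
    (by rw [hx.quasiDerivUpper_eq (by omega) ht, e]),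
    hd.derivWithin (l.uniqueDiffOn_interval t ht),
    show n - (n - 1 + 1) = 0 by omega, show n - (n - 1) = 1 by omega,
    show n - 1 + 1 = n by omega, if_neg (lt_irrefl n),
    hx.iteratedDerivWithin_eq (Nat.zero_le n) ht, hx.iteratedDerivWithin_eq hn ht, if_pos hn]
  abel

/-- Converse of the preceding lemmas. The `n`-th derivative occurs as the separate function `w`,
because the coordinate of index `n` is `y^{[n]}` and not `y^{(n)}`. -/
lemma isQuasiSystem_quasiDeriv {y : ℝ → E}
    (hy : ∀ k, k + 1 < 2 * n → DifferentiableOn ℝ (l.quasiDeriv y k) l.interval) :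
    l.IsQuasiSystem (l.quasiDeriv y) (iteratedDerivWithin n y l.interval) := by
  have hn := l.n_pos
  have hlow : ∀ k < n, l.quasiDeriv y k = iteratedDerivWithin k y l.interval := fun k hk => by
    rw [quasiDeriv, if_pos hk]
  have hup : ∀ j, l.quasiDeriv y (n + j) = l.quasiDerivUpper y j := fun j => by
    rw [quasiDeriv, if_neg (by omega), Nat.add_sub_cancel_left]
  refine ⟨fun k hk t ht => ?_, fun t ht => ?_, fun j hj t ht => ?_⟩
  · have h := (hy k (by omega) t ht).hasDerivWithinAt
    convert! h using 1
    rw [hlow k hk, ← iteratedDerivWithin_succ]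
    split_ifs with h1
    · rw [hlow _ h1]
    · exact congrArg (fun k => iteratedDerivWithin k y l.interval t) (by omega : n = k + 1)
  · have := hup 0
    rw [add_zero] at this
    rw [this, hlow (n - 1) (by omega)]
    rfl
  · have h := (hy (n + j) (by omega) t ht).hasDerivWithinAt
    convert! h using 1
    rw [show n + j + 1 = n + (j + 1) by omega, hup, hup, hlow (n - (j + 1)) (by omega),
      hlow (n - (j + 2)) (by omega)]
    simp only [quasiDerivUpper]
    rw [if_pos hj]
    have : (if n - j < n then l.quasiDeriv y (n - j) t
        else iteratedDerivWithin n y l.interval t) = iteratedDerivWithin (n - j) y l.interval t := by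
      split_ifs with h1
      · rw [hlow _ h1]
      · exact congrArg (fun k => iteratedDerivWithin k y l.interval t) (by omega : n = n - j)
    rw [this]
    abel

lemma expr_eq_neg_derivWithin (y : ℝ → E) (t : ℝ) :
    l.expr y t = -derivWithin (l.quasiDeriv y (2 * n - 1)) l.interval t
      + (l.p n t • l.quasiDeriv y 0 t + (Complex.I / 2) • ((l.q (n - 1) t).adjoint •
        (if 1 < n then l.quasiDeriv y 1 t else iteratedDerivWithin n y l.interval t))) := by
  have hn := l.n_pos
  have e1 : l.quasiDeriv y (2 * n - 1) = l.quasiDerivUpper y (n - 1) := by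
    rw [quasiDeriv, if_neg (by omega)]
    congr 1
    omega
  have e2 : l.quasiDeriv y 0 t = iteratedDerivWithin 0 y l.interval t := by
    rw [quasiDeriv, if_pos hn]
  have e3 : (if 1 < n then l.quasiDeriv y 1 t else iteratedDerivWithin n y l.interval t)
      = iteratedDerivWithin 1 y l.interval t := by
    split_ifs with h
    · rw [quasiDeriv, if_pos h]
    · exact congrArg (fun k => iteratedDerivWithin k y l.interval t) (by omega : n = 1)
  rw [e1, e2, e3, expr, quasiDeriv, if_neg (by omega), show 2 * n - n = (n - 1) + 1 by omega]
  simp only [quasiDerivUpper]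
  rw [if_neg (by omega), show n - (n - 1 + 1) = 0 by omega, show n - (n - 1) = 1 by omega,
    show n - 1 + 1 = n by omega, sub_zero]

end General

/-- `y^{(k)}`, `0 ≤ k ≤ n`, as an operator applied to the vector of quasi-derivatives. -/
def derivOp (l : DiffExpr H n) (t : ℝ) (k : ℕ) : HilbertPow H (2 * n) →L[ℂ] H :=
  if k < n then coord H n k
  else Ring.inverse (l.p 0 t) ∘L
    (coord H n n + (Complex.I / 2) • (l.q 0 t ∘L coord H n (n - 1)))

/-- The rows of the coefficient matrix of the first order system. -/
def fieldCoord (l : DiffExpr H n) (t : ℝ) (k : ℕ) : HilbertPow H (2 * n) →L[ℂ] H :=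
  if k < n then l.derivOp t (k + 1)
  else -coord H n (k + 1) + (l.p (k - n + 1) t ∘L l.derivOp t (n - (k - n + 1))
    + (Complex.I / 2) • ((l.q (k - n) t).adjoint ∘L l.derivOp t (n - (k - n)))
    - (if k - n + 1 < n then
        (Complex.I / 2) • (l.q (k - n + 1) t ∘L l.derivOp t (n - (k - n + 2))) else 0))

/-- The coefficient matrix of the first order system equivalent to `l[y] = 0`. -/
def field (l : DiffExpr H n) (t : ℝ) : HilbertPow H (2 * n) →L[ℂ] HilbertPow H (2 * n) :=
  ∑ k : Fin (2 * n), coordEmb H k ∘L l.fieldCoord t k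

/-- The operator through which `l[y]` enters the first order system. -/
def inputOp (l : DiffExpr H n) : H →L[ℂ] HilbertPow H (2 * n) :=
  -coordEmb H ⟨2 * n - 1, by have := l.n_pos; omega⟩

variable (l : DiffExpr H n)

lemma coord_field (t : ℝ) {k : ℕ} (hk : k < 2 * n) (x : HilbertPow H (2 * n)) :
    coord H n k (l.field t x) = l.fieldCoord t k x := by
  simp only [field, sum_apply, ContinuousLinearMap.comp_apply, map_sum,
    coord_coordEmb hk]
  rw [Finset.sum_eq_single ⟨k, hk⟩]
  · simp
  · intro j _ hj
    rw [if_neg]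
    exact fun e => hj (Fin.ext e.symm)
  · simp

lemma coord_inputOp {k : ℕ} (hk : k < 2 * n) (h : H) :
    coord H n k (l.inputOp h) = if k = 2 * n - 1 then -h else 0 := by
  rw [inputOp, neg_apply, map_neg, coord_coordEmb hk]
  split_ifs <;> simp

lemma _root_.continuousOn_smul_comp {X Y Z : Type*} [NormedAddCommGroup X] [NormedSpace ℂ X]
    [NormedAddCommGroup Y] [NormedSpace ℂ Y] [NormedAddCommGroup Z] [NormedSpace ℂ Z] {s : Set ℝ}
    {f : ℝ → Y →L[ℂ] Z} {g : ℝ → X →L[ℂ] Y} (hf : ContinuousOn f s) (hg : ContinuousOn g s)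
    (c : ℂ) : ContinuousOn (fun t => c • (f t ∘L g t)) s :=
  (hf.clm_comp hg).fun_const_smul c

lemma continuousOn_derivOp (k : ℕ) : ContinuousOn (fun t => l.derivOp t k) l.interval := by
  have hn := l.n_pos
  unfold derivOp
  split_ifs
  · exact continuousOn_const
  · have h2 : ContinuousOn (fun t => (Complex.I / 2) • (l.q 0 t ∘L coord H n (n - 1)))
        l.interval :=
      continuousOn_smul_comp (l.q_continuousOn 0 hn) continuousOn_const _
    have h1 : ContinuousOn (fun t => Ring.inverse (l.p 0 t)) l.interval := by
      intro t ht
      obtain ⟨u, hu⟩ := l.p_zero_isUnit t ht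
      have := NormedRing.inverse_continuousAt u
      rw [hu] at this
      exact this.comp_continuousWithinAt (l.p_continuousOn 0 (by omega) t ht)
    exact h1.clm_comp (continuousOn_const.add h2)

lemma continuousOn_fieldCoord {k : ℕ} (hk : k < 2 * n) :
    ContinuousOn (fun t => l.fieldCoord t k) l.interval := by
  have hd := l.continuousOn_derivOp
  by_cases h1 : k < n
  · simp only [fieldCoord, if_pos h1]
    exact hd _
  have a1 : ContinuousOn (fun t => l.p (k - n + 1) t ∘L l.derivOp t (n - (k - n + 1)))
      l.interval := (l.p_continuousOn _ (by omega)).clm_comp (hd _)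
  have a2 : ContinuousOn (fun t => (l.q (k - n) t).adjoint) l.interval :=
    ContinuousLinearMap.adjoint.continuous.comp_continuousOn (l.q_continuousOn _ (by omega))
  have a3 : ContinuousOn (fun t => (Complex.I / 2) •
      ((l.q (k - n) t).adjoint ∘L l.derivOp t (n - (k - n)))) l.interval :=
    continuousOn_smul_comp a2 (hd _) _
  have a4 : ContinuousOn (fun t => if k - n + 1 < n then
      (Complex.I / 2) • (l.q (k - n + 1) t ∘L l.derivOp t (n - (k - n + 2))) else 0)
      l.interval := by
    by_cases h2 : k - n + 1 < n
    · simp only [if_pos h2]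
      exact continuousOn_smul_comp (l.q_continuousOn _ h2) (hd _) _
    · simp only [if_neg h2]
      exact continuousOn_const
  simp only [fieldCoord, if_neg h1]
  exact continuousOn_const.add ((a1.add a3).sub a4)

lemma continuousOn_field : ContinuousOn l.field l.interval := by
  unfold field
  exact continuousOn_finsetSum _ fun k _ =>
    continuousOn_const.clm_comp (l.continuousOn_fieldCoord k.2)

lemma derivOp_of_lt (t : ℝ) {k : ℕ} (hk : k < n) : l.derivOp t k = coord H n k := by
  rw [derivOp, if_pos hk]

/-- Here and in the next lemma invertibility of `p_0` enters: it allows `y^{(n)}` to be recovered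
from `y^{[n]}` and `y^{(n-1)}`, which closes the first order system. -/
lemma p_zero_derivOp {t : ℝ} (ht : t ∈ l.interval) (x : HilbertPow H (2 * n)) :
    l.p 0 t (l.derivOp t n x)
      = coord H n n x + (Complex.I / 2) • l.q 0 t (coord H n (n - 1) x) := by
  have h : l.p 0 t * Ring.inverse (l.p 0 t) = 1 := Ring.mul_inverse_cancel _ (l.p_zero_isUnit t ht)
  rw [derivOp, if_neg (lt_irrefl n)]
  change (l.p 0 t * Ring.inverse (l.p 0 t)) _ = _
  rw [h]
  rfl

lemma derivOp_of_p_zero {t : ℝ} (ht : t ∈ l.interval) {x : HilbertPow H (2 * n)} {w : H}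
    (h : coord H n n x = l.p 0 t w - (Complex.I / 2) • l.q 0 t (coord H n (n - 1) x)) :
    l.derivOp t n x = w := by
  have h' : Ring.inverse (l.p 0 t) * l.p 0 t = 1 := Ring.inverse_mul_cancel _ (l.p_zero_isUnit t ht)
  rw [derivOp, if_neg (lt_irrefl n)]
  simp only [ContinuousLinearMap.comp_apply, add_apply,
    smul_apply, h, sub_add_cancel]
  change (Ring.inverse (l.p 0 t) * l.p 0 t) w = w
  rw [h']
  rfl

/-- The upper rows are numbered from the end, so that this row is paired with row `k` in the
boundary form. For `k = 0` the coordinate `2n` is zero by convention and the last term is absent. -/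
lemma fieldCoord_upper (t : ℝ) {k : ℕ} (hk : k < n) :
    l.fieldCoord t (2 * n - (k + 1)) = -coord H n (2 * n - k) + (l.p (n - k) t ∘L l.derivOp t k
      + (Complex.I / 2) • ((l.q (n - (k + 1)) t).adjoint ∘L l.derivOp t (k + 1))
      - (if 0 < k then (Complex.I / 2) • (l.q (n - k) t ∘L l.derivOp t (k - 1)) else 0)) := by
  have e : (0 < k) = (n - k < n) := by
    rw [eq_iff_iff]
    omega
  simp only [fieldCoord, if_neg (by omega : ¬ 2 * n - (k + 1) < n), e,
    show 2 * n - (k + 1) + 1 = 2 * n - k by omega,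
    show 2 * n - (k + 1) - n = n - (k + 1) by omega,
    show n - (k + 1) + 1 = n - k by omega,
    show n - (k + 1) + 2 = n - k + 1 by omega,
    show n - (n - k + 1) = k - 1 by omega,
    show n - (n - k) = k by omega, show n - (n - (k + 1)) = k + 1 by omega]

lemma conj_I_div_two : (starRingEnd ℂ) (Complex.I / 2) = -(Complex.I / 2) := by
  rw [map_div₀, Complex.conj_I, map_ofNat, neg_div]

/-- The coefficient matrix is skew with respect to the boundary form. -/
theorem boundaryForm_field {t : ℝ} (ht : t ∈ l.interval) (x y : HilbertPow H (2 * n)) :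
    boundaryForm (l.field t x) y + boundaryForm x (l.field t y) = 0 := by
  have hn := l.n_pos
  rw [boundaryForm_eq_sum, boundaryForm_eq_sum, ← Finset.sum_add_distrib]
  -- The `k`-th summand is the difference `V (k + 1) - V k`. The value `V 0 = 0` reflects the
  -- absence of a coordinate `2n` and of a term with `q_n`; that `V n = 0` is the selfadjointness of
  -- `p_0` combined with the formula for `y^{[n]}`.
  let V : ℕ → ℂ := fun k => if k = 0 then 0 else
    inner ℂ (coord H n (2 * n - k) y) (l.derivOp t k x)
      - inner ℂ (l.derivOp t k y) (coord H n (2 * n - k) x)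
      - (Complex.I / 2) * (inner ℂ (l.derivOp t k y) (l.q (n - k) t (l.derivOp t (k - 1) x))
        + inner ℂ (l.q (n - k) t (l.derivOp t (k - 1) y)) (l.derivOp t k x))
  have hV : ∀ k ∈ Finset.range n,
      (inner ℂ (coord H n (2 * n - (k + 1)) y) (coord H n k (l.field t x))
        - inner ℂ (coord H n k y) (coord H n (2 * n - (k + 1)) (l.field t x))
      + (inner ℂ (coord H n (2 * n - (k + 1)) (l.field t y)) (coord H n k x)
        - inner ℂ (coord H n k (l.field t y)) (coord H n (2 * n - (k + 1)) x)))
      = V (k + 1) - V k := by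
    intro k hk
    have hk : k < n := Finset.mem_range.1 hk
    have hp : ∀ u v : H, inner ℂ u (l.p (n - k) t v) = inner ℂ (l.p (n - k) t u) v := fun u v => by
      have := (l.p_selfAdjoint (n - k) (by omega) t ht).adjoint_eq
      conv_rhs => rw [← this, ContinuousLinearMap.adjoint_inner_left]
    simp only [V, if_neg (Nat.succ_ne_zero k), Nat.add_sub_cancel,
      l.coord_field t (by omega : k < 2 * n),
      l.coord_field t (by omega : 2 * n - (k + 1) < 2 * n), l.fieldCoord_upper t hk]
    simp only [fieldCoord, if_pos hk]
    rcases Nat.eq_zero_or_pos k with rfl | hk0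
    · simp only [lt_irrefl, if_false, if_true, coord_of_le (by omega : 2 * n ≤ 2 * n - 0),
        l.derivOp_of_lt t hn, add_apply, neg_apply, sub_apply, zero_apply, smul_apply,
        ContinuousLinearMap.comp_apply, inner_add_left, inner_add_right, inner_smul_left,
        inner_smul_right, inner_sub_right, inner_sub_left, inner_neg_left, inner_neg_right,
        inner_zero_left, inner_zero_right, conj_I_div_two, hp,
        ContinuousLinearMap.adjoint_inner_left, ContinuousLinearMap.adjoint_inner_right]
      ring
    · simp only [if_neg hk0.ne', if_pos hk0,
        l.derivOp_of_lt t hk, l.derivOp_of_lt t (by omega : k - 1 < n), add_apply, neg_apply,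
        sub_apply, smul_apply, ContinuousLinearMap.comp_apply, inner_add_left, inner_add_right,
        inner_smul_left, inner_smul_right, inner_sub_right, inner_sub_left, inner_neg_left,
        inner_neg_right, conj_I_div_two, hp,
        ContinuousLinearMap.adjoint_inner_left, ContinuousLinearMap.adjoint_inner_right]
      ring
  rw [Finset.sum_congr rfl hV, Finset.sum_range_sub]
  have hp : inner ℂ (l.derivOp t n y) (l.p 0 t (l.derivOp t n x))
      = inner ℂ (l.p 0 t (l.derivOp t n y)) (l.derivOp t n x) := by
    have := (l.p_selfAdjoint 0 (by omega) t ht).adjoint_eq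
    conv_rhs => rw [← this, ContinuousLinearMap.adjoint_inner_left]
  rw [l.p_zero_derivOp ht, l.p_zero_derivOp ht, inner_add_left, inner_add_right, inner_smul_left,
    inner_smul_right] at hp
  rw [conj_I_div_two] at hp
  simp only [V, if_neg hn.ne', if_true, show 2 * n - n = n by omega, Nat.sub_self,
    l.derivOp_of_lt t (by omega : n - 1 < n)]
  linear_combination -hp

end FirstOrderSystem

end DiffExpr

namespace DiffExpr

variable {H : Type*} [NormedAddCommGroup H] [InnerProductSpace ℂ H] [CompleteSpace H] {n : ℕ}

/-! ### Local integrability on `Δ`. -/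

section LocalIntegrability

variable {E : Type*} [NormedAddCommGroup E] {l : DiffExpr H n}

lemma locallyIntegrableOn_congr_ae {f g : ℝ → E} (hf : LocallyIntegrableOn f l.interval)
    (h : f =ᵐ[l.measure] g) : LocallyIntegrableOn g l.interval := by
  intro t ht
  obtain ⟨s, hs, hfs⟩ := hf t ht
  refine ⟨s ∩ l.interval, inter_mem hs self_mem_nhdsWithin, ?_⟩
  exact (hfs.mono_set inter_subset_left).congr_fun_ae
    (ae_mono (Measure.restrict_mono inter_subset_right le_rfl) h)

lemma locallyIntegrableOn_of_memLp {f : ℝ → E} (hf : MemLp f 2 l.measure) :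
    LocallyIntegrableOn f l.interval := by
  intro t ht
  obtain ⟨c, hc, -, hmem⟩ := l.exists_Icc_mem_nhdsWithin ht
  refine ⟨Icc 0 c, hmem, ?_⟩
  exact (hf.mono_measure (Measure.restrict_mono (l.Icc_subset_interval hc) le_rfl)).integrable
    one_le_two

lemma locallyIntegrableOn_of_continuousOn {f : ℝ → E} (hf : ContinuousOn f l.interval) :
    LocallyIntegrableOn f l.interval :=
  hf.locallyIntegrableOn l.measurableSet_interval

lemma locallyIntegrableOn_clm {F : Type*} [NormedAddCommGroup F] [NormedSpace ℂ E]
    [NormedSpace ℂ F] (L : E →L[ℂ] F) {f : ℝ → E} (hf : LocallyIntegrableOn f l.interval) :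
    LocallyIntegrableOn (fun t => L (f t)) l.interval := by
  intro t ht
  obtain ⟨s, hs, hfs⟩ := hf t ht
  exact ⟨s, hs, L.integrable_comp hfs⟩

end LocalIntegrability

/-! ### Quasi-derivatives as rows of the coefficient matrix. -/

section CoefficientRows

variable (l : DiffExpr H n)

lemma derivOp_eq_ite (t : ℝ) {k : ℕ} (hk : k ≤ n) :
    l.derivOp t k = if k < n then coord H n k else l.derivOp t n := by
  split_ifs with h
  · exact l.derivOp_of_lt t h
  · rw [show k = n by omega]

lemma fieldCoord_add (t : ℝ) {j : ℕ} (hj : j + 1 < n) :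
    l.fieldCoord t (n + j) = -coord H n (n + j + 1)
      + (l.p (j + 1) t ∘L coord H n (n - (j + 1)) + (Complex.I / 2) • ((l.q j t).adjoint ∘L
        (if n - j < n then coord H n (n - j) else l.derivOp t n))
        - (Complex.I / 2) • (l.q (j + 1) t ∘L coord H n (n - (j + 2)))) := by
  rw [← l.derivOp_eq_ite t (Nat.sub_le n j), ← l.derivOp_of_lt t (by omega : n - (j + 1) < n),
    ← l.derivOp_of_lt t (by omega : n - (j + 2) < n)]
  simp only [fieldCoord, if_neg (by omega : ¬ n + j < n), Nat.add_sub_cancel_left, if_pos hj]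

lemma fieldCoord_last (t : ℝ) :
    l.fieldCoord t (2 * n - 1) = l.p n t ∘L coord H n 0 + (Complex.I / 2) •
      ((l.q (n - 1) t).adjoint ∘L (if 1 < n then coord H n 1 else l.derivOp t n)) := by
  rw [← l.derivOp_eq_ite t l.n_pos, ← l.derivOp_of_lt t l.n_pos]
  have := l.fieldCoord_upper t l.n_pos
  rw [zero_add] at this
  rw [this, coord_of_le (by omega), if_neg (lt_irrefl 0), neg_zero, zero_add, sub_zero,
    Nat.sub_zero]

variable {l}

lemma isQuasiSystem_of_hasDerivWithinAt {x : ℝ → HilbertPow H (2 * n)}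
    (hx : ∀ k, k + 1 < 2 * n → ∀ t ∈ l.interval,
      HasDerivWithinAt (fun t => coord H n k (x t)) (l.fieldCoord t k (x t)) l.interval t) :
    l.IsQuasiSystem (fun k t => coord H n k (x t)) (fun t => l.derivOp t n (x t)) := by
  refine ⟨fun k hk t ht => ?_, fun t ht => ?_, fun j hj t ht => ?_⟩
  · convert! hx k (by omega) t ht using 1
    rw [fieldCoord, if_pos hk, l.derivOp_eq_ite t hk]
    split_ifs <;> rfl
  · simp only [ContinuousLinearMap.smul_def]
    rw [l.p_zero_derivOp ht, add_sub_cancel_right]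
  · convert! hx (n + j) (by omega) t ht using 1
    rw [l.fieldCoord_add t hj]
    split_ifs <;> rfl

lemma isQuasiSystem_op_of_hasDerivWithinAt {𝒦 : Type*} [NormedAddCommGroup 𝒦]
    [InnerProductSpace ℂ 𝒦] {X : ℝ → 𝒦 →L[ℂ] HilbertPow H (2 * n)}
    (hX : ∀ k, k + 1 < 2 * n → ∀ t ∈ l.interval,
      HasDerivWithinAt (fun t => coord H n k ∘L X t) (l.fieldCoord t k ∘L X t) l.interval t) :
    l.IsQuasiSystem (fun k t => coord H n k ∘L X t) (fun t => l.derivOp t n ∘L X t) := by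
  refine ⟨fun k hk t ht => ?_, fun t ht => ?_, fun j hj t ht => ?_⟩
  · convert! hX k (by omega) t ht using 1
    rw [fieldCoord, if_pos hk, l.derivOp_eq_ite t hk]
    split_ifs <;> rfl
  · ext h
    change _ = l.p 0 t (l.derivOp t n (X t h)) -
      (Complex.I / 2) • (l.q 0 t (coord H n (n - 1) (X t h)))
    rw [l.p_zero_derivOp ht, add_sub_cancel_right]
    rfl
  · convert! hX (n + j) (by omega) t ht using 1
    rw [l.fieldCoord_add t hj]
    split_ifs <;> rfl

/-- The vector of all quasi-derivatives of `y`. -/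
def quasiVec (l : DiffExpr H n) (y : ℝ → H) (t : ℝ) : HilbertPow H (2 * n) :=
  WithLp.toLp 2 fun k : Fin (2 * n) => l.quasiDeriv y k t

lemma coord_quasiVec (y : ℝ → H) (t : ℝ) {k : ℕ} (hk : k < 2 * n) :
    coord H n k (l.quasiVec y t) = l.quasiDeriv y k t := by
  rw [coord_apply hk]; rfl

lemma lowerHalf_quasiVec (y : ℝ → H) (t : ℝ) : lowerHalf H n (l.quasiVec y t) = l.vec1 y t := by
  ext k
  rw [lowerHalf_apply, coord_quasiVec y t (by omega)]
  rfl

lemma upperHalf_quasiVec (y : ℝ → H) (t : ℝ) : upperHalf H n (l.quasiVec y t) = l.vec2 y t := by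
  ext k
  rw [upperHalf_apply, coord_quasiVec y t (by omega)]
  rfl

lemma bracket_eq_boundaryForm (y z : ℝ → H) (t : ℝ) :
    l.bracket y z t = boundaryForm (l.quasiVec y t) (l.quasiVec z t) := by
  simp only [boundaryForm, lowerHalf_quasiVec, upperHalf_quasiVec]
  rfl

lemma fieldCoord_quasiVec {y : ℝ → H} (hy : l.MemDomExpr y) {k : ℕ} (hk : k + 1 < 2 * n) {t : ℝ}
    (ht : t ∈ l.interval) :
    HasDerivWithinAt (l.quasiDeriv y k) (l.fieldCoord t k (l.quasiVec y t)) l.interval t := by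
  have hn := l.n_pos
  have hs := isQuasiSystem_quasiDeriv fun k hk => hy.differentiableOn hk
  have hw : l.derivOp t n (l.quasiVec y t) = iteratedDerivWithin n y l.interval t := by
    refine l.derivOp_of_p_zero ht ?_
    rw [coord_quasiVec y t (by omega), coord_quasiVec y t (by omega), hs.mid t ht]
    rfl
  have hite : ∀ k ≤ n, l.derivOp t k (l.quasiVec y t) = if k < n then l.quasiDeriv y k t
      else iteratedDerivWithin n y l.interval t := fun k hk => by
    rw [l.derivOp_eq_ite t hk]
    split_ifs with h
    · exact coord_quasiVec y t (by omega)
    · exact hw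
  by_cases h : k < n
  · convert! hs.deriv_lower k h t ht using 1
    rw [fieldCoord, if_pos h, hite _ h]
  · obtain ⟨j, rfl⟩ := Nat.exists_eq_add_of_le (not_lt.1 h)
    convert! hs.deriv_upper j (by omega) t ht using 1
    rw [← hite _ (Nat.sub_le n j), l.fieldCoord_add t (by omega), ← l.derivOp_eq_ite t (Nat.sub_le n j),
      ← coord_quasiVec y t (by omega), ← coord_quasiVec y t (by omega),
      ← coord_quasiVec y t (by omega)]
    rfl

/-- This is the last row of the system: `l[y]` enters it with a minus sign, which is the origin of
the sign of `inputOp`. -/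
lemma expr_eq_fieldCoord_sub {y : ℝ → H} (hy : l.MemDomExpr y) {t : ℝ} (ht : t ∈ l.interval) :
    l.expr y t = l.fieldCoord t (2 * n - 1) (l.quasiVec y t)
      - derivWithin (l.quasiDeriv y (2 * n - 1)) l.interval t := by
  have hn := l.n_pos
  have hs := isQuasiSystem_quasiDeriv fun k hk => hy.differentiableOn hk
  have hw : l.derivOp t n (l.quasiVec y t) = iteratedDerivWithin n y l.interval t := by
    refine l.derivOp_of_p_zero ht ?_
    rw [coord_quasiVec y t (by omega), coord_quasiVec y t (by omega), hs.mid t ht]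
    rfl
  have h1 : (if 1 < n then l.quasiDeriv y 1 t else iteratedDerivWithin n y l.interval t)
      = l.derivOp t 1 (l.quasiVec y t) := by
    rw [l.derivOp_eq_ite t hn]
    split_ifs with h
    · exact (coord_quasiVec y t (by omega)).symm
    · exact hw.symm
  rw [expr_eq_neg_derivWithin, h1, fieldCoord_last, ← l.derivOp_eq_ite t hn,
    ← coord_quasiVec y t (by omega), sub_eq_neg_add]
  rfl

end CoefficientRows

/-! ### States: solutions of `l[y] = f` as curves in `H^{2n}`, and the Lagrange identity. -/

section States

/-- `x` is the vector of quasi-derivatives of a solution of `l[y] = f`. -/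
structure IsState (l : DiffExpr H n) (f : ℝ → H) (x : ℝ → HilbertPow H (2 * n)) : Prop where
  continuousOn : ContinuousOn x l.interval
  locallyIntegrableOn : LocallyIntegrableOn f l.interval
  eq : ∀ t ∈ l.interval, x t = x 0 + ∫ s in (0 : ℝ)..t, (l.field s (x s) + l.inputOp (f s))

variable {l : DiffExpr H n} {f g : ℝ → H} {x y : ℝ → HilbertPow H (2 * n)}

lemma continuousOn_field_apply (hx : ContinuousOn x l.interval) :
    ContinuousOn (fun s => l.field s (x s)) l.interval :=
  l.continuousOn_field.clm_apply hx

lemma IsState.integrand (hx : l.IsState f x) :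
    LocallyIntegrableOn (fun s => l.field s (x s) + l.inputOp (f s)) l.interval :=
  (locallyIntegrableOn_of_continuousOn (continuousOn_field_apply hx.continuousOn)).add
    (locallyIntegrableOn_clm l.inputOp hx.locallyIntegrableOn)

lemma IsState.sub_eq (hx : l.IsState f x) {a t : ℝ} (ha : a ∈ l.interval) (ht : t ∈ l.interval) :
    x t = x a + ∫ s in a..t, (l.field s (x s) + l.inputOp (f s)) := by
  rw [hx.eq t ht, hx.eq a ha, ← intervalIntegral.integral_interval_sub_left
    (intervalIntegrable_of_locallyIntegrableOn hx.integrand l.zero_mem_interval ht)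
    (intervalIntegrable_of_locallyIntegrableOn hx.integrand l.zero_mem_interval ha)]
  abel

lemma IsState.add (hx : l.IsState f x) (hy : l.IsState g y) : l.IsState (f + g) (x + y) where
  continuousOn := hx.continuousOn.add hy.continuousOn
  locallyIntegrableOn := hx.locallyIntegrableOn.add hy.locallyIntegrableOn
  eq t ht := by
    have h1 := intervalIntegrable_of_locallyIntegrableOn hx.integrand l.zero_mem_interval ht
    have h2 := intervalIntegrable_of_locallyIntegrableOn hy.integrand l.zero_mem_interval ht
    rw [Pi.add_apply, Pi.add_apply, hx.eq t ht, hy.eq t ht, add_add_add_comm,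
      ← intervalIntegral.integral_add h1 h2]
    congr 1
    refine intervalIntegral.integral_congr fun s _ => ?_
    simp only [Pi.add_apply, map_add]
    abel

lemma IsState.congr_ae (hx : l.IsState f x) (h : f =ᵐ[l.measure] g) : l.IsState g x where
  continuousOn := hx.continuousOn
  locallyIntegrableOn := locallyIntegrableOn_congr_ae hx.locallyIntegrableOn h
  eq t ht := by
    rw [hx.eq t ht]
    congr 1
    refine intervalIntegral.integral_congr_ae ?_
    rw [measure, EventuallyEq, ae_restrict_iff' l.measurableSet_interval] at h
    filter_upwards [h] with s hs hst
    rw [uIoc_of_le (l.nonneg_of_mem ht)] at hst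
    rw [hs (l.Icc_subset_interval ht (Ioc_subset_Icc_self hst))]

variable (l) in
lemma exists_isState (hf : LocallyIntegrableOn f l.interval) (x₀ : HilbertPow H (2 * n)) :
    ∃ x, l.IsState f x ∧ x 0 = x₀ := by
  -- The input is only locally integrable. Subtracting its primitive `F` leaves for `z = x - F` an
  -- equation with the continuous inhomogeneity `field · F`, to which the solvability theorem
  -- applies.
  let F : ℝ → HilbertPow H (2 * n) := fun t => ∫ s in (0 : ℝ)..t, l.inputOp (f s)
  have hF : ContinuousOn F l.interval := continuousOn_primitive (locallyIntegrableOn_clm _ hf)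
  have hA : ContinuousOn (fun t => (l.field t).restrictScalars ℝ) l.interval :=
    (ContinuousLinearMap.restrictScalarsL ℂ _ _ ℝ ℝ).continuous.comp_continuousOn
      l.continuousOn_field
  obtain ⟨z, hz, hze⟩ := l.exists_integralEq hA (continuousOn_field_apply hF) x₀
  have hz0 : z 0 = x₀ := by simpa using hze 0 l.zero_mem_interval
  have hx0 : (z + F) 0 = x₀ := by simp [hz0, F]
  refine ⟨z + F, ⟨hz.add hF, hf, fun t ht => ?_⟩, hx0⟩
  rw [hx0, Pi.add_apply, hze t ht, add_assoc]
  congr 1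
  have h1 := intervalIntegrable_of_continuousOn
    ((hA.clm_apply hz).add (continuousOn_field_apply hF)) l.zero_mem_interval ht
  have h2 := intervalIntegrable_of_locallyIntegrableOn (locallyIntegrableOn_clm l.inputOp hf)
    l.zero_mem_interval ht
  refine (intervalIntegral.integral_add h1 h2).symm.trans ?_
  refine intervalIntegral.integral_congr fun s _ => ?_
  simp

/-- Beyond `a` the equation is homogeneous, so uniqueness for data given at `a` keeps the state at
zero. -/
lemma IsState.eq_zero_of_le (hx : l.IsState f x) {a : ℝ} (ha : a ∈ l.interval) (hxa : x a = 0)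
    (hf : ∀ t, a < t → f t = 0) {t : ℝ} (ht : t ∈ l.interval) (hat : a ≤ t) : x t = 0 := by
  have hA : ContinuousOn (fun t => (l.field t).restrictScalars ℝ) l.interval :=
    (ContinuousLinearMap.restrictScalarsL ℂ _ _ ℝ ℝ).continuous.comp_continuousOn
      l.continuousOn_field
  refine integralEq_linear_unique hA ha (g := 0) (y := 0) hx.continuousOn continuousOn_const
    (fun _ _ _ => intervalIntegrable_const) ?_ (by simp) hxa ht hat
  intro s hs has
  rw [hx.sub_eq ha hs]
  congr 1
  refine intervalIntegral.integral_congr_ae (Eventually.of_forall fun r hr => ?_)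
  rw [uIoc_of_le has] at hr
  simp [hf r hr.1]

/-- A solution is determined by its initial values, also when its right-hand side is a multiple
of the solution itself. -/
lemma IsState.eqOn_of_smul {z : ℂ} (hx : l.IsState (fun t => z • coord H n 0 (x t)) x)
    (hy : l.IsState (fun t => z • coord H n 0 (y t)) y) (h : x 0 = y 0) : EqOn x y l.interval := by
  intro t ht
  -- The feedback `f = z y` is absorbed into the coefficient matrix.
  have hA : ContinuousOn (fun t => (l.field t + z • (l.inputOp ∘L coord H n 0)).restrictScalars ℝ)
      l.interval :=
    (ContinuousLinearMap.restrictScalarsL ℂ _ _ ℝ ℝ).continuous.comp_continuousOn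
      (l.continuousOn_field.add continuousOn_const)
  refine integralEq_linear_unique hA l.zero_mem_interval (g := 0) hx.continuousOn hy.continuousOn
    (fun _ _ _ => intervalIntegrable_const) ?_ ?_ h ht (l.nonneg_of_mem ht)
  · intro s hs _
    rw [hx.eq s hs]
    simp
  · intro s hs _
    rw [hy.eq s hs]
    simp

lemma boundaryForm_inputOp_left (h : H) (y : HilbertPow H (2 * n)) :
    boundaryForm (l.inputOp h) y = inner ℂ (coord H n 0 y) h := by
  have hn := l.n_pos
  rw [boundaryForm_eq_sum, Finset.sum_eq_single 0]
  · rw [l.coord_inputOp (by omega), l.coord_inputOp (by omega), if_neg (by omega), if_pos (by omega)]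
    simp
  · intro k hk hk0
    have := Finset.mem_range.1 hk
    rw [l.coord_inputOp (by omega), l.coord_inputOp (by omega), if_neg (by omega), if_neg (by omega)]
    simp
  · intro h
    exact absurd (Finset.mem_range.2 hn) h

lemma boundaryForm_inputOp_right (x : HilbertPow H (2 * n)) (h : H) :
    boundaryForm x (l.inputOp h) = -inner ℂ h (coord H n 0 x) := by
  have hn := l.n_pos
  rw [boundaryForm_eq_sum, Finset.sum_eq_single 0]
  · rw [l.coord_inputOp (by omega), l.coord_inputOp (by omega), if_pos (by omega), if_neg (by omega)]
    simp
  · intro k hk hk0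
    have := Finset.mem_range.1 hk
    rw [l.coord_inputOp (by omega), l.coord_inputOp (by omega), if_neg (by omega), if_neg (by omega)]
    simp
  · intro h
    exact absurd (Finset.mem_range.2 hn) h

/-- The Lagrange identity. -/
theorem IsState.lagrange (hx : l.IsState f x) (hy : l.IsState g y) {t : ℝ} (ht : t ∈ l.interval) :
    boundaryForm (x t) (y t) - boundaryForm (x 0) (y 0)
      = ∫ s in (0 : ℝ)..t,
        (inner ℂ (coord H n 0 (y s)) (f s) - inner ℂ (g s) (coord H n 0 (x s))) := by
  have hsub := l.Icc_subset_interval ht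
  have hxi : ∀ s ∈ l.interval, IntervalIntegrable
      (fun s => l.field s (x s) + l.inputOp (f s)) volume 0 s := fun s hs =>
    intervalIntegrable_of_locallyIntegrableOn hx.integrand l.zero_mem_interval hs
  have key := inner_sub_inner_eq_integral (l.nonneg_of_mem ht) (F := y)
    (G := fun s => boundaryOp H n (x s))
    (f := fun s => l.field s (y s) + l.inputOp (g s))
    (g := fun s => boundaryOp H n (l.field s (x s) + l.inputOp (f s)))
    (intervalIntegrable_of_locallyIntegrableOn hy.integrand l.zero_mem_interval ht)
    (intervalIntegrable_of_locallyIntegrableOn (locallyIntegrableOn_clm _ hx.integrand)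
      l.zero_mem_interval ht)
    (fun s hs => hy.eq s (hsub hs))
    (fun s hs => by
      rw [ContinuousLinearMap.intervalIntegral_comp_comm _ (hxi s (hsub hs)), ← map_add,
        ← hx.eq s (hsub hs)])
  simp only [inner_boundaryOp] at key
  rw [key]
  refine intervalIntegral.integral_congr fun s hs => ?_
  rw [uIcc_of_le (l.nonneg_of_mem ht)] at hs
  -- Skewness cancels the contributions of the coefficient matrix; only the two inputs survive.
  have := l.boundaryForm_field (hsub hs) (x s) (y s)
  simp only [boundaryForm_add_left, boundaryForm_add_right, boundaryForm_inputOp_left,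
    boundaryForm_inputOp_right]
  linear_combination this

/-- The quasi-derivatives of a function in the domain of `l` form a state. -/
theorem MemDomExpr.isState {y : ℝ → H} (hy : l.MemDomExpr y) :
    l.IsState (l.expr y) (l.quasiVec y) := by
  have hn := l.n_pos
  obtain ⟨g, hg, hgy⟩ := hy.locAC
  have hlast : ContinuousOn (l.quasiDeriv y (2 * n - 1)) l.interval :=
    (continuousOn_const.add (continuousOn_primitive hg)).congr hgy
  have hc : ContinuousOn (l.quasiVec y) l.interval := by
    refine (PiLp.continuous_toLp 2 _).comp_continuousOn (continuousOn_pi.2 fun k => ?_)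
    by_cases hk : (k : ℕ) + 1 < 2 * n
    · exact (hy.contDiffOn k hk).continuousOn
    · rw [show (k : ℕ) = 2 * n - 1 by omega]
      exact hlast
  have hrow : ∀ k < 2 * n, ContinuousOn (fun t => l.fieldCoord t k (l.quasiVec y t)) l.interval :=
    fun k hk => (l.continuousOn_fieldCoord hk).clm_apply hc
  -- The integrable density `g` of the last quasi-derivative is its derivative almost everywhere.
  -- Thus `l[y]` is almost everywhere a continuous function minus `g`, and in particular locally
  -- integrable.
  have hge : (fun t => l.fieldCoord t (2 * n - 1) (l.quasiVec y t) - g t) =ᵐ[l.measure]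
      l.expr y := by
    have hm : ∀ᵐ t ∂l.measure, t ∈ l.interval := ae_restrict_mem l.measurableSet_interval
    filter_upwards [ae_hasDerivWithinAt_of_integralEq hg hgy, hm] with t h1 ht
    rw [expr_eq_fieldCoord_sub hy ht, h1.derivWithin (l.uniqueDiffOn_interval t ht)]
  have hli := locallyIntegrableOn_congr_ae
    ((locallyIntegrableOn_of_continuousOn (hrow (2 * n - 1) (by omega))).sub hg) hge
  refine ⟨hc, hli, fun t ht => ext_coord fun k hk => ?_⟩
  have hint : LocallyIntegrableOn
      (fun s => l.field s (l.quasiVec y s) + l.inputOp (l.expr y s)) l.interval :=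
    (locallyIntegrableOn_of_continuousOn (continuousOn_field_apply hc)).add
      (locallyIntegrableOn_clm l.inputOp hli)
  rw [map_add, ← ContinuousLinearMap.intervalIntegral_comp_comm _
    (intervalIntegrable_of_locallyIntegrableOn hint l.zero_mem_interval ht)]
  simp only [map_add, l.coord_field _ hk, l.coord_inputOp hk]
  rw [coord_quasiVec y t hk, coord_quasiVec y 0 hk]
  by_cases hk' : k + 1 < 2 * n
  · simp only [if_neg (by omega : ¬ k = 2 * n - 1), add_zero]
    exact integralEq_of_hasDerivWithinAt (hrow k hk) (fun s hs => fieldCoord_quasiVec hy hk' hs) ht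
  · obtain rfl : k = 2 * n - 1 := by omega
    rw [hgy t ht]
    congr 1
    refine intervalIntegral.integral_congr_ae ?_
    rw [measure, EventuallyEq, ae_restrict_iff' l.measurableSet_interval] at hge
    filter_upwards [hge] with s hs hst
    rw [uIoc_of_le (l.nonneg_of_mem ht)] at hst
    simp only [if_true]
    rw [← hs (l.Icc_subset_interval ht (Ioc_subset_Icc_self hst))]
    abel

/-- The input acts only on the last row. All other coordinates have continuous derivatives, even
when `f` is merely locally integrable. -/
lemma IsState.coord_eq (hx : l.IsState f x) {k : ℕ} (hk : k + 1 < 2 * n) {t : ℝ}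
    (ht : t ∈ l.interval) :
    coord H n k (x t) = coord H n k (x 0) + ∫ s in (0 : ℝ)..t, l.fieldCoord s k (x s) := by
  have hk2 : k < 2 * n := by omega
  conv_lhs => rw [hx.eq t ht, map_add, ← ContinuousLinearMap.intervalIntegral_comp_comm _
    (intervalIntegrable_of_locallyIntegrableOn hx.integrand l.zero_mem_interval ht)]
  simp only [map_add, l.coord_field _ hk2, l.coord_inputOp hk2,
    if_neg (by omega : ¬ k = 2 * n - 1), add_zero]

lemma IsState.hasDerivWithinAt_coord (hx : l.IsState f x) {k : ℕ} (hk : k + 1 < 2 * n) {t : ℝ}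
    (ht : t ∈ l.interval) :
    HasDerivWithinAt (fun t => coord H n k (x t)) (l.fieldCoord t k (x t)) l.interval t :=
  hasDerivWithinAt_of_integralEq
    ((l.continuousOn_fieldCoord (by omega)).clm_apply hx.continuousOn)
    (fun _ hs => hx.coord_eq hk hs) ht

lemma IsState.isQuasiSystem (hx : l.IsState f x) :
    l.IsQuasiSystem (fun k t => coord H n k (x t)) (fun t => l.derivOp t n (x t)) :=
  isQuasiSystem_of_hasDerivWithinAt fun _ hk _ ht => hx.hasDerivWithinAt_coord hk ht

lemma IsState.quasiDeriv_eq (hx : l.IsState f x) {k : ℕ} (hk : k < 2 * n) {t : ℝ}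
    (ht : t ∈ l.interval) :
    l.quasiDeriv (fun t => coord H n 0 (x t)) k t = coord H n k (x t) :=
  hx.isQuasiSystem.quasiDeriv_eq hk ht

lemma IsState.quasiVec_eq (hx : l.IsState f x) {t : ℝ} (ht : t ∈ l.interval) :
    l.quasiVec (fun t => coord H n 0 (x t)) t = x t :=
  ext_coord fun k hk => by rw [coord_quasiVec _ t hk, hx.quasiDeriv_eq hk ht]

lemma contDiffOn_one_of_hasDerivWithinAt {E : Type*} [NormedAddCommGroup E] [NormedSpace ℝ E]
    {u v : ℝ → E} (hv : ContinuousOn v l.interval)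
    (hu : ∀ t ∈ l.interval, HasDerivWithinAt u (v t) l.interval t) :
    ContDiffOn ℝ 1 u l.interval := by
  rw [show (1 : WithTop ℕ∞) = 0 + 1 by simp,
    contDiffOn_succ_iff_derivWithin l.uniqueDiffOn_interval]
  refine ⟨fun t ht => (hu t ht).differentiableWithinAt, by simp, ?_⟩
  rw [contDiffOn_zero]
  exact hv.congr fun t ht => (hu t ht).derivWithin (l.uniqueDiffOn_interval t ht)

lemma IsState.memDomExpr (hx : l.IsState f x) :
    l.MemDomExpr (fun t => coord H n 0 (x t)) where
  contDiffOn k hk := by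
    refine (contDiffOn_one_of_hasDerivWithinAt (v := fun t => l.fieldCoord t k (x t)) ?_
      fun t ht => hx.hasDerivWithinAt_coord hk ht).congr fun t ht => hx.quasiDeriv_eq (by omega) ht
    exact (l.continuousOn_fieldCoord (by omega)).clm_apply hx.continuousOn
  locAC := by
    have hn := l.n_pos
    refine ⟨fun s => coord H n (2 * n - 1) (l.field s (x s) + l.inputOp (f s)),
      locallyIntegrableOn_clm _ hx.integrand, fun t ht => ?_⟩
    rw [hx.quasiDeriv_eq (by omega) ht, hx.quasiDeriv_eq (by omega) l.zero_mem_interval,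
      ContinuousLinearMap.intervalIntegral_comp_comm _
      (intervalIntegrable_of_locallyIntegrableOn hx.integrand l.zero_mem_interval ht), ← map_add,
      ← hx.eq t ht]

lemma IsState.expr_ae_eq (hx : l.IsState f x) :
    l.expr (fun t => coord H n 0 (x t)) =ᵐ[l.measure] f := by
  have hn := l.n_pos
  have hm : ∀ᵐ t ∂l.measure, t ∈ l.interval := ae_restrict_mem l.measurableSet_interval
  filter_upwards [ae_hasDerivWithinAt_of_integralEq hx.integrand hx.eq, hm] with t hd ht
  refine hx.isQuasiSystem.expr_eq ht ?_
  have := ((coord H n (2 * n - 1)).restrictScalars ℝ).hasFDerivAt.comp_hasDerivWithinAt t hd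
  convert! this using 1
  rw [ContinuousLinearMap.coe_restrictScalars', map_add, l.coord_field _ (by omega),
    l.coord_inputOp (by omega), if_pos rfl, l.fieldCoord_last, add_comm]
  congr 1
  split_ifs <;> rfl

end States

end DiffExpr

/-! ### Uniform smallness of operator functions along bounded sequences. -/

section UniformlySmall

variable {X F G : Type*} [NormedAddCommGroup X] [NormedSpace ℂ X] [NormedAddCommGroup F]
  [NormedSpace ℂ F] [NormedAddCommGroup G] [NormedSpace ℂ G]

/-- `L(t) h_m → 0` as `m → ∞`, uniformly on `[0, c]`. -/
def UniformlySmall (c : ℝ) (h : ℕ → X) (L : ℝ → X →L[ℂ] F) : Prop :=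
  ∀ ε > 0, ∀ᶠ m in atTop, ∀ t ∈ Icc 0 c, ‖L t (h m)‖ ≤ ε

variable {c : ℝ} {h : ℕ → X} {L L' : ℝ → X →L[ℂ] F}

lemma UniformlySmall.congr (hL : UniformlySmall c h L)
    (e : ∀ t ∈ Icc 0 c, ∀ x, L' t x = L t x) : UniformlySmall c h L' := by
  intro ε hε
  filter_upwards [hL ε hε] with m hm t ht
  rw [e t ht]
  exact hm t ht

lemma UniformlySmall.add (hL : UniformlySmall c h L) (hL' : UniformlySmall c h L') :
    UniformlySmall c h (fun t => L t + L' t) := by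
  intro ε hε
  filter_upwards [hL (ε / 2) (half_pos hε), hL' (ε / 2) (half_pos hε)] with m h1 h2 t ht
  exact (norm_add_le _ _).trans ((add_le_add (h1 t ht) (h2 t ht)).trans (add_halves ε).le)

lemma UniformlySmall.comp (hL : UniformlySmall c h L) {C : ℝ → F →L[ℂ] G}
    (hC : ContinuousOn C (Icc 0 c)) : UniformlySmall c h (fun t => C t ∘L L t) := by
  obtain ⟨K, hK⟩ := isCompact_Icc.exists_bound_of_continuousOn hC
  have hK' : 0 < max K 1 := by positivity
  intro ε hε
  filter_upwards [hL (ε / max K 1) (by positivity)] with m h1 t ht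
  refine ((C t).le_opNorm _).trans ?_
  calc ‖C t‖ * ‖L t (h m)‖ ≤ max K 1 * (ε / max K 1) := by
        gcongr
        · exact (hK t ht).trans (le_max_left _ _)
        · exact h1 t ht
    _ = ε := by field_simp

lemma UniformlySmall.const_smul (hL : UniformlySmall c h L) (a : ℂ) :
    UniformlySmall c h (fun t => a • L t) :=
  (hL.comp (C := fun _ => a • ContinuousLinearMap.id ℂ F) continuousOn_const).congr
    fun t _ x => by simp

lemma UniformlySmall.neg (hL : UniformlySmall c h L) :
    UniformlySmall c h (fun t => -L t) :=
  (hL.const_smul (-1)).congr fun t _ x => by simp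

lemma UniformlySmall.sub (hL : UniformlySmall c h L) (hL' : UniformlySmall c h L') :
    UniformlySmall c h (fun t => L t - L' t) :=
  (hL.add hL'.neg).congr fun t _ x => by simp [sub_eq_add_neg]

/-- For a bounded sequence `h`, uniform smallness follows from that of the integrals. -/
lemma uniformlySmall_of_integral [CompleteSpace F] (hc : 0 < c) (hh : ∀ m, ‖h m‖ ≤ 1)
    (hL : ContinuousOn L (Icc 0 c))
    (hi : ∀ ε > 0, ∀ᶠ m in atTop, ∀ t ∈ Icc 0 c, ‖∫ s in (0 : ℝ)..t, L s (h m)‖ ≤ ε) :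
    UniformlySmall c h L := by
  intro ε hε
  have hu := isCompact_Icc.uniformContinuousOn_of_continuous hL
  rw [Metric.uniformContinuousOn_iff_le] at hu
  obtain ⟨δ', hδ', hu⟩ := hu (ε / 2) (half_pos hε)
  set δ := min δ' c with hδ
  have hδ0 : 0 < δ := lt_min hδ' hc
  have hδc : δ ≤ c := min_le_right _ _
  filter_upwards [hi (ε * δ / 4) (by positivity)] with m hm t ht
  -- An interval of length `δ` inside `[0, c]` containing `t`; on it `L s (h m)` deviates from `L t
  -- (h m)` by at most `ε / 2`, uniformly in `m`, because `‖h m‖ ≤ 1`. The mean over this interval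
  -- is small by the hypothesis on integrals.
  obtain ⟨a, ha0, hac, hat, hta⟩ : ∃ a, 0 ≤ a ∧ a + δ ≤ c ∧ a ≤ t ∧ t ≤ a + δ := by
    by_cases h : t + δ ≤ c
    · exact ⟨t, ht.1, h, le_rfl, by linarith⟩
    · exact ⟨c - δ, by linarith, by linarith, by linarith, by linarith [ht.2]⟩
  have haI : a ∈ Icc 0 c := ⟨ha0, by linarith⟩
  have haI' : a + δ ∈ Icc 0 c := ⟨by linarith, hac⟩
  have hLh : ContinuousOn (fun s => L s (h m)) (Icc 0 c) := hL.clm_apply continuousOn_const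
  have hint : ∀ {u v}, u ∈ Icc 0 c → v ∈ Icc 0 c →
      IntervalIntegrable (fun s => L s (h m)) volume u v := fun hu hv =>
    (hLh.mono (ordConnected_Icc.uIcc_subset hu hv)).intervalIntegrable
  have h0I : (0 : ℝ) ∈ Icc 0 c := ⟨le_rfl, hc.le⟩
  have e1 : δ • L t (h m) = (∫ s in a..(a + δ), L s (h m))
      - ∫ s in a..(a + δ), (L s (h m) - L t (h m)) := by
    rw [intervalIntegral.integral_sub (hint haI haI') intervalIntegrable_const,
      intervalIntegral.integral_const]
    simp
  have e2 : ‖∫ s in a..(a + δ), L s (h m)‖ ≤ ε * δ / 2 := by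
    rw [← intervalIntegral.integral_interval_sub_left (hint h0I haI') (hint h0I haI)]
    refine (norm_sub_le _ _).trans ?_
    linarith [hm a haI, hm _ haI']
  have e3 : ‖∫ s in a..(a + δ), (L s (h m) - L t (h m))‖ ≤ ε / 2 * |a + δ - a| := by
    refine intervalIntegral.norm_integral_le_of_norm_le_const fun s hs => ?_
    rw [uIoc_of_le (by linarith)] at hs
    have hsI : s ∈ Icc 0 c := ⟨by linarith [hs.1], hs.2.trans hac⟩
    have hd : dist s t ≤ δ' := by
      rw [Real.dist_eq, abs_le]
      have := min_le_left δ' c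
      constructor <;> linarith [hs.1, hs.2]
    have := hu s hsI t ht hd
    rw [dist_eq_norm] at this
    rw [← sub_apply]
    calc ‖(L s - L t) (h m)‖ ≤ ‖L s - L t‖ * ‖h m‖ := (L s - L t).le_opNorm _
      _ ≤ ε / 2 * 1 := by gcongr; exact hh m
      _ = ε / 2 := mul_one _
  rw [add_sub_cancel_left, abs_of_pos hδ0] at e3
  have e4 : δ * ‖L t (h m)‖ ≤ δ * ε := by
    calc δ * ‖L t (h m)‖ = ‖δ • L t (h m)‖ := by
          rw [norm_smul, Real.norm_of_nonneg hδ0.le]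
      _ ≤ ε * δ / 2 + ε / 2 * δ := by rw [e1]; exact (norm_sub_le _ _).trans (add_le_add e2 e3)
      _ = δ * ε := by ring
  exact le_of_mul_le_mul_left e4 hδ0

/-- The `L₂`-norm controls the `L₁`-norm on a bounded interval, here through `r ≤ η / 2 + r² /
(2η)`. -/
lemma uniformlySmall_of_integral_sq [CompleteSpace F] (hc : 0 < c) (hh : ∀ m, ‖h m‖ ≤ 1)
    (hL : ContinuousOn L (Icc 0 c))
    (hi : Tendsto (fun m => ∫ s in (0 : ℝ)..c, ‖L s (h m)‖ ^ 2) atTop (𝓝 0)) :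
    UniformlySmall c h L := by
  refine uniformlySmall_of_integral hc hh hL fun ε hε => ?_
  -- Chosen so that the constant term contributes at most `c η / 2 ≤ ε / 2`; the quadratic term
  -- contributes `ε / 2` once the square integral is below `η ε`.
  set η := ε / (c + 1) with hη
  have hη0 : 0 < η := by positivity
  have hev : ∀ᶠ m in atTop, ∫ s in (0 : ℝ)..c, ‖L s (h m)‖ ^ 2 < η * ε :=
    hi.eventually (gt_mem_nhds (by positivity))
  filter_upwards [hev] with m hm t ht
  have hLh : ContinuousOn (fun s => ‖L s (h m)‖) (Icc 0 c) :=
    (hL.clm_apply continuousOn_const).norm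
  have hii : ∀ {g : ℝ → ℝ}, ContinuousOn g (Icc 0 c) → ∀ {v}, v ∈ Icc 0 c →
      IntervalIntegrable g volume 0 v := fun hg v hv => by
    apply ContinuousOn.intervalIntegrable
    rw [uIcc_of_le hv.1]
    exact hg.mono (Icc_subset_Icc_right hv.2)
  have hcI : c ∈ Icc 0 c := ⟨hc.le, le_rfl⟩
  have h1 : ‖∫ s in (0 : ℝ)..t, L s (h m)‖ ≤ ∫ s in (0 : ℝ)..t, ‖L s (h m)‖ :=
    intervalIntegral.norm_integral_le_integral_norm ht.1
  have h2 : ∫ s in (0 : ℝ)..t, ‖L s (h m)‖ ≤ ∫ s in (0 : ℝ)..c, ‖L s (h m)‖ :=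
    intervalIntegral.integral_mono_interval le_rfl ht.1 ht.2
      (Eventually.of_forall fun _ => norm_nonneg _) (hii hLh hcI)
  have h3 : ∫ s in (0 : ℝ)..c, ‖L s (h m)‖
      ≤ ∫ s in (0 : ℝ)..c, (η / 2 + (2 * η)⁻¹ * ‖L s (h m)‖ ^ 2) := by
    refine intervalIntegral.integral_mono_on hc.le (hii hLh hcI)
      (hii (continuousOn_const.add (continuousOn_const.mul (hLh.pow 2))) hcI) fun s _ => ?_
    have : η / 2 + (2 * η)⁻¹ * ‖L s (h m)‖ ^ 2 - ‖L s (h m)‖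
        = (2 * η)⁻¹ * (η - ‖L s (h m)‖) ^ 2 := by
      field_simp
      ring
    have h4 : 0 ≤ (2 * η)⁻¹ * (η - ‖L s (h m)‖) ^ 2 := by positivity
    linarith
  have e : ∫ s in (0 : ℝ)..c, (η / 2 + (2 * η)⁻¹ * ‖L s (h m)‖ ^ 2)
      = c * (η / 2) + (2 * η)⁻¹ * ∫ s in (0 : ℝ)..c, ‖L s (h m)‖ ^ 2 := by
    rw [intervalIntegral.integral_add (f := fun _ => η / 2)
      (g := fun s => (2 * η)⁻¹ * ‖L s (h m)‖ ^ 2) (hii continuousOn_const hcI)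
      (hii (continuousOn_const.mul (hLh.pow 2)) hcI), intervalIntegral.integral_const,
      intervalIntegral.integral_const_mul, sub_zero, smul_eq_mul]
  rw [e] at h3
  have h5 : (2 * η)⁻¹ * ∫ s in (0 : ℝ)..c, ‖L s (h m)‖ ^ 2 ≤ (2 * η)⁻¹ * (η * ε) := by
    gcongr
  have h6 : (2 * η)⁻¹ * (η * ε) = ε / 2 := by field_simp
  have h7 : c * (η / 2) ≤ ε / 2 := by
    have : η * (c + 1) = ε := by rw [hη]; field_simp
    nlinarith
  linarith

end UniformlySmall

namespace DiffExpr

variable {H : Type*} [NormedAddCommGroup H] [InnerProductSpace ℂ H] [CompleteSpace H] {n : ℕ}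

/-! ### Operator-valued fundamental solutions. -/

section Fundamental

/-- The operator-valued fundamental solution of a linear differential equation, together with a
right inverse. -/
theorem exists_fundamental {𝔸 : Type*} [NormedRing 𝔸] [NormedAlgebra ℝ 𝔸] [CompleteSpace 𝔸]
    (l : DiffExpr H n) {A : ℝ → 𝔸} (hA : ContinuousOn A l.interval) :
    ∃ Φ Ψ : ℝ → 𝔸, Φ 0 = 1 ∧ (∀ t ∈ l.interval, HasDerivWithinAt Φ (A t * Φ t) l.interval t) ∧
      ∀ t ∈ l.interval, Φ t * Ψ t = 1 := by
  have hL : ContinuousOn (fun t => ContinuousLinearMap.mul ℝ 𝔸 (A t)) l.interval :=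
    (ContinuousLinearMap.mul ℝ 𝔸).continuous.comp_continuousOn hA
  have hR : ContinuousOn (fun t => (ContinuousLinearMap.mul ℝ 𝔸).flip (A t)) l.interval :=
    (ContinuousLinearMap.mul ℝ 𝔸).flip.continuous.comp_continuousOn hA
  obtain ⟨Φ, hΦ, hΦe⟩ := l.exists_integralEq hL (g := 0) continuousOn_const 1
  obtain ⟨Ψ, hΨ, hΨe⟩ := l.exists_integralEq hR.neg (g := 0) continuousOn_const 1
  have h0 := l.zero_mem_interval
  have hΦ0 : Φ 0 = 1 := by simpa using hΦe 0 h0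
  have hΨ0 : Ψ 0 = 1 := by simpa using hΨe 0 h0
  have hΦd : ∀ t ∈ l.interval, HasDerivWithinAt Φ (A t * Φ t) l.interval t := fun t ht =>
    hasDerivWithinAt_of_integralEq (g := fun t => A t * Φ t) (hA.mul hΦ)
      (fun s hs => by rw [hΦe s hs, hΦ0]; simp) ht
  have hΨd : ∀ t ∈ l.interval, HasDerivWithinAt Ψ (-(Ψ t * A t)) l.interval t := fun t ht =>
    hasDerivWithinAt_of_integralEq (g := fun t => -(Ψ t * A t)) (hΨ.mul hA).neg
      (fun s hs => by rw [hΨe s hs, hΨ0]; simp) ht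
  refine ⟨Φ, Ψ, hΦ0, hΦd, fun t ht => ?_⟩
  have hc : ContinuousOn (fun t => Φ t * Ψ t) l.interval := hΦ.mul hΨ
  -- With `Φ' = AΦ` and `Ψ' = -ΨA`, the product `ΦΨ` satisfies `X' = AX - XA` with `X(0) = 1`; the
  -- constant `1` satisfies it as well.
  refine integralEq_linear_unique (hL.sub hR) h0 (x := fun t => Φ t * Ψ t) (y := fun _ => 1)
    (g := 0) hc continuousOn_const (fun _ _ _ => intervalIntegrable_const) ?_ ?_
    (by simp [hΦ0, hΨ0]) ht (l.nonneg_of_mem ht)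
  · intro s hs _
    refine integralEq_of_hasDerivWithinAt (x := fun t => Φ t * Ψ t) ?_ (fun r hr => ?_) hs
    · exact ((hL.sub hR).clm_apply hc).add continuousOn_const
    · convert! (hΦd r hr).mul (hΨd r hr) using 1
      simp [mul_assoc, sub_eq_add_neg]
  · intro s hs _
    simp

instance instNormedSpaceRealCLM {X Y : Type*} [NormedAddCommGroup X] [NormedSpace ℂ X]
    [NormedAddCommGroup Y] [NormedSpace ℂ Y] : NormedSpace ℝ (X →L[ℂ] Y) :=
  NormedSpace.complexToReal

/-- The coefficient matrix of the first order system equivalent to `l[y] = z y`. -/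
def fieldAt (l : DiffExpr H n) (z : ℂ) (t : ℝ) :
    HilbertPow H (2 * n) →L[ℂ] HilbertPow H (2 * n) :=
  l.field t + z • (l.inputOp ∘L coord H n 0)

lemma continuousOn_fieldAt (l : DiffExpr H n) (z : ℂ) :
    ContinuousOn (l.fieldAt z) l.interval :=
  l.continuousOn_field.add continuousOn_const

/-- The fundamental solution of `l[y] = z y`. -/
def fundSol (l : DiffExpr H n) (z : ℂ) :
    ℝ → HilbertPow H (2 * n) →L[ℂ] HilbertPow H (2 * n) :=
  (l.exists_fundamental (l.continuousOn_fieldAt z)).choose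

variable (l : DiffExpr H n) (z : ℂ)

lemma fundSol_zero : l.fundSol z 0 = 1 :=
  (l.exists_fundamental (l.continuousOn_fieldAt z)).choose_spec.choose_spec.1

lemma hasDerivWithinAt_fundSol {t : ℝ} (ht : t ∈ l.interval) :
    HasDerivWithinAt (l.fundSol z) (l.fieldAt z t ∘L l.fundSol z t) l.interval t :=
  (l.exists_fundamental (l.continuousOn_fieldAt z)).choose_spec.choose_spec.2.1 t ht

lemma exists_fundSol_eq {t : ℝ} (ht : t ∈ l.interval) (x : HilbertPow H (2 * n)) :
    ∃ h, l.fundSol z t h = x := by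
  have h := (l.exists_fundamental (l.continuousOn_fieldAt z)).choose_spec
  exact ⟨h.choose t x, congrArg (fun A : HilbertPow H (2 * n) →L[ℂ] HilbertPow H (2 * n) => A x)
    (h.choose_spec.2.2 t ht)⟩

lemma continuousOn_fundSol : ContinuousOn (l.fundSol z) l.interval := fun _ ht =>
  (l.hasDerivWithinAt_fundSol z ht).continuousWithinAt

lemma continuousOn_fundSol_apply (h : HilbertPow H (2 * n)) :
    ContinuousOn (fun t => l.fundSol z t h) l.interval :=
  (l.continuousOn_fundSol z).clm_apply continuousOn_const

lemma isState_fundSol (h : HilbertPow H (2 * n)) :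
    l.IsState (fun t => z • coord H n 0 (l.fundSol z t h)) (fun t => l.fundSol z t h) := by
  have hc := l.continuousOn_fundSol_apply z h
  refine ⟨hc, locallyIntegrableOn_of_continuousOn
    (continuousOn_const.smul ((coord H n 0).continuous.comp_continuousOn hc)), fun t ht => ?_⟩
  have hd : ∀ t ∈ l.interval, HasDerivWithinAt (fun t => l.fundSol z t h)
      (l.fieldAt z t (l.fundSol z t h)) l.interval t := fun t ht =>
    (((ContinuousLinearMap.apply ℂ (HilbertPow H (2 * n)) h).restrictScalars
      ℝ).hasFDerivAt.comp_hasDerivWithinAt t (l.hasDerivWithinAt_fundSol z ht))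
  have := integralEq_of_hasDerivWithinAt ((l.continuousOn_fieldAt z).clm_apply hc) hd ht
  rw [this]
  simp [fieldAt]

lemma isState_fundSol_zero (h : HilbertPow H (2 * n)) :
    l.IsState 0 (fun t => l.fundSol 0 t h) := by
  have := l.isState_fundSol 0 h
  simp only [zero_smul] at this
  exact this

end Fundamental

/-! ### The observability inequality. -/

section Observability

variable (l : DiffExpr H n)

/-- The operator `h ↦ y(t)`, where `y` is the solution of `l[y] = 0` with initial data `h`. -/
def outputOp (t : ℝ) : HilbertPow H (2 * n) →L[ℂ] H := coord H n 0 ∘L l.fundSol 0 t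

lemma continuousOn_outputOp : ContinuousOn l.outputOp l.interval :=
  continuousOn_const.clm_comp (l.continuousOn_fundSol 0)

variable {l}

/-- The row `fieldCoord t k` gives the derivative of coordinate `k`, so its integral is a difference
of two small values. Uniform continuity in the operator norm upgrades small integrals to small
values, so smallness passes from a function to its derivative. -/
lemma uniformlySmall_fieldCoord {c : ℝ} (hc0 : 0 < c) (hc : c ∈ l.interval)
    {h : ℕ → HilbertPow H (2 * n)} (hh : ∀ m, ‖h m‖ ≤ 1) {k : ℕ} (hk : k + 1 < 2 * n)
    (hs : UniformlySmall c h fun t => coord H n k ∘L l.fundSol 0 t) :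
    UniformlySmall c h fun t => l.fieldCoord t k ∘L l.fundSol 0 t := by
  have hsub := l.Icc_subset_interval hc
  refine uniformlySmall_of_integral hc0 hh
    (((l.continuousOn_fieldCoord (by omega)).clm_comp (l.continuousOn_fundSol 0)).mono hsub) ?_
  intro ε hε
  filter_upwards [hs (ε / 2) (half_pos hε)] with m hm t ht
  have e := (l.isState_fundSol_zero (h m)).coord_eq hk (hsub ht)
  have h1 := hm t ht
  have h2 := hm 0 ⟨le_rfl, hc0.le⟩
  simp only [ContinuousLinearMap.comp_apply] at h1 h2 ⊢
  rw [eq_sub_of_add_eq' e.symm]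
  refine (norm_sub_le _ _).trans ?_
  linarith

/-- Observability: a solution of `l[y] = 0` is controlled by its `L₂`-norm near `0`. -/
theorem exists_observability {c : ℝ} (hc0 : 0 < c) (hc : c ∈ l.interval) :
    ∃ δ : ℝ, 0 < δ ∧ ∀ h : HilbertPow H (2 * n),
      δ * ‖h‖ ^ 2 ≤ ∫ s in (0 : ℝ)..c, ‖l.outputOp s h‖ ^ 2 := by
  have hn := l.n_pos
  have hsub := l.Icc_subset_interval hc
  -- Otherwise there are unit initial data whose solutions tend to zero in `L₂(0, c)`. Smallness
  -- then climbs from `y` through all quasi-derivatives, uniformly on `[0, c]`; at `t = 0` it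
  -- contradicts `‖h m‖ = 1`.
  by_contra hcon
  push Not at hcon
  have hex : ∀ m : ℕ, ∃ h : HilbertPow H (2 * n), ‖h‖ = 1 ∧
      ∫ s in (0 : ℝ)..c, ‖l.outputOp s h‖ ^ 2 < 1 / ((m : ℝ) + 1) := by
    intro m
    obtain ⟨h, hh⟩ := hcon (1 / ((m : ℝ) + 1)) (by positivity)
    have hne : ‖h‖ ≠ 0 := by
      intro h0
      rw [h0] at hh
      have : 0 ≤ ∫ s in (0 : ℝ)..c, ‖l.outputOp s h‖ ^ 2 :=
        intervalIntegral.integral_nonneg hc0.le fun _ _ => by positivity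
      simp only [ne_eq, OfNat.ofNat_ne_zero, not_false_eq_true, zero_pow, mul_zero] at hh
      linarith
    refine ⟨((‖h‖⁻¹ : ℝ) : ℂ) • h, ?_, ?_⟩
    · rw [norm_smul, Complex.norm_real, norm_inv, norm_norm, inv_mul_cancel₀ hne]
    · have : ∀ s, ‖l.outputOp s (((‖h‖⁻¹ : ℝ) : ℂ) • h)‖ ^ 2
          = (‖h‖ ^ 2)⁻¹ * ‖l.outputOp s h‖ ^ 2 := fun s => by
        rw [map_smul, norm_smul, Complex.norm_real, norm_inv, norm_norm, mul_pow, inv_pow]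
      simp only [this]
      rw [intervalIntegral.integral_const_mul, inv_mul_lt_iff₀ (by positivity)]
      linarith
  choose h hh1 hh2 using hex
  have hh : ∀ m, ‖h m‖ ≤ 1 := fun m => (hh1 m).le
  have hlim : Tendsto (fun m => ∫ s in (0 : ℝ)..c, ‖l.outputOp s (h m)‖ ^ 2) atTop (𝓝 0) :=
    squeeze_zero (fun m => intervalIntegral.integral_nonneg hc0.le fun _ _ => by positivity)
      (fun m => (hh2 m).le) tendsto_one_div_add_atTop_nhds_zero_nat
  have h0 : UniformlySmall c h fun t => coord H n 0 ∘L l.fundSol 0 t :=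
    uniformlySmall_of_integral_sq hc0 hh (l.continuousOn_outputOp.mono hsub) hlim
  have hD : ∀ k ≤ n, UniformlySmall c h fun t => l.derivOp t k ∘L l.fundSol 0 t := by
    intro k
    induction k with
    | zero =>
      intro _
      simp only [l.derivOp_of_lt _ hn]
      exact h0
    | succ k ih =>
      intro hk
      have := ih (by omega)
      simp only [l.derivOp_of_lt _ (Nat.lt_of_succ_le hk)] at this
      refine (uniformlySmall_fieldCoord hc0 hc hh (by omega) this).congr fun t _ x => ?_
      rw [fieldCoord, if_pos (by omega)]
  have hC : ∀ k < n, UniformlySmall c h fun t => coord H n k ∘L l.fundSol 0 t := by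
    intro k hk
    have := hD k hk.le
    simp only [l.derivOp_of_lt _ hk] at this
    exact this
  have hp : ∀ k ≤ n, ContinuousOn (l.p k) (Icc 0 c) := fun k hk => (l.p_continuousOn k hk).mono hsub
  have hq : ∀ k < n, ContinuousOn (l.q k) (Icc 0 c) := fun k hk => (l.q_continuousOn k hk).mono hsub
  have hU : ∀ j < n, UniformlySmall c h fun t => coord H n (n + j) ∘L l.fundSol 0 t := by
    intro j
    induction j with
    | zero =>
      intro _
      refine (((hD n le_rfl).comp (hp 0 (Nat.zero_le n))).sub
        (((hC (n - 1) (by omega)).comp (hq 0 hn)).const_smul (Complex.I / 2))).congr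
        fun t ht x => ?_
      change coord H n n (l.fundSol 0 t x) = l.p 0 t (l.derivOp t n (l.fundSol 0 t x))
        - (Complex.I / 2) • (l.q 0 t (coord H n (n - 1) (l.fundSol 0 t x)))
      rw [l.p_zero_derivOp (hsub ht), add_sub_cancel_right]
    | succ j ih =>
      intro hj
      have hqa : ContinuousOn (fun t => (l.q j t).adjoint) (Icc 0 c) :=
        ContinuousLinearMap.adjoint.continuous.comp_continuousOn (hq j (by omega))
      refine (((((hC (n - (j + 1)) (by omega)).comp (hp (j + 1) (by omega))).add
        (((hD (n - j) (Nat.sub_le n j)).comp hqa).const_smul (Complex.I / 2))).sub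
        (((hC (n - (j + 2)) (by omega)).comp (hq (j + 1) hj)).const_smul (Complex.I / 2))).sub
        (uniformlySmall_fieldCoord hc0 hc hh (by omega) (ih (by omega)))).congr fun t ht x => ?_
      rw [l.fieldCoord_add t hj, ← l.derivOp_eq_ite t (Nat.sub_le n j)]
      simp only [ContinuousLinearMap.comp_apply, add_apply, sub_apply, neg_apply, smul_apply,
        add_assoc]
      abel
  have hall : ∀ k < 2 * n, UniformlySmall c h fun t => coord H n k ∘L l.fundSol 0 t := by
    intro k hk
    by_cases hkn : k < n
    · exact hC k hkn
    · obtain ⟨j, rfl⟩ := Nat.exists_eq_add_of_le (not_lt.1 hkn)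
      exact hU j (by omega)
  -- A bound for each of the `2n` coordinates whose sum `2n / (4n + 1)` is less than `1`.
  have hpos : (0 : ℝ) < 1 / (4 * n + 1) := by positivity
  have hev : ∀ᶠ m in atTop, ∀ k : Fin (2 * n), ∀ t ∈ Icc 0 c,
      ‖coord H n k (l.fundSol 0 t (h m))‖ ≤ 1 / (4 * n + 1) :=
    eventually_all.2 fun k => hall k k.2 _ hpos
  obtain ⟨m, hm⟩ := hev.exists
  have hsum : h m = ∑ k : Fin (2 * n), coordEmb H k (coord H n k (h m)) := by
    refine ext_coord fun k hk => ?_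
    rw [map_sum, Finset.sum_eq_single ⟨k, hk⟩]
    · rw [coord_coordEmb hk, if_pos rfl]
    · intro j _ hj
      rw [coord_coordEmb hk, if_neg]
      exact fun e => hj (Fin.ext e.symm)
    · simp
  have hle : ‖h m‖ ≤ ∑ _k : Fin (2 * n), (1 / (4 * n + 1) : ℝ) := by
    conv_lhs => rw [hsum]
    refine (norm_sum_le _ _).trans (Finset.sum_le_sum fun k _ => ?_)
    have h1 := hm k 0 ⟨le_rfl, hc0.le⟩
    rw [l.fundSol_zero] at h1
    refine le_trans (le_of_eq ?_) h1
    exact PiLp.norm_single 2 _ k _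
  rw [hh1, Finset.sum_const, Finset.card_univ, Fintype.card_fin, nsmul_eq_mul, mul_one_div,
    le_div_iff₀ (by positivity)] at hle
  push_cast at hle
  have : (0 : ℝ) ≤ n := Nat.cast_nonneg n
  linarith

end Observability

end DiffExpr

/-! ### Auxiliary facts on square integrable functions. -/

lemma MeasureTheory.MemLp.integrable_inner_two {α E : Type*} [MeasurableSpace α] {μ : Measure α}
    [NormedAddCommGroup E] [InnerProductSpace ℂ E] {f g : α → E} (hf : MemLp f 2 μ)
    (hg : MemLp g 2 μ) : Integrable (fun x => inner ℂ (f x) (g x)) μ := by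
  refine (L2.integrable_inner (𝕜 := ℂ) (hf.toLp f) (hg.toLp g)).congr ?_
  filter_upwards [hf.coeFn_toLp, hg.coeFn_toLp] with x h1 h2
  rw [h1, h2]

lemma MeasureTheory.MemLp.ae_eq_zero_of_integral_inner_self {α E : Type*} [MeasurableSpace α]
    {μ : Measure α} [NormedAddCommGroup E] [InnerProductSpace ℂ E] {f : α → E} (hf : MemLp f 2 μ)
    (h : ∫ x, inner ℂ (f x) (f x) ∂μ = 0) : ∀ᵐ x ∂μ, f x = 0 := by
  have h1 : inner ℂ (hf.toLp f) (hf.toLp f) = 0 := by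
    rw [L2.inner_def, ← h]
    refine integral_congr_ae ?_
    filter_upwards [hf.coeFn_toLp] with x hx
    rw [hx]
  filter_upwards [hf.coeFn_toLp, Lp.coeFn_zero E 2 μ] with x hx h0
  rw [← hx, inner_self_eq_zero.1 h1, h0]
  rfl

lemma memLp_two_of_continuousOn_Icc {E : Type*} [NormedAddCommGroup E] {c : ℝ} {u : ℝ → E}
    (hu : ContinuousOn u (Icc 0 c)) : MemLp u 2 (volume.restrict (Ioc 0 c)) := by
  obtain ⟨K, hK⟩ := isCompact_Icc.exists_bound_of_continuousOn hu
  refine MemLp.of_bound ((hu.mono Ioc_subset_Icc_self).aestronglyMeasurable measurableSet_Ioc) K ?_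
  rw [ae_restrict_iff' measurableSet_Ioc]
  exact Eventually.of_forall fun t ht => hK t (Ioc_subset_Icc_self ht)

lemma integrable_clm_apply_of_continuousOn_Icc {X Y : Type*} [NormedAddCommGroup X]
    [NormedSpace ℂ X] [NormedAddCommGroup Y] [NormedSpace ℂ Y] {c : ℝ} {A : ℝ → X →L[ℂ] Y}
    {d : ℝ → X} (hA : ContinuousOn A (Icc 0 c)) (hd : Integrable d (volume.restrict (Ioc 0 c))) :
    Integrable (fun s => A s (d s)) (volume.restrict (Ioc 0 c)) := by
  obtain ⟨K, hK⟩ := isCompact_Icc.exists_bound_of_continuousOn hA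
  refine (ContinuousLinearMap.id ℂ (X →L[ℂ] Y)).integrable_of_bilin_of_bdd_left
    K ((hA.mono Ioc_subset_Icc_self).aestronglyMeasurable measurableSet_Ioc) ?_ hd
  rw [ae_restrict_iff' measurableSet_Ioc]
  exact Eventually.of_forall fun t ht => hK t (Ioc_subset_Icc_self ht)

namespace DiffExpr

variable {H : Type*} [NormedAddCommGroup H] [InnerProductSpace ℂ H] [CompleteSpace H] {n : ℕ}

/-! ### Limits at the right end point. -/

section AtEnd

variable (l : DiffExpr H n)

instance atEnd_neBot : l.atEnd.NeBot := by
  refine comap_neBot fun s hs => ?_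
  obtain ⟨a, ha, hs⟩ := (mem_nhdsLT_iff_exists_Ioo_subset' l.b_pos).1 hs
  obtain ⟨r, h1, h2⟩ := EReal.lt_iff_exists_real_btwn.1 ha
  exact ⟨r, hs ⟨h1, h2⟩⟩

instance atEnd_isCountablyGenerated : l.atEnd.IsCountablyGenerated := by
  unfold atEnd
  infer_instance

lemma eventually_le_atEnd {c : ℝ} (hc : (c : EReal) < l.b) : ∀ᶠ t in l.atEnd, c ≤ t := by
  filter_upwards [preimage_mem_comap (Ioo_mem_nhdsLT hc)] with t ht
  exact EReal.coe_le_coe_iff.1 ht.1.le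

/-- The sets `(-∞, t]`, `t ↑ b`, exhaust `Δ` up to a null set; the point `b`, if it belongs to `Δ`,
carries no mass. -/
lemma tendsto_integral_atEnd {E : Type*} [NormedAddCommGroup E] [NormedSpace ℝ E] {F : ℝ → E}
    (hF : Integrable F l.measure) :
    Tendsto (fun t => ∫ s in (0 : ℝ)..t, F s) l.atEnd (𝓝 (∫ s, F s ∂l.measure)) := by
  have hcov : AECover l.measure l.atEnd fun t : ℝ => Iic t :=
    ⟨l.ae_lt_b.mono fun x hx => l.eventually_le_atEnd hx, fun _ => measurableSet_Iic⟩
  refine (hcov.integral_tendsto_of_countably_generated hF).congr' ?_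
  filter_upwards [l.eventually_mem_interval] with t ht
  have h0 := l.nonneg_of_mem ht
  rw [measure, Measure.restrict_restrict measurableSet_Iic, intervalIntegral.integral_of_le h0,
    ← integral_Icc_eq_integral_Ioc]
  congr 2
  ext s
  refine ⟨fun hs => ⟨l.nonneg_of_mem hs.2, hs.1⟩, fun hs => ⟨hs.2, l.Icc_subset_interval ht hs⟩⟩

end AtEnd

/-! ### Steering on `[0, c]` and orthogonality to homogeneous solutions. -/

section Control

variable {l : DiffExpr H n} {c : ℝ} {f : ℝ → H} {x : ℝ → HilbertPow H (2 * n)}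

lemma IsState.memMaxDom (hx : l.IsState f x) (hf : MemLp f 2 l.measure)
    (hx2 : MemLp (fun t => coord H n 0 (x t)) 2 l.measure) :
    l.MemMaxDom (fun t => coord H n 0 (x t)) :=
  ⟨hx.memDomExpr, hx2, (memLp_congr_ae hx.expr_ae_eq).2 hf⟩

lemma measure_restrict_Ioc (hc : c ∈ l.interval) :
    l.measure.restrict (Ioc 0 c) = volume.restrict (Ioc 0 c) := by
  rw [measure, Measure.restrict_restrict measurableSet_Ioc,
    inter_eq_left.2 (Ioc_subset_Icc_self.trans (l.Icc_subset_interval hc))]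

lemma memLp_of_eq_zero (hc : c ∈ l.interval) (hf : MemLp f 2 (volume.restrict (Ioc 0 c)))
    (h0 : ∀ t ∈ l.interval, c < t → f t = 0) : MemLp f 2 l.measure := by
  rw [← measure_restrict_Ioc hc] at hf
  refine (memLp_congr_ae ?_).2 ((memLp_indicator_iff_restrict measurableSet_Ioc).2 hf)
  have hm : ∀ᵐ t ∂l.measure, t ∈ l.interval := ae_restrict_mem l.measurableSet_interval
  have h2 : ∀ᵐ t ∂l.measure, t ≠ 0 := by
    refine ae_restrict_of_ae ?_
    simp [ae_iff, measure_singleton]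
  filter_upwards [hm, h2] with t ht ht0
  have h0t := lt_of_le_of_ne (l.nonneg_of_mem ht) (Ne.symm ht0)
  by_cases htc : t ≤ c
  · rw [indicator_of_mem (show t ∈ Ioc 0 c from ⟨h0t, htc⟩)]
  · rw [indicator_of_notMem (show t ∉ Ioc 0 c from fun h => htc h.2), h0 t ht (not_le.1 htc)]

variable (l) in
/-- The observability Gramian on `[0, c]`. -/
def gramian (c : ℝ) : HilbertPow H (2 * n) →L[ℂ] HilbertPow H (2 * n) :=
  ∫ s in (0 : ℝ)..c, (l.outputOp s).adjoint ∘L l.outputOp s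

lemma continuousOn_outputOp_apply (hc : c ∈ l.interval) (h : HilbertPow H (2 * n)) :
    ContinuousOn (fun s => l.outputOp s h) (Icc 0 c) :=
  (l.continuousOn_outputOp.mono (l.Icc_subset_interval hc)).clm_apply continuousOn_const

lemma inner_gramian (hc : c ∈ l.interval) (h k : HilbertPow H (2 * n)) :
    inner ℂ k (l.gramian c h) = ∫ s in (0 : ℝ)..c, inner ℂ (l.outputOp s k) (l.outputOp s h) := by
  have hcont : ContinuousOn (fun s => (l.outputOp s).adjoint ∘L l.outputOp s) l.interval :=
    (ContinuousLinearMap.adjoint.continuous.comp_continuousOn l.continuousOn_outputOp).clm_comp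
      l.continuousOn_outputOp
  have hi := intervalIntegrable_of_continuousOn hcont l.zero_mem_interval hc
  have hi' := intervalIntegrable_of_continuousOn (hcont.clm_apply (continuousOn_const (c := h)))
    l.zero_mem_interval hc
  have e1 : l.gramian c h = ∫ s in (0 : ℝ)..c, (l.outputOp s).adjoint (l.outputOp s h) :=
    ((ContinuousLinearMap.apply ℂ (HilbertPow H (2 * n)) h).intervalIntegral_comp_comm hi).symm
  have e2 := (innerSL ℂ k).intervalIntegral_comp_comm hi'
  rw [e1, ← innerSL_apply_apply, ← ContinuousLinearMap.coe_coe]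
  refine Eq.trans e2.symm (intervalIntegral.integral_congr fun s _ => ?_)
  simp [ContinuousLinearMap.adjoint_inner_right]

/-- Observability says exactly that the Gramian is coercive, and a coercive bounded operator is
boundedly invertible. -/
lemma isUnit_gramian (hc0 : 0 < c) (hc : c ∈ l.interval) : IsUnit (l.gramian c) := by
  obtain ⟨δ, hδ, hobs⟩ := exists_observability hc0 hc
  refine ContinuousLinearMap.isUnit_of_forall_le_norm_inner_map _ (c := ⟨δ, hδ.le⟩) hδ fun h => ?_
  have e : inner ℂ h (l.gramian c h)
      = ((∫ s in (0 : ℝ)..c, ‖l.outputOp s h‖ ^ 2 : ℝ) : ℂ) := by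
    rw [inner_gramian hc, ← intervalIntegral.integral_ofReal]
    refine intervalIntegral.integral_congr fun s _ => ?_
    simp [inner_self_eq_norm_sq_to_K]
  rw [norm_inner_symm, e, Complex.norm_real]
  refine le_trans ?_ (le_abs_self _)
  rw [mul_comm]
  exact hobs h

/-- The functionals on the state space are represented by outputs on `[0, c]`. -/
lemma exists_integral_inner_outputOp (hc0 : 0 < c) (hc : c ∈ l.interval)
    (k : HilbertPow H (2 * n)) : ∃ h, ∀ y,
      ∫ s in (0 : ℝ)..c, inner ℂ (l.outputOp s y) (l.outputOp s h) = inner ℂ y k := by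
  obtain ⟨u, hu⟩ := isUnit_gramian hc0 hc
  refine ⟨(↑u⁻¹ : HilbertPow H (2 * n) →L[ℂ] HilbertPow H (2 * n)) k, fun y => ?_⟩
  have e : (↑u : HilbertPow H (2 * n) →L[ℂ] HilbertPow H (2 * n))
      ((↑u⁻¹ : HilbertPow H (2 * n) →L[ℂ] HilbertPow H (2 * n)) k) = k :=
    congrArg (fun A : HilbertPow H (2 * n) →L[ℂ] HilbertPow H (2 * n) => A k) u.mul_inv
  rw [← inner_gramian hc, ← hu, e]

/-- A right-hand side supported in `[0, c]` steers the state to zero if it compensates the initial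
data on the solutions of the homogeneous equation. -/
lemma IsState.eq_zero_of_integral_inner (hx : l.IsState f x) (hc : c ∈ l.interval)
    (hf : ∀ t, c < t → f t = 0)
    (h : ∀ y, ∫ s in (0 : ℝ)..c, inner ℂ (l.outputOp s y) (f s) = -boundaryForm (x 0) y) {t : ℝ}
    (ht : t ∈ l.interval) (hct : c ≤ t) : x t = 0 := by
  refine hx.eq_zero_of_le hc (eq_zero_of_boundaryForm_eq_zero fun v => ?_) hf ht hct
  -- Every vector is the value at `c` of a homogeneous solution, so the Lagrange identity tests `x
  -- c` against all of `H^{2n}`; the boundary form is nondegenerate.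
  obtain ⟨y, rfl⟩ := l.exists_fundSol_eq 0 hc v
  have e := hx.lagrange (l.isState_fundSol_zero y) hc
  simp only [Pi.zero_apply, inner_zero_left, sub_zero, l.fundSol_zero] at e
  have h' := h y
  simp only [outputOp, ContinuousLinearMap.comp_apply] at h'
  rw [h', one_apply_eq_self] at e
  linear_combination e

/-- There are functions in the domain of the maximal operator with prescribed initial data which
vanish near the right end point. -/
theorem exists_memMaxDom_of_initial (hc0 : 0 < c) (hc : c ∈ l.interval)
    (x₀ : HilbertPow H (2 * n)) : ∃ y, l.MemMaxDom y ∧ l.quasiVec y 0 = x₀ ∧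
      ∀ t ∈ l.interval, c ≤ t → l.quasiVec y t = 0 := by
  -- The right-hand side is sought as a homogeneous solution cut off at `c`; its data `k` are chosen
  -- to compensate the boundary term of `x₀` at `0`.
  obtain ⟨k, hk⟩ := exists_integral_inner_outputOp hc0 hc (-boundaryOp H n x₀)
  let f : ℝ → H := (Iic c).indicator fun s => l.outputOp s k
  have hfc : ∀ t, c < t → f t = 0 := fun t ht => indicator_of_notMem (s := Iic c) (not_le.2 ht) _
  have hfe : ∀ t ∈ Ioc 0 c, f t = l.outputOp t k := fun t ht => indicator_of_mem (s := Iic c) ht.2 _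
  have hf2 : MemLp f 2 l.measure := by
    refine memLp_of_eq_zero hc ((memLp_congr_ae ?_).2
      (memLp_two_of_continuousOn_Icc (continuousOn_outputOp_apply hc k))) fun t _ => hfc t
    rw [EventuallyEq, ae_restrict_iff' measurableSet_Ioc]
    exact Eventually.of_forall hfe
  obtain ⟨x, hx, hx0⟩ := l.exists_isState (locallyIntegrableOn_of_memLp hf2) x₀
  have hxc : ∀ t ∈ l.interval, c ≤ t → x t = 0 := fun t ht hct => by
    refine hx.eq_zero_of_integral_inner hc hfc (fun y => ?_) ht hct
    rw [hx0, ← inner_boundaryOp, ← inner_neg_right, ← hk y]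
    refine intervalIntegral.integral_congr_ae (Eventually.of_forall fun s hs => ?_)
    rw [uIoc_of_le hc0.le] at hs
    rw [hfe s hs]
  have hx2 : MemLp (fun t => coord H n 0 (x t)) 2 l.measure :=
    memLp_of_eq_zero hc (memLp_two_of_continuousOn_Icc ((coord H n 0).continuous.comp_continuousOn
      (hx.continuousOn.mono (l.Icc_subset_interval hc))))
      fun t ht hct => by rw [hxc t ht hct.le, map_zero]
  refine ⟨_, hx.memMaxDom hf2 hx2, ?_, fun t ht hct => ?_⟩
  · rw [hx.quasiVec_eq l.zero_mem_interval, hx0]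
  · rw [hx.quasiVec_eq ht, hxc t ht hct]

lemma vanishesAtEnd_of_quasiVec_eq_zero {y : ℝ → H} (hcb : (c : EReal) < l.b)
    (h : ∀ t ∈ l.interval, c ≤ t → l.quasiVec y t = 0) : l.VanishesAtEnd y := by
  intro z _
  refine tendsto_const_nhds.congr' ?_
  filter_upwards [l.eventually_mem_interval, l.eventually_le_atEnd hcb] with t ht hct
  rw [bracket_eq_boundaryForm, h t ht hct, boundaryForm_zero_left]

lemma exists_memMaxDom_vanishesAtEnd (l : DiffExpr H n) (x₀ : HilbertPow H (2 * n)) :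
    ∃ y, l.MemMaxDom y ∧ l.quasiVec y 0 = x₀ ∧ l.VanishesAtEnd y := by
  obtain ⟨c, hc0, hcb, hc⟩ := l.exists_pos_mem_interval
  obtain ⟨y, hy, hy0, hyc⟩ := exists_memMaxDom_of_initial hc0 hc x₀
  exact ⟨y, hy, hy0, vanishesAtEnd_of_quasiVec_eq_zero hcb hyc⟩

/-- A function on `[0, c]` which is orthogonal to everything orthogonal to the solutions of the
homogeneous equation is such a solution. -/
theorem exists_ae_eq_outputOp (hc0 : 0 < c) (hc : c ∈ l.interval) {d : ℝ → H}
    (hd : MemLp d 2 (volume.restrict (Ioc 0 c)))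
    (horth : ∀ e : ℝ → H, MemLp e 2 (volume.restrict (Ioc 0 c)) →
      (∀ h, ∫ s in (0 : ℝ)..c, inner ℂ (l.outputOp s h) (e s) = 0) →
        ∫ s in (0 : ℝ)..c, inner ℂ (e s) (d s) = 0) :
    ∃ h, ∀ᵐ s ∂volume.restrict (Ioc 0 c), d s = l.outputOp s h := by
  have hWm : ∀ h, MemLp (fun s => l.outputOp s h) 2 (volume.restrict (Ioc 0 c)) := fun h =>
    memLp_two_of_continuousOn_Icc (continuousOn_outputOp_apply hc h)
  have hcont : ContinuousOn (fun s => (l.outputOp s).adjoint) (Icc 0 c) :=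
    (ContinuousLinearMap.adjoint.continuous.comp_continuousOn l.continuousOn_outputOp).mono
      (l.Icc_subset_interval hc)
  have hint : Integrable (fun s => (l.outputOp s).adjoint (d s)) (volume.restrict (Ioc 0 c)) :=
    integrable_clm_apply_of_continuousOn_Icc hcont (hd.integrable (by norm_num))
  -- With this `h`, the solution `outputOp · h` is the orthogonal projection of `d` to the space of
  -- homogeneous solutions. The remainder is orthogonal to that space, hence by hypothesis to `d`,
  -- hence to itself.
  obtain ⟨h, hh⟩ := exists_integral_inner_outputOp hc0 hc
    (∫ s in (0 : ℝ)..c, (l.outputOp s).adjoint (d s))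
  refine ⟨h, ?_⟩
  have hsub : ∀ u : ℝ → H, MemLp u 2 (volume.restrict (Ioc 0 c)) →
      ∫ s in (0 : ℝ)..c, inner ℂ (u s) (d s - l.outputOp s h)
      = (∫ s in (0 : ℝ)..c, inner ℂ (u s) (d s))
        - ∫ s in (0 : ℝ)..c, inner ℂ (u s) (l.outputOp s h) := fun u hu => by
    simp only [inner_sub_right, intervalIntegral.integral_of_le hc0.le]
    exact integral_sub (hu.integrable_inner_two hd) (hu.integrable_inner_two (hWm h))
  have horthW : ∀ y, ∫ s in (0 : ℝ)..c, inner ℂ (l.outputOp s y) (d s - l.outputOp s h) = 0 := by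
    intro y
    rw [hsub _ (hWm y), hh y, sub_eq_zero, intervalIntegral.integral_of_le hc0.le,
      intervalIntegral.integral_of_le hc0.le, ← integral_inner hint]
    simp only [ContinuousLinearMap.adjoint_inner_right]
  have he : MemLp (fun s => d s - l.outputOp s h) 2 (volume.restrict (Ioc 0 c)) := hd.sub (hWm h)
  have h1 := horth _ he horthW
  have h2 : ∫ s in (0 : ℝ)..c, inner ℂ (d s - l.outputOp s h) (l.outputOp s h) = 0 := by
    have := congrArg (starRingEnd ℂ) (horthW h)
    rw [map_zero, intervalIntegral.integral_of_le hc0.le, ← integral_conj] at this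
    simpa only [inner_conj_symm, intervalIntegral.integral_of_le hc0.le] using this
  have h3 := hsub _ he
  rw [h1, h2, sub_zero, intervalIntegral.integral_of_le hc0.le] at h3
  filter_upwards [he.ae_eq_zero_of_integral_inner_self h3] with s hs
  exact sub_eq_zero.1 hs

end Control

end DiffExpr

namespace DiffExpr

variable {H : Type*} [NormedAddCommGroup H] [InnerProductSpace ℂ H] [CompleteSpace H] {n : ℕ}

/-! ### Green's formula on `Δ`. -/

section Green

variable {l : DiffExpr H n} {y z : ℝ → H}

lemma coord_zero_quasiVec (y : ℝ → H) (t : ℝ) : coord H n 0 (l.quasiVec y t) = y t := by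
  have hn := l.n_pos
  rw [coord_quasiVec y t (by omega), quasiDeriv, if_pos hn, iteratedDerivWithin_zero]

lemma bracket_swap (y z : ℝ → H) (t : ℝ) :
    l.bracket z y t = -(starRingEnd ℂ) (l.bracket y z t) := by
  simp only [bracket, map_sub, inner_conj_symm]
  ring

lemma MemMaxDom.tendsto_bracket (hy : l.MemMaxDom y) (hz : l.MemMaxDom z) :
    Tendsto (l.bracket y z) l.atEnd (𝓝 (l.bracket y z 0
      + ∫ s, (inner ℂ (z s) (l.expr y s) - inner ℂ (l.expr z s) (y s)) ∂l.measure)) := by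
  have hi := (hz.memLp.integrable_inner_two hy.expr_memLp).sub
    (hz.expr_memLp.integrable_inner_two hy.memLp)
  refine ((l.tendsto_integral_atEnd hi).const_add (l.bracket y z 0)).congr' ?_
  filter_upwards [l.eventually_mem_interval] with t ht
  have := hy.memDomExpr.isState.lagrange hz.memDomExpr.isState ht
  simp only [coord_zero_quasiVec] at this
  simp only [Pi.sub_apply]
  rw [← this, bracket_eq_boundaryForm, bracket_eq_boundaryForm]
  ring

variable (l) in
/-- The element `u` of `L₂ × L₂` is the pair `(y, l[y])`, `y ∈ 𝒟`. -/
structure Represents (u : l.L2 × l.L2) (y : ℝ → H) : Prop where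
  memMaxDom : l.MemMaxDom y
  fst : u.1 =ᵐ[l.measure] y
  snd : u.2 =ᵐ[l.measure] l.expr y

lemma mem_extension_iff {θ : Submodule ℂ (HilbertPow H n × HilbertPow H n)} {u : l.L2 × l.L2} :
    u ∈ l.extension θ ↔ ∃ y, l.Represents u y ∧ (l.vec1 y 0, l.vec2 y 0) ∈ θ ∧
      l.VanishesAtEnd y :=
  ⟨fun ⟨y, h1, h2, h3, h4, h5⟩ => ⟨y, ⟨h1, h4, h5⟩, h2, h3⟩,
    fun ⟨y, ⟨h1, h4, h5⟩, h2, h3⟩ => ⟨y, h1, h2, h3, h4, h5⟩⟩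

lemma MemMaxDom.represents (hy : l.MemMaxDom y) :
    l.Represents (hy.memLp.toLp y, hy.expr_memLp.toLp (l.expr y)) y :=
  ⟨hy, hy.memLp.coeFn_toLp, hy.expr_memLp.coeFn_toLp⟩

lemma Represents.tendsto_bracket {u v : l.L2 × l.L2} (hu : l.Represents u y)
    (hv : l.Represents v z) : Tendsto (l.bracket y z) l.atEnd
      (𝓝 (l.bracket y z 0 + (inner ℂ v.1 u.2 - inner ℂ v.2 u.1))) := by
  convert! hu.memMaxDom.tendsto_bracket hv.memMaxDom using 3
  rw [integral_sub (hv.memMaxDom.memLp.integrable_inner_two hu.memMaxDom.expr_memLp)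
    (hv.memMaxDom.expr_memLp.integrable_inner_two hu.memMaxDom.memLp), L2.inner_def, L2.inner_def]
  congr 1
  · refine integral_congr_ae ?_
    filter_upwards [hv.fst, hu.snd] with s h1 h2
    rw [h1, h2]
  · refine integral_congr_ae ?_
    filter_upwards [hv.snd, hu.fst] with s h1 h2
    rw [h1, h2]

/-- The bracket tends to zero at `b` by assumption, while the Lagrange identity expresses its limit
by the bracket at `0` and scalar products in `L₂`. -/
lemma Represents.green {u v : l.L2 × l.L2} (hu : l.Represents u y)
    (hv : l.Represents v z) (h : l.VanishesAtEnd z) :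
    inner ℂ v.2 u.1 - inner ℂ v.1 u.2 = l.bracket y z 0 := by
  have h1 := (h y hu.memMaxDom).star.neg
  simp only [star_zero, neg_zero] at h1
  have h2 := tendsto_nhds_unique (hu.tendsto_bracket hv)
    (h1.congr fun t => (bracket_swap z y t).symm)
  linear_combination -h2

end Green

/-! ### The adjoint of the extension `L_θ`. -/

section Adjoint

variable {l : DiffExpr H n} {θ : Submodule ℂ (HilbertPow H n × HilbertPow H n)}

/-- An element of the adjoint relation of an extension differs from any solution of the
inhomogeneous equation by a solution of the homogeneous one, on every `[0, c]`. -/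
lemma exists_ae_eq_of_mem_adjoint {u : l.L2 × l.L2} (hu : u ∈ (l.extension θ).adjoint)
    {x : ℝ → HilbertPow H (2 * n)} (hx : l.IsState u.2 x) (hx0 : x 0 = 0) {c : ℝ} (hc0 : 0 < c)
    (hcb : (c : EReal) < l.b) (hc : c ∈ l.interval) :
    ∃ h, ∀ᵐ s ∂volume.restrict (Ioc 0 c), u.1 s = coord H n 0 (x s) + l.outputOp s h := by
  have hum : MemLp u.1 2 (volume.restrict (Ioc 0 c)) := by
    rw [← measure_restrict_Ioc hc]
    exact (Lp.memLp u.1).restrict _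
  have hxm : MemLp (fun s => coord H n 0 (x s)) 2 (volume.restrict (Ioc 0 c)) :=
    memLp_two_of_continuousOn_Icc ((coord H n 0).continuous.comp_continuousOn
      (hx.continuousOn.mono (l.Icc_subset_interval hc)))
  have key : ∀ e : ℝ → H, MemLp e 2 (volume.restrict (Ioc 0 c)) →
      (∀ h, ∫ s in (0 : ℝ)..c, inner ℂ (l.outputOp s h) (e s) = 0) →
      ∫ s in (0 : ℝ)..c, inner ℂ (e s) ((u.1 : ℝ → H) s - coord H n 0 (x s)) = 0 := by
    intro e he horth
    set f : ℝ → H := (Ioc 0 c).indicator e with hf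
    have hfc : ∀ t, c < t → f t = 0 := fun t ht =>
      indicator_of_notMem (s := Ioc 0 c) (fun h => not_le.2 ht h.2) _
    have hfe : ∀ t ∈ Ioc 0 c, f t = e t := fun t ht => indicator_of_mem ht _
    have hfi : ∀ G : ℝ → H → ℂ, ∫ s in (0 : ℝ)..c, G s (f s) = ∫ s in (0 : ℝ)..c, G s (e s) :=
      fun G => by
        refine intervalIntegral.integral_congr_ae (Eventually.of_forall fun s hs => ?_)
        rw [uIoc_of_le hc0.le] at hs
        rw [hfe s hs]
    have hfr : MemLp f 2 (volume.restrict (Ioc 0 c)) := by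
      refine (memLp_congr_ae ?_).2 he
      rw [EventuallyEq, ae_restrict_iff' measurableSet_Ioc]
      exact Eventually.of_forall hfe
    have hf2 : MemLp f 2 l.measure := memLp_of_eq_zero hc hfr fun t _ => hfc t
    -- The test function solves `l[w] = f` with zero initial state. Orthogonality of `e` to the
    -- homogeneous solutions makes its state vanish from `c` on, so it belongs to every extension,
    -- whatever `θ` is.
    obtain ⟨w, hw, hw0⟩ := l.exists_isState (locallyIntegrableOn_of_memLp hf2) 0
    have hwc : ∀ t ∈ l.interval, c ≤ t → w t = 0 := fun t ht hct => by
      refine hw.eq_zero_of_integral_inner hc hfc (fun k => ?_) ht hct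
      rw [hfi fun s v => inner ℂ (l.outputOp s k) v, horth k, hw0, boundaryForm_zero_left, neg_zero]
    have hw2 : MemLp (fun t => coord H n 0 (w t)) 2 l.measure :=
      memLp_of_eq_zero hc (memLp_two_of_continuousOn_Icc ((coord H n 0).continuous.comp_continuousOn
        (hw.continuousOn.mono (l.Icc_subset_interval hc))))
        fun t ht hct => by rw [hwc t ht hct.le, map_zero]
    have hD := hw.memMaxDom hf2 hw2
    have hmem : (hw2.toLp _, hf2.toLp f) ∈ l.extension θ := by
      refine mem_extension_iff.2 ⟨fun t => coord H n 0 (w t), ⟨hD, hw2.coeFn_toLp,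
        hf2.coeFn_toLp.trans hw.expr_ae_eq.symm⟩, ?_,
        vanishesAtEnd_of_quasiVec_eq_zero hcb fun t ht hct => by rw [hw.quasiVec_eq ht, hwc t ht hct]⟩
      rw [← lowerHalf_quasiVec, ← upperHalf_quasiVec, hw.quasiVec_eq l.zero_mem_interval, hw0,
        map_zero, map_zero]
      exact θ.zero_mem
    have hadj := (Submodule.mem_adjoint_iff _ _).1 hu _ _ hmem
    rw [L2.inner_def, L2.inner_def, sub_eq_zero] at hadj
    have hrestr : ∀ (F : ℝ → ℂ), (∀ t ∈ l.interval, c < t → F t = 0) →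
        ∫ s, F s ∂l.measure = ∫ s in (0 : ℝ)..c, F s := fun F hF => by
      have hm : ∀ᵐ t ∂l.measure, t ∈ l.interval := ae_restrict_mem l.measurableSet_interval
      have h2 : ∀ᵐ t ∂l.measure, t ≠ 0 := by
        refine ae_restrict_of_ae ?_
        simp [ae_iff, measure_singleton]
      rw [intervalIntegral.integral_of_le hc0.le, ← measure_restrict_Ioc hc,
        setIntegral_eq_integral_of_ae_compl_eq_zero]
      filter_upwards [hm, h2] with t ht ht0 htn
      refine hF t ht (not_le.1 fun htc => htn ⟨lt_of_le_of_ne (l.nonneg_of_mem ht) (Ne.symm ht0), htc⟩)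
    have e1 : ∫ s, inner ℂ ((hf2.toLp f) s) (u.1 s) ∂l.measure
        = ∫ s in (0 : ℝ)..c, inner ℂ (e s) (u.1 s) := by
      rw [← hfi fun s v => inner ℂ v (u.1 s), ← hrestr (fun s => inner ℂ (f s) (u.1 s))
        fun t _ htc => by rw [hfc t htc, inner_zero_left]]
      refine integral_congr_ae ?_
      filter_upwards [hf2.coeFn_toLp] with s hs
      rw [hs]
    have e2 : ∫ s, inner ℂ ((hw2.toLp fun t => coord H n 0 (w t)) s) (u.2 s) ∂l.measure
        = ∫ s in (0 : ℝ)..c, inner ℂ (coord H n 0 (w s)) (u.2 s) := by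
      rw [← hrestr (fun s => inner ℂ (coord H n 0 (w s)) (u.2 s))
        fun t ht htc => by rw [hwc t ht htc.le, map_zero, inner_zero_left]]
      refine integral_congr_ae ?_
      filter_upwards [hw2.coeFn_toLp] with s hs
      rw [hs]
    have hlag := hx.lagrange hw hc
    rw [hwc c hc le_rfl, hx0, boundaryForm_zero_right, boundaryForm_zero_left, sub_zero] at hlag
    have hu2m : MemLp u.2 2 (volume.restrict (Ioc 0 c)) := by
      rw [← measure_restrict_Ioc hc]
      exact (Lp.memLp u.2).restrict _
    have hw2m : MemLp (fun s => coord H n 0 (w s)) 2 (volume.restrict (Ioc 0 c)) :=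
      memLp_two_of_continuousOn_Icc ((coord H n 0).continuous.comp_continuousOn
        (hw.continuousOn.mono (l.Icc_subset_interval hc)))
    have e3 : ∫ s in (0 : ℝ)..c, (inner ℂ (coord H n 0 (w s)) (u.2 s)
          - inner ℂ (f s) (coord H n 0 (x s)))
        = (∫ s in (0 : ℝ)..c, inner ℂ (coord H n 0 (w s)) (u.2 s))
          - ∫ s in (0 : ℝ)..c, inner ℂ (e s) (coord H n 0 (x s)) := by
      rw [← hfi fun s v => inner ℂ v (coord H n 0 (x s))]
      simp only [intervalIntegral.integral_of_le hc0.le]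
      exact integral_sub (hw2m.integrable_inner_two hu2m) (hfr.integrable_inner_two hxm)
    have e4 : ∫ s in (0 : ℝ)..c, inner ℂ (e s) ((u.1 : ℝ → H) s - coord H n 0 (x s))
        = (∫ s in (0 : ℝ)..c, inner ℂ (e s) (u.1 s))
          - ∫ s in (0 : ℝ)..c, inner ℂ (e s) (coord H n 0 (x s)) := by
      simp only [inner_sub_right, intervalIntegral.integral_of_le hc0.le]
      exact integral_sub (he.integrable_inner_two hum) (he.integrable_inner_two hxm)
    -- The adjoint relation for `u` and the Lagrange identity for `x` yield the same integral of `w`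
    -- against `u.2`; subtraction gives orthogonality of `e` to `u.1 - x`.
    refine e4.trans ?_
    rw [e1, e2] at hadj
    rw [e3] at hlag
    rw [hadj, ← hlag]
  obtain ⟨h, hh⟩ := exists_ae_eq_outputOp hc0 hc (hum.sub hxm) key
  refine ⟨h, ?_⟩
  filter_upwards [hh] with s hs
  rw [← hs]
  exact (add_sub_cancel _ _).symm

/-- Observability in qualitative form; it makes the homogeneous correction independent of the length
of the interval. -/
lemma outputOp_injective {c : ℝ} (hc0 : 0 < c) (hc : c ∈ l.interval) {h : HilbertPow H (2 * n)}
    (hh : ∀ᵐ s ∂volume.restrict (Ioc 0 c), l.outputOp s h = 0) : h = 0 := by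
  obtain ⟨δ, hδ, hobs⟩ := exists_observability hc0 hc
  have h1 := hobs h
  have h2 : ∫ s in (0 : ℝ)..c, ‖l.outputOp s h‖ ^ 2 = 0 := by
    rw [intervalIntegral.integral_of_le hc0.le]
    refine integral_eq_zero_of_ae ?_
    filter_upwards [hh] with s hs
    simp [hs]
  rw [h2] at h1
  have h3 : ‖h‖ ^ 2 ≤ 0 := by
    by_contra hcon
    have := mul_pos hδ (not_le.1 hcon)
    linarith
  exact norm_eq_zero.1 (pow_eq_zero_iff two_ne_zero |>.1 (le_antisymm h3 (by positivity)))

/-- Elements of the adjoint of an extension belong to the maximal operator. -/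
lemma exists_represents_of_mem_adjoint {u : l.L2 × l.L2} (hu : u ∈ (l.extension θ).adjoint) :
    ∃ y, l.Represents u y := by
  obtain ⟨x, hx, hx0⟩ := l.exists_isState (locallyIntegrableOn_of_memLp (Lp.memLp u.2)) 0
  obtain ⟨c, hc0, hcb, hc⟩ := l.exists_pos_mem_interval
  obtain ⟨h, hh⟩ := exists_ae_eq_of_mem_adjoint hu hx hx0 hc0 hcb hc
  -- The data `k` found on the longer interval `[0, r]` must coincide with `h`, since both describe
  -- `u.1` on `[0, c]`. Rational `r` suffice to exhaust `Δ` up to a null set.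
  have hall : ∀ r : ℚ, c ≤ r → ((r : ℝ) : EReal) < l.b →
      ∀ᵐ s ∂volume.restrict (Ioc 0 (r : ℝ)), u.1 s = coord H n 0 (x s) + l.outputOp s h := by
    intro r hr hrb
    have hr0 : (0 : ℝ) < r := hc0.trans_le hr
    obtain ⟨k, hk⟩ := exists_ae_eq_of_mem_adjoint hu hx hx0 hr0 hrb
      (l.mem_interval_of_lt hr0.le hrb)
    have hk' := ae_restrict_of_ae_restrict_of_subset (Ioc_subset_Ioc_right hr) hk
    have : k - h = 0 := outputOp_injective hc0 hc (by
      filter_upwards [hk', hh] with s h1 h2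
      rw [map_sub, sub_eq_zero]
      rw [h1] at h2
      exact add_left_cancel h2)
    rwa [sub_eq_zero.1 this] at hk
  have hae : u.1 =ᵐ[l.measure] fun s => coord H n 0 ((x + fun s => l.fundSol 0 s h) s) := by
    have h1 : ∀ᵐ s : ℝ, ∀ r : ℚ, c ≤ r → ((r : ℝ) : EReal) < l.b → s ∈ Ioc 0 (r : ℝ) →
        u.1 s = coord H n 0 (x s) + l.outputOp s h := by
      rw [ae_all_iff]
      intro r
      by_cases hr : c ≤ r
      · by_cases hrb : ((r : ℝ) : EReal) < l.b
        · filter_upwards [(ae_restrict_iff' measurableSet_Ioc).1 (hall r hr hrb)] with s hs _ _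
            using hs
        · exact Eventually.of_forall fun s _ h => absurd h hrb
      · exact Eventually.of_forall fun s h => absurd h hr
    have hm : ∀ᵐ t ∂l.measure, t ∈ l.interval := ae_restrict_mem l.measurableSet_interval
    have h2 : ∀ᵐ t ∂l.measure, t ≠ 0 := by
      refine ae_restrict_of_ae ?_
      simp [ae_iff, measure_singleton]
    filter_upwards [ae_restrict_of_ae h1, hm, h2, l.ae_lt_b] with s hs hsl hs0 hsb
    have hmax : ((max s c : ℝ) : EReal) < l.b := by
      rcases max_choice s c with h | h <;> rw [h] <;> assumption
    obtain ⟨r, hr1, hr2⟩ := EReal.lt_iff_exists_rat_btwn.1 hmax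
    have hr1' : max s c < (r : ℝ) := EReal.coe_lt_coe_iff.1 hr1
    rw [hs r ((le_max_right _ _).trans hr1'.le) hr2 ⟨lt_of_le_of_ne (l.nonneg_of_mem hsl)
      (Ne.symm hs0), (le_max_left _ _).trans hr1'.le⟩, Pi.add_apply, map_add]
    rfl
  have hst : l.IsState (u.2 + 0) (x + fun s => l.fundSol 0 s h) :=
    hx.add (l.isState_fundSol_zero h)
  rw [add_zero] at hst
  exact ⟨_, hst.memMaxDom (Lp.memLp u.2) ((memLp_congr_ae hae).1 (Lp.memLp u.1)), hae,
    hst.expr_ae_eq.symm⟩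

/-- The adjoint of the extension `L_θ`. -/
theorem mem_adjoint_extension_iff {u : l.L2 × l.L2} : u ∈ (l.extension θ).adjoint ↔
    ∃ y, l.Represents u y ∧ (l.vec1 y 0, l.vec2 y 0) ∈ θ.adjoint := by
  constructor
  · intro hu
    obtain ⟨y, hy⟩ := exists_represents_of_mem_adjoint hu
    refine ⟨y, hy, (Submodule.mem_adjoint_iff _ _).2 fun a b hab => ?_⟩
    -- A function of the domain of `L_θ` with arbitrarily prescribed initial data in `θ`; Green's
    -- formula then reads off the condition on the data of `y`.
    obtain ⟨z, hz, hz0, hzb⟩ := l.exists_memMaxDom_vanishesAtEnd (joinHalves H n (a, b))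
    have h1 : l.vec1 z 0 = a := by rw [← lowerHalf_quasiVec, hz0, lowerHalf_joinHalves]
    have h2 : l.vec2 z 0 = b := by rw [← upperHalf_quasiVec, hz0, upperHalf_joinHalves]
    have h3 := (Submodule.mem_adjoint_iff _ _).1 hu _ _
      (mem_extension_iff.2 ⟨z, hz.represents, by rwa [h1, h2], hzb⟩)
    have h4 := hy.green hz.represents hzb
    rw [h3, bracket, h1, h2] at h4
    exact h4.symm
  · rintro ⟨y, hy, hyθ⟩
    refine (Submodule.mem_adjoint_iff _ _).2 fun a b hab => ?_
    obtain ⟨z, hz, hzθ, hzb⟩ := mem_extension_iff.1 hab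
    have h3 := (Submodule.mem_adjoint_iff _ _).1 hyθ _ _ hzθ
    exact (hy.green hz hzb).trans h3

lemma extension_le_adjoint (hθ : θ ≤ θ.adjoint) :
    l.extension θ ≤ (l.extension θ).adjoint := by
  intro u hu
  obtain ⟨y, hy, hyθ, -⟩ := mem_extension_iff.1 hu
  exact mem_adjoint_extension_iff.2 ⟨y, hy, hθ hyθ⟩

end Adjoint

end DiffExpr

namespace DiffExpr

variable {H : Type*} [NormedAddCommGroup H] [InnerProductSpace ℂ H] [CompleteSpace H] {n : ℕ}

/-! ### The limit point condition and triviality of the defect subspaces. -/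

section LimitPoint

variable {l : DiffExpr H n} {θ : Submodule ℂ (HilbertPow H n × HilbertPow H n)} {z : ℂ}
  {y : ℝ → H}

lemma quasiVec_add {y w : ℝ → H} (hy : l.MemDomExpr y) (hw : l.MemDomExpr w) {t : ℝ}
    (ht : t ∈ l.interval) : l.quasiVec (y + w) t = l.quasiVec y t + l.quasiVec w t :=
  ext_coord fun k hk => by
    rw [map_add, coord_quasiVec _ _ hk, coord_quasiVec _ _ hk, coord_quasiVec _ _ hk,
      quasiDeriv_add hy hw hk ht, Pi.add_apply]

variable (l) in
/-- `l` is in the limit point case at the right end point: the bracket vanishes there. -/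
def IsLimitPoint : Prop := ∀ y, l.MemMaxDom y → l.VanishesAtEnd y

lemma MemMaxDom.exists_represents (hy : l.MemMaxDom y) : ∃ u, l.Represents u y :=
  ⟨_, hy.represents⟩

lemma VanishesAtEnd.tendsto_bracket_right {w : ℝ → H} (hw : l.VanishesAtEnd w)
    (hy : l.MemMaxDom y) : Tendsto (l.bracket y w) l.atEnd (𝓝 0) := by
  have h1 := (hw y hy).star.neg
  simp only [star_zero, neg_zero] at h1
  exact h1.congr fun t => (bracket_swap w y t).symm

/-- A function of the maximal domain is the sum of one with zero initial data and one vanishing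
near the right end point. -/
lemma MemMaxDom.exists_add_eq (hy : l.MemMaxDom y) : ∃ y₁ y₂, l.MemMaxDom y₁ ∧ l.MemMaxDom y₂ ∧
    l.quasiVec y₁ 0 = 0 ∧ l.VanishesAtEnd y₂ ∧ y = y₁ + y₂ := by
  obtain ⟨w, hw, hw0, hwb⟩ := l.exists_memMaxDom_vanishesAtEnd (-l.quasiVec y 0)
  refine ⟨y + w, (-1 : ℂ) • w, hy.add hw, hw.smul (-1), ?_, hwb.smul (-1), ?_⟩
  · rw [quasiVec_add hy.memDomExpr hw.memDomExpr l.zero_mem_interval, hw0, add_neg_cancel]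
  · funext t
    simp only [Pi.add_apply, Pi.neg_apply, neg_smul, one_smul, add_neg_cancel_right]

/-- If the defect subspaces of `L_θ` are trivial, then the limit point case holds. -/
theorem isLimitPoint_of_defectSubspace_eq_bot (hθ : θ ≤ θ.adjoint) (hz : z.im ≠ 0)
    (h₁ : defectSubspace (l.extension θ) z = ⊥)
    (h₂ : defectSubspace (l.extension θ) (starRingEnd ℂ z) = ⊥) : l.IsLimitPoint := by
  intro y hy
  -- Only the parts with zero initial data matter. They belong to the adjoint of `L_θ`, whose
  -- symmetry leaves no limit for their bracket.
  obtain ⟨y₁, y₂, hy₁, hy₂, hy0, hyb, rfl⟩ := hy.exists_add_eq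
  refine VanishesAtEnd.add hy₁ hy₂ (fun w hw => ?_) hyb
  obtain ⟨w₁, w₂, hw₁, hw₂, hw0, hwb, rfl⟩ := hw.exists_add_eq
  have hmem : ∀ {u : l.L2 × l.L2} {v : ℝ → H}, l.Represents u v → l.quasiVec v 0 = 0 →
      (u.1, u.2) ∈ (l.extension θ).adjoint := by
    intro u v hv hv0
    refine mem_adjoint_extension_iff.2 ⟨v, hv, ?_⟩
    rw [← lowerHalf_quasiVec, ← upperHalf_quasiVec, hv0, map_zero, map_zero]
    exact Submodule.zero_mem _
  obtain ⟨u, hu⟩ := hy₁.exists_represents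
  obtain ⟨v, hv⟩ := hw₁.exists_represents
  have hu' := hmem hu hy0
  have hv' := hmem hv hw0
  have hT := extension_le_adjoint (l := l) hθ
  have h : inner ℂ v.2 u.1 = inner ℂ v.1 u.2 :=
    inner_comm_of_defectSubspace_eq_bot (X := l.L2) (T := l.extension θ) hT hz h₁ h₂ hv' hu'
  have hlim := hu.tendsto_bracket hv
  rw [h, sub_self, bracket_eq_boundaryForm, hy0, boundaryForm_zero_left, add_zero] at hlim
  have := hlim.add (hwb.tendsto_bracket_right hy₁)
  rw [add_zero] at this
  refine this.congr' ?_
  filter_upwards [l.eventually_mem_interval] with t ht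
  rw [bracket_eq_boundaryForm, bracket_eq_boundaryForm, bracket_eq_boundaryForm,
    quasiVec_add hw₁.memDomExpr hw₂.memDomExpr ht, boundaryForm_add_right]

/-- In the limit point case a square integrable solution of `l[y] = z y` with initial data in a
symmetric relation vanishes. -/
lemma IsLimitPoint.eq_zero (hl : l.IsLimitPoint) (hθ : θ ≤ θ.adjoint) (hz : z.im ≠ 0)
    {u : l.L2 × l.L2} (hu : l.Represents u y) (huz : u.2 = z • u.1)
    (hyθ : (l.vec1 y 0, l.vec2 y 0) ∈ θ) : u.1 = 0 := by
  have h1 := hu.green hu (hl y hu.memMaxDom)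
  have h2 : l.bracket y y 0 = 0 := (Submodule.mem_adjoint_iff _ _).1 (hθ hyθ) _ _ hyθ
  rw [h2, huz, inner_smul_left, inner_smul_right, ← sub_mul] at h1
  rcases mul_eq_zero.1 h1 with h | h
  · exfalso
    -- The factor `conj z - z` has imaginary part `-2 Im z`, which is nonzero.
    have := congrArg Complex.im h
    simp at this
    exact hz (by linarith)
  · exact inner_self_eq_zero.1 h

theorem IsLimitPoint.defectSubspace_eq_bot (hl : l.IsLimitPoint) (hθ : IsSelfAdjointRelation θ)
    (hz : z.im ≠ 0) : defectSubspace (l.extension θ) z = ⊥ := by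
  rw [Submodule.eq_bot_iff]
  intro x hx
  obtain ⟨y, hy, hyθ⟩ := mem_adjoint_extension_iff.1 (mem_defectSubspace_iff.1 hx)
  rw [hθ] at hyθ
  exact hl.eq_zero hθ.ge hz hy rfl hyθ

lemma Represents.quasiVec_eq_fundSol {u : l.L2 × l.L2} (hu : l.Represents u y)
    (huz : u.2 = z • u.1) {t : ℝ} (ht : t ∈ l.interval) :
    l.quasiVec y t = l.fundSol z t (l.quasiVec y 0) := by
  have h : l.expr y =ᵐ[l.measure] fun t => z • coord H n 0 (l.quasiVec y t) := by
    filter_upwards [hu.fst, hu.snd, Lp.coeFn_smul z u.1] with s h1 h2 h3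
    rw [← h2, huz, h3, Pi.smul_apply, h1, coord_zero_quasiVec]
  refine (hu.memMaxDom.memDomExpr.isState.congr_ae h).eqOn_of_smul (l.isState_fundSol z _) ?_ ht
  rw [l.fundSol_zero]
  rfl

/-- A square integrable solution of `l[y] = z y`. -/
lemma exists_represents_fundSol {x₀ : HilbertPow H (2 * n)}
    (hx : MemLp (fun t => coord H n 0 (l.fundSol z t x₀)) 2 l.measure) :
    ∃ (u : l.L2) (y : ℝ → H), l.Represents (u, z • u) y ∧ l.quasiVec y 0 = x₀ ∧
      u =ᵐ[l.measure] fun t => coord H n 0 (l.fundSol z t x₀) := by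
  have hs := l.isState_fundSol z x₀
  refine ⟨hx.toLp _, _, ⟨hs.memMaxDom (hx.const_smul z) hx, hx.coeFn_toLp, ?_⟩, ?_, hx.coeFn_toLp⟩
  · refine EventuallyEq.trans ?_ hs.expr_ae_eq.symm
    filter_upwards [Lp.coeFn_smul z (hx.toLp _), hx.coeFn_toLp] with s h1 h2
    rw [h1, Pi.smul_apply, h2]
  · rw [hs.quasiVec_eq l.zero_mem_interval, l.fundSol_zero]
    rfl

/-- A solution of `l[y] = z y` vanishing almost everywhere also solves `l[y] = 0`, for which
observability is available. -/
lemma eq_zero_of_fundSol_ae_eq_zero {x₀ : HilbertPow H (2 * n)}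
    (hx : ∀ᵐ t ∂l.measure, coord H n 0 (l.fundSol z t x₀) = 0) : x₀ = 0 := by
  obtain ⟨c, hc0, -, hc⟩ := l.exists_pos_mem_interval
  have hs := l.isState_fundSol z x₀
  have hs' : l.IsState (fun t => (0 : ℂ) • coord H n 0 (l.fundSol z t x₀))
      (fun t => l.fundSol z t x₀) := by
    refine hs.congr_ae ?_
    filter_upwards [hx] with t ht
    rw [ht, smul_zero, smul_zero]
  have heq := hs'.eqOn_of_smul (l.isState_fundSol 0 x₀) (by rw [l.fundSol_zero, l.fundSol_zero])
  refine outputOp_injective hc0 hc ?_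
  rw [← measure_restrict_Ioc hc]
  refine ae_restrict_of_ae ?_
  filter_upwards [hx, ae_restrict_mem l.measurableSet_interval] with t h1 h2
  rw [outputOp, ContinuousLinearMap.comp_apply]
  exact (congrArg (coord H n 0) (heq h2).symm).trans h1

end LimitPoint

/-! ### The operator solutions `φ_K` and the fundamental solution. -/

section Phi

variable {l : DiffExpr H n} {z : ℂ} {K₀ K₁ : HilbertPow H n →L[ℂ] HilbertPow H n}
  {𝒦 : Type*} [NormedAddCommGroup 𝒦] [InnerProductSpace ℂ 𝒦]

lemma _root_.HasDerivWithinAt.clm_apply_const {X Y : Type*} [NormedAddCommGroup X]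
    [NormedSpace ℂ X] [NormedAddCommGroup Y] [NormedSpace ℂ Y] {F : ℝ → X →L[ℂ] Y}
    {F' : X →L[ℂ] Y} {s : Set ℝ} {t : ℝ} (hF : HasDerivWithinAt F F' s t) (h : X) :
    HasDerivWithinAt (fun t => F t h) (F' h) s t :=
  ((ContinuousLinearMap.apply ℂ Y h).restrictScalars ℝ).hasFDerivAt.comp_hasDerivWithinAt t hF

lemma _root_.HasDerivWithinAt.clm_comp_const {X Y Z : Type*} [NormedAddCommGroup X]
    [NormedSpace ℂ X] [NormedAddCommGroup Y] [NormedSpace ℂ Y] [NormedAddCommGroup Z]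
    [NormedSpace ℂ Z] {F : ℝ → X →L[ℂ] Y}
    {F' : X →L[ℂ] Y} {s : Set ℝ} {t : ℝ} (hF : HasDerivWithinAt F F' s t) (B : Z →L[ℂ] X) :
    HasDerivWithinAt (fun t => F t ∘L B) (F' ∘L B) s t :=
  (((ContinuousLinearMap.compL ℂ Z X Y).flip B).restrictScalars
    ℝ).hasFDerivAt.comp_hasDerivWithinAt t hF

lemma _root_.HasDerivWithinAt.const_clm_comp {X Y Z : Type*} [NormedAddCommGroup X]
    [NormedSpace ℂ X] [NormedAddCommGroup Y] [NormedSpace ℂ Y] [NormedAddCommGroup Z]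
    [NormedSpace ℂ Z] {F : ℝ → X →L[ℂ] Y}
    {F' : X →L[ℂ] Y} {s : Set ℝ} {t : ℝ} (hF : HasDerivWithinAt F F' s t) (A : Y →L[ℂ] Z) :
    HasDerivWithinAt (fun t => A ∘L F t) (A ∘L F') s t :=
  (((ContinuousLinearMap.compL ℂ X Y Z) A).restrictScalars
    ℝ).hasFDerivAt.comp_hasDerivWithinAt t hF

lemma IsQuasiSystem.apply {x : ℕ → ℝ → 𝒦 →L[ℂ] H} {w : ℝ → 𝒦 →L[ℂ] H}
    (hx : l.IsQuasiSystem x w) (h : 𝒦) :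
    l.IsQuasiSystem (fun k t => x k t h) (fun t => w t h) := by
  refine ⟨fun k hk t ht => ?_, fun t ht => ?_, fun j hj t ht => ?_⟩
  · convert! (hx.deriv_lower k hk t ht).clm_apply_const h using 1
    split_ifs <;> rfl
  · exact congrArg (fun A : 𝒦 →L[ℂ] H => A h) (hx.mid t ht)
  · convert! (hx.deriv_upper j hj t ht).clm_apply_const h using 1
    split_ifs <;> rfl

/-- Evaluation at a vector preserves the first order system, and this system determines the
quasi-derivatives; hence evaluation commutes with them. -/
lemma IsOperatorSolution.isState {Y : ℝ → 𝒦 →L[ℂ] H} (hY : l.IsOperatorSolution z Y) (h : 𝒦) :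
    l.IsState (fun t => z • coord H n 0 (l.quasiVec (fun t => Y t h) t))
      (l.quasiVec fun t => Y t h) ∧
    ∀ k < 2 * n, ∀ t ∈ l.interval, l.quasiDeriv (fun t => Y t h) k t = l.quasiDeriv Y k t h := by
  have hn := l.n_pos
  have hsys := (isQuasiSystem_quasiDeriv (l := l) (y := Y) fun k hk =>
    (hY.contDiffOn k (by omega)).differentiableOn (by simp)).apply h
  have h0 : (fun t => l.quasiDeriv Y 0 t h) = fun t => Y t h := by
    funext t
    rw [quasiDeriv, if_pos hn, iteratedDerivWithin_zero]
  have hq : ∀ k < 2 * n, ∀ t ∈ l.interval,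
      l.quasiDeriv (fun t => Y t h) k t = l.quasiDeriv Y k t h := fun k hk t ht => by
    rw [← hsys.quasiDeriv_eq hk ht, h0]
  have hdiff : ∀ t ∈ l.interval, HasDerivWithinAt (l.quasiDeriv Y (2 * n - 1))
      (derivWithin (l.quasiDeriv Y (2 * n - 1)) l.interval t) l.interval t := fun t ht =>
    (((hY.contDiffOn (2 * n - 1) (by omega)).differentiableOn (by simp)) t ht).hasDerivWithinAt
  have hcont : ContinuousOn (derivWithin (l.quasiDeriv Y (2 * n - 1)) l.interval) l.interval :=
    (hY.contDiffOn (2 * n - 1) (by omega)).continuousOn_derivWithin l.uniqueDiffOn_interval le_rfl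
  have hdom : l.MemDomExpr fun t => Y t h := by
    refine ⟨fun k hk => ?_, fun t => derivWithin (l.quasiDeriv Y (2 * n - 1)) l.interval t h,
      locallyIntegrableOn_of_continuousOn (hcont.clm_apply continuousOn_const), fun t ht => ?_⟩
    · exact (((ContinuousLinearMap.apply ℂ H h).restrictScalars ℝ).contDiff.comp_contDiffOn
        (hY.contDiffOn k (by omega))).congr fun t ht => hq k (by omega) t ht
    · rw [hq _ (by omega) t ht, hq _ (by omega) 0 l.zero_mem_interval]
      exact integralEq_of_hasDerivWithinAt (hcont.clm_apply continuousOn_const)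
        (fun s hs => (hdiff s hs).clm_apply_const h) ht
  have hexpr : ∀ t ∈ l.interval, l.expr (fun t => Y t h) t = z • Y t h := by
    intro t ht
    rw [← h0]
    refine hsys.expr_eq ht ?_
    convert! (hdiff t ht).clm_apply_const h using 1
    have e := l.expr_eq_neg_derivWithin Y t
    rw [hY.expr_eq t ht, ← sub_eq_iff_eq_add, ← neg_eq_iff_eq_neg] at e
    rw [← e]
    simp only [sub_apply, add_apply, smul_apply, neg_sub]
    rw [sub_eq_neg_add]
    congr 2
    split_ifs <;> rfl
  refine ⟨hdom.isState.congr_ae ?_, hq⟩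
  filter_upwards [ae_restrict_mem l.measurableSet_interval] with t ht
  rw [hexpr t ht, coord_zero_quasiVec]

/-- The operator solution `φ_K(·, z)` applied to a vector. -/
lemma IsPhi.apply_eq {φ : ℝ → HilbertPow H n →L[ℂ] H} (hφ : l.IsPhi K₀ K₁ z φ)
    (h : HilbertPow H n) {t : ℝ} (ht : t ∈ l.interval) :
    φ t h = coord H n 0 (l.fundSol z t (joinHalves H n (K₀ h, K₁ h))) := by
  obtain ⟨hs, hq⟩ := hφ.isOperatorSolution.isState h
  have h0 : l.quasiVec (fun t => φ t h) 0 = joinHalves H n (K₀ h, K₁ h) := by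
    refine ext_halves ?_ ?_
    · rw [lowerHalf_joinHalves, lowerHalf_quasiVec]
      ext k
      exact (hq k (by omega) 0 l.zero_mem_interval).trans (hφ.initial₁ h k)
    · rw [upperHalf_joinHalves, upperHalf_quasiVec]
      ext k
      exact (hq _ (by omega) 0 l.zero_mem_interval).trans (hφ.initial₂ h k)
  have := hs.eqOn_of_smul (l.isState_fundSol z (joinHalves H n (K₀ h, K₁ h)))
    (by rw [h0, l.fundSol_zero]; rfl) ht
  exact (coord_zero_quasiVec _ _).symm.trans (congrArg (coord H n 0) this)

lemma fieldAt_coord {k : ℕ} (hk : k + 1 < 2 * n) (t : ℝ) :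
    coord H n k ∘L l.fieldAt z t = l.fieldCoord t k := by
  ext x
  rw [fieldAt, ContinuousLinearMap.comp_apply, add_apply, map_add, l.coord_field _ (by omega),
    smul_apply, map_smul, ContinuousLinearMap.comp_apply, l.coord_inputOp (by omega),
    if_neg (by omega), smul_zero, add_zero]

lemma coord_fieldAt_last (t : ℝ) (x : HilbertPow H (2 * n)) :
    coord H n (2 * n - 1) (l.fieldAt z t x)
      = l.fieldCoord t (2 * n - 1) x - z • coord H n 0 x := by
  have hn := l.n_pos
  rw [fieldAt, add_apply, map_add, l.coord_field _ (by omega),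
    smul_apply, map_smul, ContinuousLinearMap.comp_apply, l.coord_inputOp (by omega),
    if_pos rfl, smul_neg, sub_eq_add_neg]

lemma hasDerivWithinAt_coord_fundSol_comp (B : 𝒦 →L[ℂ] HilbertPow H (2 * n)) (k : ℕ) {t : ℝ}
    (ht : t ∈ l.interval) : HasDerivWithinAt (fun t => coord H n k ∘L (l.fundSol z t ∘L B))
      (coord H n k ∘L (l.fieldAt z t ∘L (l.fundSol z t ∘L B))) l.interval t :=
  ((l.hasDerivWithinAt_fundSol z ht).clm_comp_const B).const_clm_comp (coord H n k)

variable (l z) in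
lemma isOperatorSolution_fundSol_comp (B : 𝒦 →L[ℂ] HilbertPow H (2 * n)) :
    l.IsOperatorSolution z (fun t => coord H n 0 ∘L (l.fundSol z t ∘L B)) ∧
    ∀ k < 2 * n, ∀ t ∈ l.interval, l.quasiDeriv (fun t => coord H n 0 ∘L (l.fundSol z t ∘L B)) k t
      = coord H n k ∘L (l.fundSol z t ∘L B) := by
  have hn := l.n_pos
  have hsys := isQuasiSystem_op_of_hasDerivWithinAt (l := l) (X := fun t => l.fundSol z t ∘L B)
    fun k hk t ht => by
      have := hasDerivWithinAt_coord_fundSol_comp (z := z) B k ht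
      rwa [← ContinuousLinearMap.comp_assoc, fieldAt_coord hk] at this
  have hq : ∀ k < 2 * n, ∀ t ∈ l.interval,
      l.quasiDeriv (fun t => coord H n 0 ∘L (l.fundSol z t ∘L B)) k t
        = coord H n k ∘L (l.fundSol z t ∘L B) := fun k hk t ht => hsys.quasiDeriv_eq hk ht
  refine ⟨⟨fun k hk => ?_, fun t ht => ?_⟩, hq⟩
  · refine (contDiffOn_one_of_hasDerivWithinAt
      (v := fun t => coord H n k ∘L (l.fieldAt z t ∘L (l.fundSol z t ∘L B))) ?_
      fun t ht => hasDerivWithinAt_coord_fundSol_comp B k ht).congr (hq k hk)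
    exact continuousOn_const.clm_comp ((l.continuousOn_fieldAt z).clm_comp
      ((l.continuousOn_fundSol z).clm_comp continuousOn_const))
  · refine hsys.expr_eq ht ?_
    convert! hasDerivWithinAt_coord_fundSol_comp (z := z) B (2 * n - 1) ht using 1
    ext h
    rw [ContinuousLinearMap.comp_apply, ContinuousLinearMap.comp_apply, coord_fieldAt_last,
      l.fieldCoord_last, sub_eq_neg_add]
    simp only [add_apply, neg_apply]
    congr 1
    split_ifs <;> rfl

variable (l) in
theorem exists_isPhi (K₀ K₁ : HilbertPow H n →L[ℂ] HilbertPow H n) (z : ℂ) :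
    ∃ φ, l.IsPhi K₀ K₁ z φ := by
  obtain ⟨hsol, hq⟩ := l.isOperatorSolution_fundSol_comp z (joinHalves H n ∘L K₀.prod K₁)
  refine ⟨_, hsol, fun h k => ?_, fun h k => ?_⟩
  · rw [hq k (by omega) 0 l.zero_mem_interval]
    change lowerHalf H n (l.fundSol z 0 (joinHalves H n (K₀ h, K₁ h))) k = _
    rw [l.fundSol_zero]
    exact congrArg (fun u : HilbertPow H n => u k) (lowerHalf_joinHalves (K₀ h, K₁ h))
  · rw [hq _ (by omega) 0 l.zero_mem_interval]
    change upperHalf H n (l.fundSol z 0 (joinHalves H n (K₀ h, K₁ h))) k = _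
    rw [l.fundSol_zero]
    exact congrArg (fun u : HilbertPow H n => u k) (upperHalf_joinHalves (K₀ h, K₁ h))

lemma lintegral_enorm_sq_eq_top_iff {f : ℝ → H} (hf : ContinuousOn f l.interval) :
    ∫⁻ t in l.interval, ‖f t‖ₑ ^ 2 = ⊤ ↔ ¬ MemLp f 2 l.measure := by
  have h1 : AEStronglyMeasurable f l.measure := hf.aestronglyMeasurable l.measurableSet_interval
  have h2 := eLpNorm_lt_top_iff_lintegral_rpow_enorm_lt_top (f := f) (μ := l.measure)
    (p := 2) (by norm_num) (by norm_num)
  simp only [ENNReal.toReal_ofNat, ENNReal.rpow_ofNat] at h2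
  rw [MemLp, and_iff_right h1, h2, not_lt, top_le_iff, measure]

/-- Existence and uniqueness of `φ_K` remove the existential quantifier: all reduces to the
fundamental solution applied to `(K₀ h, K₁ h)`. -/
lemma phiNotSquareIntegrable_iff : l.PhiNotSquareIntegrable K₀ K₁ z ↔
    ∀ h : HilbertPow H n, h ≠ 0 → ¬ MemLp
      (fun t => coord H n 0 (l.fundSol z t (joinHalves H n (K₀ h, K₁ h)))) 2 l.measure := by
  have hc : ∀ x₀, ContinuousOn (fun t => coord H n 0 (l.fundSol z t x₀)) l.interval := fun x₀ =>
    (coord H n 0).continuous.comp_continuousOn (l.continuousOn_fundSol_apply z x₀)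
  have key : ∀ φ, l.IsPhi K₀ K₁ z φ → ∀ h, (∫⁻ t in l.interval, ‖φ t h‖ₑ ^ 2 = ⊤ ↔ ¬ MemLp
      (fun t => coord H n 0 (l.fundSol z t (joinHalves H n (K₀ h, K₁ h)))) 2 l.measure) :=
    fun φ hφ h => by
      rw [← lintegral_enorm_sq_eq_top_iff (hc _), setLIntegral_congr_fun l.measurableSet_interval
        fun t ht => by rw [hφ.apply_eq h ht]]
  constructor
  · rintro ⟨φ, hφ, hh⟩ h hne
    exact (key φ hφ h).1 (hh h hne)
  · intro hh
    obtain ⟨φ, hφ⟩ := l.exists_isPhi K₀ K₁ z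
    exact ⟨φ, hφ, fun h hne => (key φ hφ h).2 (hh h hne)⟩

/-- A square integrable `φ_K h` has initial data in the symmetric relation `ran K`, so it vanishes
in `L₂`. Then its initial data vanish, and `h = 0` by admissibility of the pair. -/
theorem IsLimitPoint.phiNotSquareIntegrable (hl : l.IsLimitPoint) (hK : IsSelfAdjointPair K₀ K₁)
    (hz : z.im ≠ 0) : l.PhiNotSquareIntegrable K₀ K₁ z := by
  refine phiNotSquareIntegrable_iff.2 fun h hne hm => hne ?_
  obtain ⟨u, y, hy, hy0, hu⟩ := exists_represents_fundSol hm
  have h0 : u = 0 := hl.eq_zero (u := (u, z • u)) hK.range_selfAdjoint.ge hz hy rfl (by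
    rw [← lowerHalf_quasiVec, ← upperHalf_quasiVec, hy0, lowerHalf_joinHalves, upperHalf_joinHalves]
    exact ⟨h, rfl⟩)
  have hx : joinHalves H n (K₀ h, K₁ h) = 0 := by
    refine eq_zero_of_fundSol_ae_eq_zero (l := l) (z := z) ?_
    rw [h0] at hu
    filter_upwards [hu, Lp.coeFn_zero H 2 l.measure] with t h1 h2
    rw [← h1, h2]
    rfl
  refine hK.ker_eq_bot h ?_ ?_
  · have := lowerHalf_joinHalves (K₀ h, K₁ h)
    rwa [hx, map_zero, eq_comm] at this
  · have := upperHalf_joinHalves (K₀ h, K₁ h)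
    rwa [hx, map_zero, eq_comm] at this

/-- For `θ = ran K`, a defect element solves `l[y] = z y` with data in `θ* = ran K`. It is therefore
some `φ_K h`, and its square integrability forces `h = 0`. -/
theorem PhiNotSquareIntegrable.defectSubspace_eq_bot (hK : IsSelfAdjointPair K₀ K₁)
    (hφ : l.PhiNotSquareIntegrable K₀ K₁ z) :
    defectSubspace (l.extension
      (LinearMap.range ((K₀.prod K₁ : HilbertPow H n →L[ℂ] HilbertPow H n × HilbertPow H n) :
        HilbertPow H n →ₗ[ℂ] HilbertPow H n × HilbertPow H n))) z = ⊥ := by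
  rw [Submodule.eq_bot_iff]
  intro u hu
  obtain ⟨y, hy, hyθ⟩ := mem_adjoint_extension_iff.1 (mem_defectSubspace_iff.1 hu)
  rw [hK.range_selfAdjoint] at hyθ
  obtain ⟨h, hh⟩ := hyθ
  have h0 : l.quasiVec y 0 = joinHalves H n (K₀ h, K₁ h) := by
    refine ext_halves ?_ ?_
    · rw [lowerHalf_joinHalves, lowerHalf_quasiVec]
      exact (congrArg Prod.fst hh).symm
    · rw [upperHalf_joinHalves, upperHalf_quasiVec]
      exact (congrArg Prod.snd hh).symm
  have hae : u =ᵐ[l.measure]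
      fun t => coord H n 0 (l.fundSol z t (joinHalves H n (K₀ h, K₁ h))) := by
    filter_upwards [hy.fst, ae_restrict_mem l.measurableSet_interval] with t h1 h2
    rw [h1, ← h0, ← hy.quasiVec_eq_fundSol rfl h2, coord_zero_quasiVec]
  have hhz : h = 0 := by
    by_contra hne
    exact phiNotSquareIntegrable_iff.1 hφ h hne ((memLp_congr_ae hae).1 (Lp.memLp u))
  refine Lp.ext ?_
  filter_upwards [hae, Lp.coeFn_zero H 2 l.measure] with t h1 h2
  rw [h1, h2, hhz, map_zero, map_zero, Prod.mk_zero_zero, map_zero, map_zero, map_zero]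
  rfl

end Phi

end DiffExpr

lemma deficiencyIndexPos_eq_zero_iff {X : Type*} [NormedAddCommGroup X] [InnerProductSpace ℂ X]
    {T : Submodule ℂ (X × X)} :
    deficiencyIndexPos T = 0 ↔ defectSubspace T Complex.I = ⊥ := by
  rw [deficiencyIndexPos, Cardinal.toENat_eq_zero, Submodule.rank_eq_zero]

lemma deficiencyIndexNeg_eq_zero_iff {X : Type*} [NormedAddCommGroup X] [InnerProductSpace ℂ X]
    {T : Submodule ℂ (X × X)} :
    deficiencyIndexNeg T = 0 ↔ defectSubspace T (-Complex.I) = ⊥ := by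
  rw [deficiencyIndexNeg, Cardinal.toENat_eq_zero, Submodule.rank_eq_zero]

namespace DiffExpr

variable {H : Type*} [NormedAddCommGroup H] [InnerProductSpace ℂ H] [CompleteSpace H] {n : ℕ}

/-! ### Deficiency indices, operator pairs and the limit point condition. -/

section Equivalences

variable {l : DiffExpr H n} {θ : Submodule ℂ (HilbertPow H n × HilbertPow H n)}

theorem endDeficiency_eq_zero_iff_isLimitPoint (hθ : IsSelfAdjointRelation θ) :
    (l.endDeficiencyPos θ = 0 ∧ l.endDeficiencyNeg θ = 0) ↔ l.IsLimitPoint := by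
  rw [endDeficiencyPos, endDeficiencyNeg, deficiencyIndexPos_eq_zero_iff,
    deficiencyIndexNeg_eq_zero_iff]
  refine ⟨fun ⟨h₁, h₂⟩ => isLimitPoint_of_defectSubspace_eq_bot hθ.ge (z := Complex.I) (by simp) h₁
    (by rwa [Complex.conj_I]), fun h => ⟨h.defectSubspace_eq_bot hθ (by simp),
      h.defectSubspace_eq_bot hθ (by simp)⟩⟩

/-- Some selfadjoint pair must exist for (iii) to imply (ii). -/
lemma isSelfAdjointPair_id_zero {X : Type*} [NormedAddCommGroup X] [InnerProductSpace ℂ X] :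
    IsSelfAdjointPair (ContinuousLinearMap.id ℂ X) (0 : X →L[ℂ] X) := by
  refine ⟨fun h h0 _ => h0, ?_⟩
  ext ⟨a, b⟩
  rw [Submodule.mem_adjoint_iff]
  constructor
  · intro h
    have := h b 0 ⟨b, rfl⟩
    rw [inner_zero_left, zero_sub, neg_eq_zero, inner_self_eq_zero] at this
    exact ⟨a, Prod.ext rfl this.symm⟩
  · rintro ⟨v, hv⟩ c d ⟨w, hw⟩
    obtain rfl : 0 = b := congrArg Prod.snd hv
    obtain rfl : 0 = d := congrArg Prod.snd hw
    rw [inner_zero_left, inner_zero_right, sub_zero]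

theorem isLimitPoint_of_phiNotSquareIntegrable {K₀ K₁ : HilbertPow H n →L[ℂ] HilbertPow H n}
    (hK : IsSelfAdjointPair K₀ K₁) {z w : ℂ} (hz : 0 < z.im) (hw : w.im < 0)
    (h₁ : l.PhiNotSquareIntegrable K₀ K₁ z) (h₂ : l.PhiNotSquareIntegrable K₀ K₁ w) :
    l.IsLimitPoint := by
  have hT := extension_le_adjoint (l := l) hK.range_selfAdjoint.ge
  refine isLimitPoint_of_defectSubspace_eq_bot hK.range_selfAdjoint.ge (z := z) hz.ne'
    (h₁.defectSubspace_eq_bot hK) ?_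
  -- Essential selfadjointness needs a conjugate pair of points; the given `w` is moved to `conj z`
  -- inside the lower half-plane.
  refine defectSubspace_eq_bot_of_same_side hT (z := w) ?_ (h₂.defectSubspace_eq_bot hK)
  rw [Complex.conj_im]
  nlinarith

end Equivalences

/-! ### Counting dimensions when `dim H < ∞`. -/

section FiniteDimensional

variable {l : DiffExpr H n} {θ : Submodule ℂ (HilbertPow H n × HilbertPow H n)} {z : ℂ}
  {y w : ℝ → H} {u v : l.L2 × l.L2}

lemma Represents.add (hu : l.Represents u y) (hv : l.Represents v w) :
    l.Represents (u + v) (y + w) :=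
  ⟨hu.memMaxDom.add hv.memMaxDom, (Lp.coeFn_add _ _).trans (hu.fst.add hv.fst),
    (Lp.coeFn_add _ _).trans ((hu.snd.add hv.snd).trans
      (expr_add hu.memMaxDom.memDomExpr hv.memMaxDom.memDomExpr).symm)⟩

lemma Represents.smul (hu : l.Represents u y) (c : ℂ) : l.Represents (c • u) (c • y) :=
  ⟨hu.memMaxDom.smul c, (Lp.coeFn_smul _ _).trans (hu.fst.const_smul c), by
    rw [expr_smul]
    exact (Lp.coeFn_smul _ _).trans (hu.snd.const_smul c)⟩

variable (l z) in
/-- The initial data of the square integrable solutions of `l[y] = z y`. -/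
def squareIntegrableData : Submodule ℂ (HilbertPow H (2 * n)) where
  carrier := {x | MemLp (fun t => coord H n 0 (l.fundSol z t x)) 2 l.measure}
  zero_mem' := by simp
  add_mem' {x y} hx hy := (memLp_congr_ae (Eventually.of_forall fun t => by simp)).1 (hx.add hy)
  smul_mem' c x hx :=
    (memLp_congr_ae (Eventually.of_forall fun t => by simp)).1 (hx.const_smul c)

lemma mem_squareIntegrableData {x : HilbertPow H (2 * n)} : x ∈ l.squareIntegrableData z ↔
    MemLp (fun t => coord H n 0 (l.fundSol z t x)) 2 l.measure := Iff.rfl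

variable (l z) in
/-- The square integrable solution with given initial data. -/
def solutionMap : l.squareIntegrableData z →ₗ[ℂ] l.L2 where
  toFun x := (mem_squareIntegrableData.1 x.2).toLp _
  map_add' x y := by
    refine Eq.trans ?_ (MemLp.toLp_add (mem_squareIntegrableData.1 x.2)
      (mem_squareIntegrableData.1 y.2))
    exact MemLp.toLp_congr _ _ (Eventually.of_forall fun t => by simp)
  map_smul' c x := by
    refine Eq.trans ?_ (MemLp.toLp_const_smul c (mem_squareIntegrableData.1 x.2))
    exact MemLp.toLp_congr _ _ (Eventually.of_forall fun t => by simp)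

lemma solutionMap_injective : Function.Injective (l.solutionMap z) := by
  rw [injective_iff_map_eq_zero]
  intro x hx
  refine Subtype.ext (eq_zero_of_fundSol_ae_eq_zero (l := l) (z := z) ?_)
  have h1 : l.solutionMap z x =ᵐ[l.measure] fun t => coord H n 0 (l.fundSol z t x) :=
    MemLp.coeFn_toLp x.2
  rw [hx] at h1
  filter_upwards [h1, Lp.coeFn_zero H 2 l.measure] with t h1 h2
  rw [← h1, h2]
  rfl

lemma Represents.quasiVec_mem {f : l.L2} (hu : l.Represents (f, z • f) y) :
    ∃ h : l.quasiVec y 0 ∈ l.squareIntegrableData z, l.solutionMap z ⟨_, h⟩ = f := by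
  have hae : f =ᵐ[l.measure] fun t => coord H n 0 (l.fundSol z t (l.quasiVec y 0)) := by
    filter_upwards [hu.fst, ae_restrict_mem l.measurableSet_interval] with t h1 h2
    rw [h1, ← hu.quasiVec_eq_fundSol rfl h2, coord_zero_quasiVec]
  have hm : l.quasiVec y 0 ∈ l.squareIntegrableData z := (memLp_congr_ae hae).1 (Lp.memLp f)
  refine ⟨hm, Lp.ext ?_⟩
  have h1 : l.solutionMap z ⟨_, hm⟩ =ᵐ[l.measure]
      fun t => coord H n 0 (l.fundSol z t (l.quasiVec y 0)) := MemLp.coeFn_toLp hm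
  exact h1.trans hae.symm

lemma halvesEquiv_quasiVec (y : ℝ → H) (t : ℝ) :
    halvesEquiv H n (l.quasiVec y t) = (l.vec1 y t, l.vec2 y t) :=
  Prod.ext (lowerHalf_quasiVec y t) (upperHalf_quasiVec y t)

/-- Defect elements correspond to their initial data: these must belong to a square integrable
solution and satisfy the adjoint boundary condition. -/
lemma defectSubspace_extension_eq_map : defectSubspace (l.extension θ) z =
    ((θ.adjoint.comap (halvesEquiv H n : HilbertPow H (2 * n) →ₗ[ℂ] _)).comap
      (l.squareIntegrableData z).subtype).map (l.solutionMap z) := by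
  ext f
  rw [Submodule.mem_map]
  constructor
  · intro hf
    obtain ⟨y, hy, hyθ⟩ := mem_adjoint_extension_iff.1 (mem_defectSubspace_iff.1 hf)
    obtain ⟨h1, h2⟩ := hy.quasiVec_mem
    refine ⟨⟨_, h1⟩, ?_, h2⟩
    change halvesEquiv H n (l.quasiVec y 0) ∈ θ.adjoint
    rwa [halvesEquiv_quasiVec]
  · rintro ⟨⟨x, hx⟩, hxθ, rfl⟩
    obtain ⟨u, y, hy, hy0, hu⟩ := exists_represents_fundSol hx
    have e : l.solutionMap z ⟨x, hx⟩ = u := Lp.ext ((MemLp.coeFn_toLp hx).trans hu.symm)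
    rw [e]
    refine mem_defectSubspace_iff.2 (mem_adjoint_extension_iff.2 ⟨y, hy, ?_⟩)
    rw [← halvesEquiv_quasiVec, hy0]
    exact hxθ

lemma rank_defectSubspace_extension : Module.rank ℂ (defectSubspace (l.extension θ) z) =
    Module.rank ℂ ↥(l.squareIntegrableData z ⊓
      θ.adjoint.comap (halvesEquiv H n : HilbertPow H (2 * n) →ₗ[ℂ] _)) := by
  rw [defectSubspace_extension_eq_map, ← Submodule.map_comap_subtype]
  exact (Submodule.equivMapOfInjective _ solutionMap_injective _).rank_eq.symm.trans
    (Submodule.equivMapOfInjective _ (Submodule.injective_subtype _) _).rank_eq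

/-- Given `x`, a maximal function `y₀` with initial data `x` is corrected by a `y` with data in `θ`
such that `l[y] - z y = l[y₀] - z y₀`. Such a `y` exists because the shifted adjoint of `L_θ` is
surjective. Then `y₀ - y` is a square integrable solution, and `x` is the sum of its data and those
of `y`. -/
lemma squareIntegrableData_sup_eq_top (hθ : IsSelfAdjointRelation θ) (hz : z.im ≠ 0) :
    l.squareIntegrableData z ⊔
      θ.comap (halvesEquiv H n : HilbertPow H (2 * n) →ₗ[ℂ] _) = ⊤ := by
  refine eq_top_iff.2 fun x _ => ?_
  obtain ⟨y₀, hy₀, hy₀x, -⟩ := l.exists_memMaxDom_vanishesAtEnd x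
  obtain ⟨u₀, hu₀⟩ := hy₀.exists_represents
  have hT := extension_le_adjoint (l := l) hθ.ge
  obtain ⟨g, g', hg, hgf⟩ := exists_mem_adjoint_sub_smul_eq (X := l.L2) (T := l.extension θ) hT hz
    (u₀.2 - z • u₀.1)
  obtain ⟨y, hy, hyθ⟩ := mem_adjoint_extension_iff.1 hg
  rw [hθ] at hyθ
  have hw := hu₀.add (hy.smul (-1))
  have e : u₀ + (-1 : ℂ) • (g, g') = (u₀.1 - g, z • (u₀.1 - g)) := by
    refine Prod.ext ?_ ?_
    · simp [sub_eq_add_neg]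
    · have : u₀.2 - g' = z • (u₀.1 - g) := by
        rw [eq_comm, ← sub_eq_zero, ← sub_eq_zero.2 hgf, smul_sub]
        abel
      rw [← this]
      simp [sub_eq_add_neg]
  rw [e] at hw
  obtain ⟨h1, -⟩ := hw.quasiVec_mem
  have h2 : x = l.quasiVec (y₀ + (-1 : ℂ) • y) 0 + l.quasiVec y 0 := by
    have hy' := hy.memMaxDom.smul (-1)
    rw [← hy₀x, ← quasiVec_add (hy₀.add hy').memDomExpr hy.memMaxDom.memDomExpr
      l.zero_mem_interval]
    congr 1
    funext t
    simp
  rw [h2]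
  refine Submodule.add_mem_sup h1 ?_
  change halvesEquiv H n (l.quasiVec y 0) ∈ θ
  rwa [halvesEquiv_quasiVec]

theorem toENat_rank_defectSubspace_extension_bot [FiniteDimensional ℂ H]
    (hθ : IsSelfAdjointRelation θ) (hz : z.im ≠ 0) :
    Cardinal.toENat (Module.rank ℂ (defectSubspace (l.extension ⊥) z)) =
      ((n * Module.finrank ℂ H : ℕ) : ℕ∞) +
        Cardinal.toENat (Module.rank ℂ (defectSubspace (l.extension θ) z)) := by
  have hX : Module.finrank ℂ (HilbertPow H n) = n * Module.finrank ℂ H := by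
    rw [(WithLp.linearEquiv 2 ℂ (Fin n → H)).finrank_eq, Module.finrank_pi_fintype]
    simp
  -- For `L₀` the adjoint imposes no condition on the initial data, so its defect subspace
  -- corresponds to all of `S_z`.
  have hbot : (⊥ : Submodule ℂ (HilbertPow H n × HilbertPow H n)).adjoint = ⊤ := by
    refine eq_top_iff.2 fun x _ => (Submodule.mem_adjoint_iff _ _).2 fun a b hab => ?_
    obtain ⟨rfl, rfl⟩ := Prod.mk_eq_zero.1 ((Submodule.mem_bot ℂ).1 hab)
    simp
  rw [rank_defectSubspace_extension, rank_defectSubspace_extension, hbot, Submodule.comap_top,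
    inf_top_eq, hθ, ← Module.finrank_eq_rank, ← Module.finrank_eq_rank, map_natCast, map_natCast]
  -- With `S_z + θ` of dimension `2n dim H` and `θ` of dimension `n dim H`, this gives `dim S_z = n
  -- dim H + dim (S_z ∩ θ)`.
  have h1 := Submodule.finrank_sup_add_finrank_inf_eq (l.squareIntegrableData z)
    (θ.comap (halvesEquiv H n : HilbertPow H (2 * n) →ₗ[ℂ] _))
  rw [squareIntegrableData_sup_eq_top hθ hz, finrank_top, (halvesEquiv H n).finrank_eq,
    Module.finrank_prod, hX] at h1
  have h2 : Module.finrank ℂ (θ.comap (halvesEquiv H n : HilbertPow H (2 * n) →ₗ[ℂ] _))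
      = n * Module.finrank ℂ H := by
    rw [← hX, ← finrank_of_isSelfAdjointRelation hθ]
    exact ((halvesEquiv H n).submoduleMap _ |>.finrank_eq).trans
      (by rw [Submodule.map_comap_eq_of_surjective (halvesEquiv H n).surjective])
  rw [h2] at h1
  norm_cast
  omega

end FiniteDimensional

end DiffExpr

end

theorem proposition3p14 {H : Type*} [NormedAddCommGroup H] [InnerProductSpace ℂ H]
    [CompleteSpace H] [TopologicalSpace.SeparableSpace H] {n : ℕ} (l : DiffExpr H n)
    (θ : Submodule ℂ (HilbertPow H n × HilbertPow H n)) (hθ : IsSelfAdjointRelation θ) :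
    List.TFAE
      [l.endDeficiencyPos θ = 0 ∧ l.endDeficiencyNeg θ = 0,
        ∃ K₀ K₁ : HilbertPow H n →L[ℂ] HilbertPow H n, IsSelfAdjointPair K₀ K₁ ∧
          ∃ z w : ℂ, 0 < z.im ∧ w.im < 0 ∧
            l.PhiNotSquareIntegrable K₀ K₁ z ∧ l.PhiNotSquareIntegrable K₀ K₁ w,
        ∀ K₀ K₁ : HilbertPow H n →L[ℂ] HilbertPow H n, IsSelfAdjointPair K₀ K₁ →
          ∀ z : ℂ, z.im ≠ 0 → l.PhiNotSquareIntegrable K₀ K₁ z] ∧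
    (FiniteDimensional ℂ H →
      ((l.endDeficiencyPos θ = 0 ∧ l.endDeficiencyNeg θ = 0) ↔
        (deficiencyIndexPos l.minimalOperator = ((n * Module.finrank ℂ H : ℕ) : ℕ∞) ∧
          deficiencyIndexNeg l.minimalOperator = ((n * Module.finrank ℂ H : ℕ) : ℕ∞)))) := by
  refine ⟨?_, fun _ => ?_⟩
  · rw [DiffExpr.endDeficiency_eq_zero_iff_isLimitPoint hθ]
    tfae_have 1 → 3 := fun h _ _ hK _ hz => h.phiNotSquareIntegrable hK hz
    tfae_have 3 → 2 := fun h => ⟨_, _, DiffExpr.isSelfAdjointPair_id_zero, Complex.I, -Complex.I,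
      by simp, by simp, h _ _ DiffExpr.isSelfAdjointPair_id_zero _ (by simp),
      h _ _ DiffExpr.isSelfAdjointPair_id_zero _ (by simp)⟩
    tfae_have 2 → 1 := fun ⟨_, _, hK, _, _, hz, hw, h₁, h₂⟩ =>
      DiffExpr.isLimitPoint_of_phiNotSquareIntegrable hK hz hw h₁ h₂
    tfae_finish
  -- The summand `n dim H` is finite and can be cancelled in `ℕ∞`; the case `a = ⊤` is excluded on
  -- both sides separately.
  · have key : ∀ a b : ℕ∞, b = ((n * Module.finrank ℂ H : ℕ) : ℕ∞) + a →
        (a = 0 ↔ b = ((n * Module.finrank ℂ H : ℕ) : ℕ∞)) := by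
      rintro a b rfl
      cases a with
      | top =>
        rw [add_top]
        exact ⟨fun h => absurd h (by simp), fun h => absurd h.symm (ENat.natCast_ne_top _)⟩
      | coe a => norm_cast; omega
    exact and_congr
      (key _ _ (DiffExpr.toENat_rank_defectSubspace_extension_bot hθ (by simp)))
      (key _ _ (DiffExpr.toENat_rank_defectSubspace_extension_bot hθ (by simp)))
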